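/- **Theorem 1.** Algorithms are multi-tape Turing machines with two transition functions. Such a machine is used as a non-deterministic algorithm (it accepts an input if some sequence of choices leads to acceptance) or as a classical probabilistic algorithm (in every step one of the two transition functions is chosen by an independent fair coin). It runs in time $T$ on an input if every computation path on that input halts within $T$ steps. Circuits are given to algorithms by their descriptions as words over a fixed finite alphabet. For a Boolean circuit $f:\{0,1\}^n\to\{0,1\}$ with gates AND, OR, NOT let $gap(f)=\sum_{x\in\{0,1\}^n}(-1)^{f(x)}$. Assume the following conjecture: for every constant $a>0$ there is a polynomial $p$ such that, whenever $T:\mathbb N\to\mathbb N$ and $A$ is a non-deterministic algorithm which, given any Boolean circuit $f:\{0,1\}^n\to\{0,1\}$ (any $n$) with at least one and at most $p(n)$ gates, runs in time $T(n)$ and accepts if $gap(f)\neq0$ and rejects (has no accepting path) if $gap(f)=0$, then $T(n)>2^{(1-a)n}$ for infinitely many $n$. The $N$-qubit DQC1 model with a unitary $U$ starts from the state $|0\rangle\langle0|\otimes I^{\otimes N-1}/2^{N-1}$, applies $U$, measures the first qubit in the computational basis and accepts if the result is $0$; its acceptance probability is $$p_{acc}=\mathrm{Tr}\Big[(|0\rangle\langle0|\otimes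 I^{\otimes N-1})\,U\Big(|0\rangle\langle0|\otimes\tfrac{I^{\otimes N-1}}{2^{N-1}}\Big)U^\dagger\Big].$$ A probabilistic algorithm samples $p_{acc}$ in time $\tau$ within a multiplicative error $\epsilon$ if, given the description of the circuit of $U$, it runs in time $T$ for some integer $T\le\tau$ and accepts with a probability $q_{acc}$ such that $|p_{acc}-q_{acc}|\le\epsilon\,p_{acc}$. Then for every constant $a>0$ there are polynomials $q,r$ and a family $(D_n)_{n\in\mathbb N}$ such that $D_n$ is an $N_n$-qubit DQC1 model with $N_n\le q(n)$ whose unitary is given by a circuit of at most $r(N_n)$ gates from $\{X, H, \text{Toffoli}\}$, and such that for every classical probabilistic algorithm there are infinitely many $n$ for which the algorithm does not sample the acceptance probability of $D_n$ in time $2^{(1-a)n}$ within any multiplicative error $0\le\epsilon<1$. -/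

import Mathlib

open Filter

/-! ## Boolean circuits -/

/-- Boolean circuits with `n` inputs and `s` gates, as straight-line programs. The wires are
numbered `0, …, n + s - 1`: first the inputs, then the gates in order; each gate (NOT, AND, OR)
reads wires that come before it. -/
inductive BoolCircuit (n : ℕ) : ℕ → Type
  | nil : BoolCircuit n 0
  | not {s : ℕ} (C : BoolCircuit n s) (i : Fin (n + s)) : BoolCircuit n (s + 1)
  | and {s : ℕ} (C : BoolCircuit n s) (i j : Fin (n + s)) : BoolCircuit n (s + 1)
  | or {s : ℕ} (C : BoolCircuit n s) (i j : Fin (n + s)) : BoolCircuit n (s + 1)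

/-- The values of all wires on input `x`. -/
def BoolCircuit.wires {n : ℕ} :
    {s : ℕ} → BoolCircuit n s → (Fin n → Bool) → Fin (n + s) → Bool
  | _, .nil, x => x
  | _, .not C i, x => Fin.snoc (α := fun _ => Bool) (C.wires x) (! C.wires x i)
  | _, .and C i j, x => Fin.snoc (α := fun _ => Bool) (C.wires x) (C.wires x i && C.wires x j)
  | _, .or C i j, x => Fin.snoc (α := fun _ => Bool) (C.wires x) (C.wires x i || C.wires x j)

/-- The function `{0,1}ⁿ → {0,1}` computed by a circuit with at least one gate: the value of
the last gate. -/
def BoolCircuit.eval {n s : ℕ} (C : BoolCircuit n (s + 1)) (x : Fin n → Bool) : Bool :=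
  C.wires x (Fin.last (n + s))

/-- `gap(f) = ∑_x (-1)^{f(x)}`. -/
def BoolCircuit.gap {n s : ℕ} (C : BoolCircuit n (s + 1)) : ℤ :=
  ∑ x : Fin n → Bool, (-1) ^ (C.eval x).toNat

/-! ## Quantum circuits and the one-clean-qubit model -/

/-- Elementary gates on `N` qubits: `X`, Hadamard, and Toffoli (controls `i`, `j`, target `k`). -/
inductive QGate (N : ℕ) : Type
  | x (i : Fin N) : QGate N
  | h (i : Fin N) : QGate N
  | toffoli (i j k : Fin N) (hij : i ≠ j) (hik : i ≠ k) (hjk : j ≠ k) : QGate N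

/-- Operators on `N` qubits, in the computational basis `{0,1}^N`. -/
abbrev QOp (N : ℕ) : Type := Matrix (Fin N → Bool) (Fin N → Bool) ℂ

/-- The unitary matrix of a gate; the entry `(z, y)` is `⟨z| g |y⟩`. -/
noncomputable def QGate.matrix {N : ℕ} : QGate N → QOp N
  | .x i => Matrix.of fun z y => if z = Function.update y i (! y i) then 1 else 0
  | .h i => Matrix.of fun z y =>
      if ∀ j, j ≠ i → z j = y j then
        (if z i && y i then -1 else 1) * ((Real.sqrt 2 : ℝ) : ℂ)⁻¹
      else 0
  | .toffoli i j k _ _ _ => Matrix.of fun z y =>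
      if z = Function.update y k (xor (y k) (y i && y j)) then 1 else 0

/-- The unitary of a sequence of gates, the head of the list being applied first. -/
noncomputable def circuitUnitary {N : ℕ} (gs : List (QGate N)) : QOp N :=
  gs.foldl (fun U g => g.matrix * U) 1

/-- The projector `|0⟩⟨0| ⊗ I^{⊗ m}` on `m + 1` qubits (the first qubit has index `0`). -/
def proj0 (m : ℕ) : QOp (m + 1) :=
  Matrix.diagonal fun y => if y 0 = false then 1 else 0

/-- Acceptance probability of the `(m + 1)`-qubit DQC1 model with unitary `U`:
`Tr[(|0⟩⟨0| ⊗ I^{⊗ m}) U (|0⟩⟨0| ⊗ I^{⊗ m} / 2^m) U†]`. -/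
noncomputable def dqc1AcceptProb {m : ℕ} (U : QOp (m + 1)) : ℝ :=
  (Matrix.trace (proj0 m * (U * (((2 : ℂ) ^ m)⁻¹ • proj0 m) * U.conjTranspose))).re

/-- A DQC1 model whose unitary is given by a circuit: one clean qubit (index `0`), `mixed`
completely mixed qubits, and a list of gates. -/
structure DQC1 where
  mixed : ℕ
  gates : List (QGate (mixed + 1))

/-- The total number `N` of qubits. -/
def DQC1.numQubits (D : DQC1) : ℕ := D.mixed + 1

/-- The acceptance probability `p_acc`. -/
noncomputable def DQC1.acceptProb (D : DQC1) : ℝ :=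
  dqc1AcceptProb (circuitUnitary D.gates)

/-! ## Descriptions of circuits as words over a finite alphabet -/

/-- The alphabet of the descriptions. -/
inductive Letter : Type
  | one | sep | bnot | band | bor | qx | qh | qtoffoli

/-- Self-delimiting unary code of a natural number. -/
def unary (k : ℕ) : List Letter := List.replicate k Letter.one ++ [Letter.sep]

/-- Description of a Boolean circuit: the number of inputs, then the gates in order. -/
def BoolCircuit.encode {n : ℕ} : {s : ℕ} → BoolCircuit n s → List Letter
  | _, .nil => unary n
  | _, .not C i => C.encode ++ Letter.bnot :: unary i
  | _, .and C i j => C.encode ++ Letter.band :: (unary i ++ unary j)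
  | _, .or C i j => C.encode ++ Letter.bor :: (unary i ++ unary j)

/-- Description of a quantum gate. -/
def QGate.encode {N : ℕ} : QGate N → List Letter
  | .x i => Letter.qx :: unary i
  | .h i => Letter.qh :: unary i
  | .toffoli i j k _ _ _ => Letter.qtoffoli :: (unary i ++ unary j ++ unary k)

/-- Description of a DQC1 model: the number of qubits, then the gates in order. -/
def DQC1.encode (D : DQC1) : List Letter :=
  unary D.numQubits ++ D.gates.flatMap QGate.encode

/-! ## Turing machines with a binary choice in every step -/

/-- A multi-tape Turing machine with two transition functions (one for each value of a bit).
There are `k + 1` two-way infinite tapes; a cell holds a blank (`none`), an input symbol or a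
work symbol. A state `q` with `verdict q = some b` is halting, and accepting iff `b = true`.
Choosing the bits freely gives a nondeterministic machine; choosing them uniformly at random
gives a probabilistic machine. -/
structure Machine where
  State : Type
  Work : Type
  [finState : Finite State]
  [finWork : Finite Work]
  k : ℕ
  start : State
  verdict : State → Option Bool
  /-- New state, and for each tape the symbol written and the move (`none`: stay). -/
  trans : Bool → State → (Fin (k + 1) → Option (Letter ⊕ Work)) →
    State × (Fin (k + 1) → Option (Letter ⊕ Work) × Option Turing.Dir)

namespace Machine

/-- A configuration: state and tapes with their heads. -/
structure Cfg (M : Machine) where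
  state : M.State
  tapes : Fin (M.k + 1) → Turing.Tape (Option (Letter ⊕ M.Work))

/-- The initial configuration: the word `w` on tape `0` with the head on its first symbol, all
other tapes blank. -/
def init (M : Machine) (w : List Letter) : M.Cfg where
  state := M.start
  tapes := fun j => if j = 0 then Turing.Tape.mk₁ (w.map fun s => some (Sum.inl s))
    else Turing.Tape.mk₁ []

/-- Write a symbol, then move. -/
def act {Γ : Type} [Inhabited Γ] (T : Turing.Tape Γ) (u : Γ × Option Turing.Dir) :
    Turing.Tape Γ :=
  match u.2 with
  | none => T.write u.1
  | some d => (T.write u.1).move d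

/-- One step with choice bit `b`; halting configurations stay as they are. -/
def step (M : Machine) (c : M.Cfg) (b : Bool) : M.Cfg :=
  match M.verdict c.state with
  | some _ => c
  | none =>
    let r := M.trans b c.state fun j => (c.tapes j).head
    { state := r.1, tapes := fun j => act (c.tapes j) (r.2 j) }

/-- The configuration reached on input `w` after `bs.length` steps with choice bits `bs`. -/
def run (M : Machine) (w : List Letter) (bs : List Bool) : M.Cfg :=
  bs.foldl M.step (M.init w)

/-- The outcome on input `w` after `bs.length` steps with choice bits `bs` (`none`: not halted). -/
def outcome (M : Machine) (w : List Letter) (bs : List Bool) : Option Bool :=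
  M.verdict (M.run w bs).state

/-- On input `w`, every computation path halts within `T` steps. -/
def HaltsWithin (M : Machine) (w : List Letter) (T : ℕ) : Prop :=
  ∀ bs : List Bool, bs.length = T → M.outcome w bs ≠ none

/-- Nondeterministic acceptance: some computation path accepts. -/
def NAccepts (M : Machine) (w : List Letter) : Prop :=
  ∃ bs : List Bool, M.outcome w bs = some true

/-- Probability that `M` has accepted `w` after `T` steps, with uniformly random bits. -/
noncomputable def acceptProb (M : Machine) (w : List Letter) (T : ℕ) : ℝ :=
  (Nat.card {c : Fin T → Bool // M.outcome w (List.ofFn c) = some true} : ℝ) / 2 ^ T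

/-- Given the description of `D`, the probabilistic machine `M` samples the acceptance
probability of `D` in time `τ` within the multiplicative error `ε`. -/
def Samples (M : Machine) (D : DQC1) (τ ε : ℝ) : Prop :=
  ∃ T : ℕ, (T : ℝ) ≤ τ ∧ M.HaltsWithin D.encode T ∧
    |D.acceptProb - M.acceptProb D.encode T| ≤ ε * D.acceptProb

end Machine

/-! ## The conjecture -/

/-- For every `a > 0` there is a polynomial size bound `p` such that every nondeterministic
`T(n)`-time algorithm which decides `gap(f) ≠ 0` for the `n`-input Boolean circuits `f` of size
at most `p(n)` has `T(n) > 2^{(1-a)n}` for infinitely many `n`. -/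
def GapConjecture : Prop :=
  ∀ a : ℝ, 0 < a → ∃ p : Polynomial ℕ, ∀ (M : Machine) (T : ℕ → ℕ),
    (∀ (n s : ℕ) (f : BoolCircuit n (s + 1)), s + 1 ≤ p.eval n →
      M.HaltsWithin f.encode (T n) ∧ (M.NAccepts f.encode ↔ f.gap ≠ 0)) →
    ∃ᶠ n : ℕ in atTop, (2 : ℝ) ^ ((1 - a) * (n : ℝ)) < (T n : ℝ)

/-! The core is a one-clean-qubit circuit built from a Boolean circuit `f` whose acceptance
probability vanishes exactly when `gap(f) = 0` (`BoolCircuit.acceptProb_toDQC1_eq_zero_iff`). A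
sampler with multiplicative error below `1` accepts with positive probability exactly when `p_acc >
0`. Read as a nondeterministic machine and run after a quadratic-time translation of `f`
(`runs_translation`, `Machine.after`), it therefore decides `gap(f) ≠ 0`, and the conjecture bounds
its running time from below.

The quantum part rests on one identity: `p_acc` is `2^{-m}` times the squared Frobenius norm of the
block `Π U Π` with `Π = |0⟩⟨0| ⊗ I`. Every wire of `f` has a mixed qubit, and one more mixed qubit
is an auxiliary bit `z`. Let `V` be the diagonal involution with sign `(-1)^z`, times `-1` where the
wires form a correct computation with output different from `z`. Let `P` project the wires and `z`
onto one vector of the Hadamard basis. Then `P V P = c P`, where `c` is the mean sign. Incorrect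
wire values cancel between `z = 0` and `z = 1`, and the correct ones give `c = gap(f) / 2^{n+s}`
(`BoolCircuit.mean_phase`). The square of `(1 - 2P) V` is a product of two reflections, whose square
is `1` iff they commute, iff `c` is `0` or `±1` (`reflections_pow_eq_one_iff`); and `|gap(f)| ≤ 2^n`
rules out `±1` as soon as there is a gate.

To move this operator into the block, each of the reflections `1 - 2P` and `1 - 2E`, where `E` marks
the correct computations with output different from `z`, becomes a flip of the clean qubit
controlled by its projector. On `|-⟩` such a flip is the reflection, on `|+⟩` it is trivial. For `U
= X R^4`, with `R` one round, the block is `(1 - W) / 2` with `W = ((1 - 2P) V)^4`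
(`compress_eq_zero_iff`). The controls are evaluated without clean ancillas, by commutators of
Toffoli gates on qubits in unknown states (`Toggles`).

A single family that defeats all machines comes from diagonalisation: up to renaming there are
countably many machines, each fails at infinitely many sizes (`frequently_not_samples`), and
increasing sizes are chosen so that every machine is treated infinitely often. -/

/-! ## Stacks on tapes and program fragments -/

/-- The alphabet of the tapes of a machine with work symbols `W`. -/
abbrev Cell (W : Type) : Type := Option (Letter ⊕ W)

/-- The letter in a cell, if any. -/
def Cell.letter {W : Type} : Cell W → Option Letter
  | some (Sum.inl a) => some a
  | _ => none

/-- A stack of letters as a tape, the head being on the top of the stack. -/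
def stackTape (W : Type) (l : List Letter) : Turing.Tape (Cell W) :=
  Turing.Tape.mk₁ (l.map fun s => some (Sum.inl s))

theorem letter_head_stackTape (W : Type) (l : List Letter) :
    Cell.letter (stackTape W l).head = l.head? := by
  cases l <;> rfl

/-- Half tapes are words up to trailing blanks, so an erased cell left behind the head leaves no
trace. This makes stack operations exact equalities of tapes. -/
theorem listBlank_cons_none (W : Type) :
    Turing.ListBlank.cons (none : Cell W) (Turing.ListBlank.mk []) = Turing.ListBlank.mk [] := by
  have h := Turing.ListBlank.cons_head_tail (Turing.ListBlank.mk ([] : List (Cell W)))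
  exact h

theorem stackTape_push (W : Type) (l : List Letter) (a : Letter) :
    ((stackTape W l).move Turing.Dir.left).write (some (Sum.inl a)) = stackTape W (a :: l) := by
  simp only [stackTape, Turing.Tape.mk₁, Turing.Tape.mk₂, Turing.Tape.move_left_mk',
    Turing.Tape.write_mk', List.map_cons]
  rw [Turing.ListBlank.tail_cons, Turing.ListBlank.cons_mk]
  rfl

/-- The empty stack is included: the head then moves over a blank tape, which does not change it, in
accordance with `[].tail = []`. -/
theorem stackTape_pop (W : Type) (l : List Letter) :
    ((stackTape W l).write none).move Turing.Dir.right = stackTape W l.tail := by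
  cases l with
  | nil =>
    simp only [stackTape, Turing.Tape.mk₁, Turing.Tape.mk₂, List.map_nil, List.tail_nil]
    have h : (Turing.Tape.mk' (Turing.ListBlank.mk []) (Turing.ListBlank.mk [])).write none =
      Turing.Tape.mk' (Turing.ListBlank.mk ([] : List (Cell W))) (Turing.ListBlank.mk []) := rfl
    rw [h, Turing.Tape.move_right_mk']
    have h2 : (Turing.ListBlank.mk ([] : List (Cell W))).head = none := rfl
    rw [h2, listBlank_cons_none]; rfl
  | cons a l =>
    simp only [stackTape, Turing.Tape.mk₁, Turing.Tape.mk₂, List.map_cons, List.tail_cons]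
    rw [← Turing.ListBlank.cons_mk, Turing.Tape.write_mk', Turing.Tape.move_right_mk',
      Turing.ListBlank.head_cons, Turing.ListBlank.tail_cons, Turing.ListBlank.tail_cons,
      listBlank_cons_none]

/-- A deterministic program fragment: a multi-tape transition table with one entry and one exit
(the next state `none`). -/
structure Frag (ι W : Type) where
  S : Type
  [finS : Finite S]
  start : S
  trans : S → (ι → Cell W) → Option S × (ι → Cell W × Option Turing.Dir)

attribute [instance] Frag.finS

namespace Frag

variable {ι W : Type}

/-- `F.Path s T T' t`: started in state `s` on tapes `T`, the fragment exits after exactly `t`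
steps with tapes `T'`. -/
inductive Path (F : Frag ι W) : F.S → (ι → Turing.Tape (Cell W)) →
    (ι → Turing.Tape (Cell W)) → ℕ → Prop
  | exit {s T u} (h : F.trans s (fun j => (T j).head) = (none, u)) :
      Path F s T (fun j => Machine.act (T j) (u j)) 1
  | step {s T u s' T' t} (h : F.trans s (fun j => (T j).head) = (some s', u))
      (p : Path F s' (fun j => Machine.act (T j) (u j)) T' t) : Path F s T T' (t + 1)

theorem Path.of_eq {F : Frag ι W} {s : F.S} {T T' T'' : ι → Turing.Tape (Cell W)} {t : ℕ}
    (p : F.Path s T T' t) (h : T'' = T') : F.Path s T T'' t := h ▸ p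

/-- The tapes holding the stacks `σ`. -/
def tapesOf (W : Type) (σ : ι → List Letter) : ι → Turing.Tape (Cell W) :=
  fun j => stackTape W (σ j)

/-- The fragment turns the stacks `σ` into the stacks `σ'` in at most `B` steps. -/
def RunsIn (F : Frag ι W) (σ σ' : ι → List Letter) (B : ℕ) : Prop :=
  ∃ t ≤ B, F.Path F.start (tapesOf W σ) (tapesOf W σ') t

theorem RunsIn.mono {F : Frag ι W} {σ σ' : ι → List Letter} {B B' : ℕ} (h : F.RunsIn σ σ' B)
    (hB : B ≤ B') : F.RunsIn σ σ' B' := by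
  obtain ⟨t, ht, p⟩ := h
  exact ⟨t, ht.trans hB, p⟩

theorem RunsIn.cast {F : Frag ι W} {σ σ' σ'' : ι → List Letter} {B B' : ℕ} (h : F.RunsIn σ σ' B)
    (hB : B ≤ B') (hσ : σ'' = σ') : F.RunsIn σ σ'' B' := hσ ▸ h.mono hB

/-- Leave a tape unchanged. -/
def keep (h : ι → Cell W) : ι → Cell W × Option Turing.Dir := fun j => (h j, none)

theorem act_keep (T : ι → Turing.Tape (Cell W)) (j : ι) :
    Machine.act (T j) (keep (fun j => (T j).head) j) = T j := by
  simp [Machine.act, keep, Turing.Tape.write_self]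

section
variable [DecidableEq ι]

/-- Push the letter `a` onto the stack `r`. -/
def push (r : ι) (a : Letter) : Frag ι W where
  S := Bool
  start := false
  trans s h := match s with
    | false => (some true, Function.update (keep h) r (h r, some Turing.Dir.left))
    | true => (none, Function.update (keep h) r (some (Sum.inl a), none))

theorem runs_push (r : ι) (a : Letter) (σ : ι → List Letter) :
    (push r a : Frag ι W).RunsIn σ (Function.update σ r (a :: σ r)) 2 := by
  refine ⟨2, le_rfl, ?_⟩
  have p2 := Path.exit (F := (push r a : Frag ι W)) (s := true)
    (T := fun j => Machine.act (tapesOf W σ j) (Function.update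
      (keep fun j => (tapesOf W σ j).head) r ((tapesOf W σ r).head, some Turing.Dir.left) j)) rfl
  have p1 := Path.step (F := (push r a : Frag ι W)) (s := false) (T := tapesOf W σ) rfl p2
  refine p1.of_eq ?_
  funext j
  by_cases hj : j = r
  · subst hj
    simp [Machine.act, tapesOf, Turing.Tape.write_self, stackTape_push]
  · simp [Machine.act, tapesOf, hj, keep, Turing.Tape.write_self]

/-- Remove the top of the stack `r`. -/
def pop (r : ι) : Frag ι W where
  S := Unit
  start := ()
  trans _ h := (none, Function.update (keep h) r (none, some Turing.Dir.right))

theorem runs_pop (r : ι) (σ : ι → List Letter) :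
    (pop r : Frag ι W).RunsIn σ (Function.update σ r (σ r).tail) 1 := by
  refine ⟨1, le_rfl, ?_⟩
  have p1 := Path.exit (F := (pop r : Frag ι W)) (s := ()) (T := tapesOf W σ) rfl
  refine p1.of_eq ?_
  funext j
  by_cases hj : j = r
  · subst hj
    simp [Machine.act, tapesOf, stackTape_pop]
  · simp [Machine.act, tapesOf, hj, keep, Turing.Tape.write_self]

end

/-- Do nothing. -/
def skip : Frag ι W where
  S := Unit
  start := ()
  trans _ h := (none, keep h)

theorem runs_skip (σ : ι → List Letter) : (skip : Frag ι W).RunsIn σ σ 1 := by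
  refine ⟨1, le_rfl, ?_⟩
  have p1 := Path.exit (F := (skip : Frag ι W)) (s := ()) (T := tapesOf W σ) rfl
  refine p1.of_eq ?_
  funext j
  rw [act_keep]

/-- Sequential composition. -/
def seq (F G : Frag ι W) : Frag ι W where
  S := F.S ⊕ G.S
  start := Sum.inl F.start
  trans s h := match s with
    | Sum.inl s => (some ((F.trans s h).1.elim (Sum.inr G.start) Sum.inl), (F.trans s h).2)
    | Sum.inr s => ((G.trans s h).1.map Sum.inr, (G.trans s h).2)

theorem path_seq_inr {F G : Frag ι W} {s : G.S} {T T' : ι → Turing.Tape (Cell W)} {t : ℕ}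
    (p : G.Path s T T' t) : (seq F G).Path (Sum.inr s) T T' t := by
  induction p with
  | exit h => exact Path.exit (by simp [seq, h])
  | step h _ ih => exact Path.step (by simp [seq, h]) ih

/-- The exit transition of `F` leads directly into the start state of `G`, so the times add without
an extra step. -/
theorem path_seq_inl {F G : Frag ι W} {s : F.S} {T T' T'' : ι → Turing.Tape (Cell W)} {t t' : ℕ}
    (p : F.Path s T T' t) (q : G.Path G.start T' T'' t') :
    (seq F G).Path (Sum.inl s) T T'' (t + t') := by
  induction p with
  | exit h =>
    rw [Nat.add_comm]
    exact Path.step (by simp [seq, h]) (path_seq_inr q)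
  | step h _ ih =>
    rw [Nat.add_right_comm]
    exact Path.step (by simp [seq, h]) (ih q)

theorem RunsIn.seq {F G : Frag ι W} {σ σ' σ'' : ι → List Letter} {B B' : ℕ}
    (hF : F.RunsIn σ σ' B) (hG : G.RunsIn σ' σ'' B') : (seq F G).RunsIn σ σ'' (B + B') := by
  obtain ⟨t, ht, p⟩ := hF
  obtain ⟨t', ht', q⟩ := hG
  exact ⟨t + t', by omega, path_seq_inl p q⟩

/-- Sequential composition of a list of fragments. -/
def seqs : List (Frag ι W) → Frag ι W
  | [] => skip
  | F :: Fs => seq F (seqs Fs)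

theorem runs_seqs_nil (σ : ι → List Letter) : (seqs [] : Frag ι W).RunsIn σ σ 1 := runs_skip σ

theorem RunsIn.seqs_cons {F : Frag ι W} {Fs : List (Frag ι W)} {σ σ' σ'' : ι → List Letter}
    {B B' : ℕ} (hF : F.RunsIn σ σ' B) (hG : (seqs Fs).RunsIn σ' σ'' B') :
    (seqs (F :: Fs)).RunsIn σ σ'' (B + B') := hF.seq hG

/-- Branch on the top of the stack `r`. -/
def ite (r : ι) (c : Option Letter → Bool) (F G : Frag ι W) : Frag ι W where
  S := Option (F.S ⊕ G.S)
  start := none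
  trans s h := match s with
    | none => (some (some (if c (h r).letter then Sum.inl F.start else Sum.inr G.start)), keep h)
    | some (Sum.inl s) => ((F.trans s h).1.map (some ∘ Sum.inl), (F.trans s h).2)
    | some (Sum.inr s) => ((G.trans s h).1.map (some ∘ Sum.inr), (G.trans s h).2)

theorem path_ite_inl {r : ι} {c : Option Letter → Bool} {F G : Frag ι W} {s : F.S}
    {T T' : ι → Turing.Tape (Cell W)} {t : ℕ}
    (p : F.Path s T T' t) : (ite r c F G).Path (some (Sum.inl s)) T T' t := by
  induction p with
  | exit h => exact Path.exit (by simp [ite, h])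
  | step h _ ih => exact Path.step (by simp [ite, h]) ih

theorem path_ite_inr {r : ι} {c : Option Letter → Bool} {F G : Frag ι W} {s : G.S}
    {T T' : ι → Turing.Tape (Cell W)} {t : ℕ}
    (p : G.Path s T T' t) : (ite r c F G).Path (some (Sum.inr s)) T T' t := by
  induction p with
  | exit h => exact Path.exit (by simp [ite, h])
  | step h _ ih => exact Path.step (by simp [ite, h]) ih

theorem RunsIn.ite_true {r : ι} {c : Option Letter → Bool} {F G : Frag ι W}
    {σ σ' : ι → List Letter} {B : ℕ} (hc : c (σ r).head? = true) (hF : F.RunsIn σ σ' B) :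
    (ite r c F G).RunsIn σ σ' (B + 1) := by
  obtain ⟨t, ht, p⟩ := hF
  refine ⟨t + 1, by omega, Path.step (s' := some (Sum.inl F.start))
    (u := keep fun j => (tapesOf W σ j).head) ?_ ?_⟩
  · simp [ite, tapesOf, letter_head_stackTape, hc]
  · simp only [act_keep]
    exact path_ite_inl p

theorem RunsIn.ite_false {r : ι} {c : Option Letter → Bool} {F G : Frag ι W}
    {σ σ' : ι → List Letter} {B : ℕ} (hc : c (σ r).head? = false) (hG : G.RunsIn σ σ' B) :
    (ite r c F G).RunsIn σ σ' (B + 1) := by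
  obtain ⟨t, ht, p⟩ := hG
  refine ⟨t + 1, by omega, Path.step (s' := some (Sum.inr G.start))
    (u := keep fun j => (tapesOf W σ j).head) ?_ ?_⟩
  · simp [ite, tapesOf, letter_head_stackTape, hc]
  · simp only [act_keep]
    exact path_ite_inr p

/-- Repeat `F` while the top of the stack `r` satisfies `c`. -/
def loop (r : ι) (c : Option Letter → Bool) (F : Frag ι W) : Frag ι W where
  S := Option F.S
  start := none
  trans s h := match s with
    | none => (if c (h r).letter then some (some F.start) else none, keep h)
    | some s => (some (F.trans s h).1, (F.trans s h).2)

/-- The exit transition of the body returns to the test state `none`. Only the test itself costs an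
extra step per round. -/
theorem path_loop {r : ι} {c : Option Letter → Bool} {F : Frag ι W} {s : F.S}
    {T T' T'' : ι → Turing.Tape (Cell W)} {t t' : ℕ}
    (p : F.Path s T T' t) (q : (loop r c F).Path none T' T'' t') :
    (loop r c F).Path (some s) T T'' (t + t') := by
  induction p with
  | exit h =>
    rw [Nat.add_comm]
    exact Path.step (by simp [loop, h]) q
  | step h _ ih =>
    rw [Nat.add_right_comm]
    exact Path.step (by simp [loop, h]) (ih q)

theorem runs_loop_exit {r : ι} {c : Option Letter → Bool} {F : Frag ι W}
    {σ : ι → List Letter} (hc : c (σ r).head? = false) : (loop r c F).RunsIn σ σ 1 := by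
  refine ⟨1, le_rfl, ?_⟩
  have p := Path.exit (F := loop r c F) (s := none) (T := tapesOf W σ)
    (u := keep fun j => (tapesOf W σ j).head)
    (by simp [loop, tapesOf, letter_head_stackTape, hc])
  simp only [act_keep] at p
  exact p

theorem RunsIn.loop_step {r : ι} {c : Option Letter → Bool} {F : Frag ι W}
    {σ σ' σ'' : ι → List Letter} {B B' : ℕ} (hc : c (σ r).head? = true)
    (hF : F.RunsIn σ σ' B) (h : (loop r c F).RunsIn σ' σ'' B') :
    (loop r c F).RunsIn σ σ'' (B + B' + 1) := by
  obtain ⟨t, ht, p⟩ := hF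
  obtain ⟨t', ht', q⟩ := h
  refine ⟨t + t' + 1, by omega, Path.step (s' := some F.start)
    (u := keep fun j => (tapesOf W σ j).head) ?_ ?_⟩
  · simp [loop, tapesOf, letter_head_stackTape, hc]
  · simp only [act_keep]
    exact path_loop p q

end Frag

/-! ## Running a machine after a translation -/

namespace Machine

attribute [instance] Machine.finState Machine.finWork

variable {m : ℕ} (M : Machine) (F : Frag (Fin m ⊕ Fin (M.k + 1)) M.Work)

/-- The tapes of the combined machine: `m` own tapes, then the tapes of `M`. -/
def tapeEquiv (M : Machine) (m : ℕ) : Fin m ⊕ Fin (M.k + 1) ≃ Fin (m + M.k + 1) :=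
  finSumFinEquiv

/-- First the fragment `F`, which uses `m` tapes of its own and the tapes of `M`, then `M`. -/
def after : Machine where
  State := F.S ⊕ M.State
  Work := M.Work
  k := m + M.k
  start := Sum.inl F.start
  verdict := Sum.elim (fun _ => none) M.verdict
  trans b s h := match s with
    | Sum.inl s =>
      let r := F.trans s fun j => h (tapeEquiv M m j)
      (r.1.elim (Sum.inr M.start) Sum.inl, fun j => r.2 ((tapeEquiv M m).symm j))
    | Sum.inr s =>
      let r := M.trans b s fun j => h (tapeEquiv M m (Sum.inr j))
      (Sum.inr r.1, fun j => Sum.elim (fun i => (h (tapeEquiv M m (Sum.inl i)),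
        none)) r.2 ((tapeEquiv M m).symm j))

/-- The configuration of the combined machine while `F` runs. -/
def afterCfg (s : (after M F).State)
    (T : Fin m ⊕ Fin (M.k + 1) → Turing.Tape (Cell M.Work)) : (after M F).Cfg where
  state := s
  tapes := fun j => T ((tapeEquiv M m).symm j)

/-- States of `F` are never halting in the combined machine, and the choice bit has no influence on
them. -/
theorem step_afterCfg_inl (s : F.S) (T : Fin m ⊕ Fin (M.k + 1) → Turing.Tape (Cell M.Work))
    (b : Bool) :
    (after M F).step (afterCfg M F (Sum.inl s) T) b =
      afterCfg M F ((F.trans s fun j => (T j).head).1.elim (Sum.inr M.start) Sum.inl)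
        (fun j => act (T j) ((F.trans s fun j => (T j).head).2 j)) := by
  simp [step, afterCfg, after]
  rfl

/-- The tapes belonging to `F` stay frozen while `M` runs, whatever they hold. Hence the translation
need not clean up its own stacks. -/
theorem step_afterCfg_inr (c : M.Cfg) (T : Fin m → Turing.Tape (Cell M.Work)) (b : Bool) :
    (after M F).step (afterCfg M F (Sum.inr c.state) (Sum.elim T c.tapes)) b =
      afterCfg M F (Sum.inr (M.step c b).state) (Sum.elim T (M.step c b).tapes) := by
  rcases h : M.verdict c.state with _ | v
  · simp only [step, afterCfg, after, h, Sum.elim_inr]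
    simp only [Equiv.symm_apply_apply, Sum.elim_inr]
    refine congrArg (Cfg.mk (M := after M F) _) (funext fun j => ?_)
    rcases hj : (tapeEquiv M m).symm j with i | i
    · exact Turing.Tape.write_self _
    · rfl
  · simp [step, afterCfg, after, h]

theorem foldl_step_afterCfg_inr (T : Fin m → Turing.Tape (Cell M.Work)) (bs : List Bool) :
    ∀ c : M.Cfg, bs.foldl (after M F).step (afterCfg M F (Sum.inr c.state) (Sum.elim T c.tapes)) =
      afterCfg M F (Sum.inr (bs.foldl M.step c).state)
        (Sum.elim T (bs.foldl M.step c).tapes) := by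
  induction bs with
  | nil => intro c; rfl
  | cons b bs ih => intro c; simp only [List.foldl_cons]; rw [step_afterCfg_inr, ih]

theorem foldl_step_afterCfg_inl {s : F.S}
    {T T' : Fin m ⊕ Fin (M.k + 1) → Turing.Tape (Cell M.Work)} {t : ℕ} (p : F.Path s T T' t) :
    ∀ bs : List Bool, bs.length = t →
      bs.foldl (after M F).step (afterCfg M F (Sum.inl s) T) =
        afterCfg M F (Sum.inr M.start) T' := by
  induction p with
  | exit h =>
    intro bs hbs
    obtain ⟨b, rfl⟩ := List.length_eq_one_iff.1 hbs
    simp only [List.foldl_cons, List.foldl_nil, step_afterCfg_inl, h]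
    rfl
  | step h _ ih =>
    intro bs hbs
    cases bs with
    | nil => simp at hbs
    | cons b bs =>
      simp only [List.foldl_cons]
      rw [step_afterCfg_inl, h]
      exact ih bs (by simpa using hbs)

/-- This excludes any verdict before the translation has finished, so no path can accept early. -/
theorem foldl_step_afterCfg_inl_lt {s : F.S}
    {T T' : Fin m ⊕ Fin (M.k + 1) → Turing.Tape (Cell M.Work)} {t : ℕ} (p : F.Path s T T' t) :
    ∀ bs : List Bool, bs.length < t →
      ∃ s', (bs.foldl (after M F).step (afterCfg M F (Sum.inl s) T)).state = Sum.inl s' := by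
  induction p with
  | exit h =>
    intro bs hbs
    obtain rfl : bs = [] := List.length_eq_zero_iff.1 (by omega)
    exact ⟨_, rfl⟩
  | step h _ ih =>
    intro bs hbs
    cases bs with
    | nil => exact ⟨_, rfl⟩
    | cons b bs =>
      simp only [List.foldl_cons]
      rw [step_afterCfg_inl, h]
      exact ih bs (by simpa using hbs)

theorem init_after (hm : 0 < m) (w : List Letter) :
    (after M F).init w = afterCfg M F (Sum.inl F.start)
      (Frag.tapesOf M.Work (Function.update (fun _ => []) (Sum.inl ⟨0, hm⟩) w)) := by
  refine congrArg (Cfg.mk (M := after M F) _) (funext fun (j : Fin (m + M.k + 1)) => ?_)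
  have h0 : (tapeEquiv M m).symm (0 : Fin (m + M.k + 1)) = Sum.inl ⟨0, hm⟩ := by
    rw [Equiv.symm_apply_eq]; rfl
  change (if j = 0 then Turing.Tape.mk₁ (w.map fun s => some (Sum.inl s))
    else Turing.Tape.mk₁ []) = stackTape M.Work (Function.update (fun _ => []) (Sum.inl ⟨0, hm⟩) w
      ((tapeEquiv M m).symm j))
  by_cases hj : j = 0
  · rw [hj, h0, Function.update_self]
    rfl
  · have h1 : (tapeEquiv M m).symm j ≠ Sum.inl ⟨0, hm⟩ := by
      rw [← h0]
      exact fun h => hj ((tapeEquiv M m).symm.injective h)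
    rw [if_neg hj, Function.update_of_ne h1]
    rfl

/-- Outcomes of the combined machine, when `F` translates `w` to `w'`. -/
theorem outcome_after (hm : 0 < m) {w w' : List Letter} {σ : Fin m ⊕ Fin (M.k + 1) → List Letter}
    {t : ℕ}
    (p : F.Path F.start
      (Frag.tapesOf M.Work (Function.update (fun _ => []) (Sum.inl ⟨0, hm⟩) w))
      (Frag.tapesOf M.Work σ) t)
    (hσ : ∀ j, σ (Sum.inr j) = if j = 0 then w' else []) (bs : List Bool) :
    (after M F).outcome w bs = if bs.length < t then none else M.outcome w' (bs.drop t) := by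
  unfold outcome run
  rw [init_after M F hm]
  split_ifs with h
  · obtain ⟨s', hs'⟩ := foldl_step_afterCfg_inl_lt M F p bs h
    rw [hs']; rfl
  · rw [← List.take_append_drop t bs, List.foldl_append,
      foldl_step_afterCfg_inl M F p (bs.take t) (by simp; omega)]
    have hinit : Frag.tapesOf M.Work σ =
        Sum.elim (fun i => stackTape M.Work (σ (Sum.inl i))) (M.init w').tapes := by
      funext j
      rcases j with i | i
      · rfl
      · by_cases hi : i = 0 <;> simp [Frag.tapesOf, hσ, init, hi, stackTape]
    rw [hinit]
    have := foldl_step_afterCfg_inr M F (fun i => stackTape M.Work (σ (Sum.inl i)))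
      ((bs.take t ++ bs.drop t).drop t) (M.init w')
    rw [List.take_append_drop] at this ⊢
    have hs : (M.init w').state = M.start := rfl
    rw [hs] at this
    rw [this]
    rfl

/-! ### Halting within a time bound, and positive acceptance probability. -/

theorem step_of_halted {c : M.Cfg} (h : M.verdict c.state ≠ none) (b : Bool) :
    M.step c b = c := by
  unfold step
  split <;> simp_all

theorem foldl_step_of_halted {c : M.Cfg} (h : M.verdict c.state ≠ none) (bs : List Bool) :
    bs.foldl M.step c = c := by
  induction bs with
  | nil => rfl
  | cons b bs ih => rw [List.foldl_cons, step_of_halted M h, ih]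

theorem outcome_append {w : List Letter} {bs : List Bool} (h : M.outcome w bs ≠ none)
    (cs : List Bool) : M.outcome w (bs ++ cs) = M.outcome w bs := by
  unfold outcome run at *
  rw [List.foldl_append, foldl_step_of_halted M h]

variable {M} in
theorem HaltsWithin.outcome_take {w : List Letter} {T : ℕ} (h : M.HaltsWithin w T)
    {bs : List Bool} (hbs : T ≤ bs.length) : M.outcome w bs = M.outcome w (bs.take T) := by
  conv_lhs => rw [← List.take_append_drop T bs]
  exact outcome_append M (h _ (by simpa using hbs)) _

variable {M} in
theorem HaltsWithin.mono {w : List Letter} {T T' : ℕ} (h : M.HaltsWithin w T)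
    (hT : T ≤ T') : M.HaltsWithin w T' := by
  intro bs hbs
  rw [h.outcome_take (by omega)]
  exact h _ (by simp; omega)

/-- A machine that halts within `T` steps accepts with positive probability iff it accepts
nondeterministically. -/
theorem acceptProb_ne_zero_iff {w : List Letter} {T : ℕ} (h : M.HaltsWithin w T) :
    M.acceptProb w T ≠ 0 ↔ M.NAccepts w := by
  have hcard : M.acceptProb w T ≠ 0 ↔
      Nonempty {c : Fin T → Bool // M.outcome w (List.ofFn c) = some true} := by
    unfold acceptProb
    rw [div_ne_zero_iff, Nat.cast_ne_zero, Nat.card_ne_zero]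
    exact ⟨fun h => h.1.1, fun h => ⟨⟨h, inferInstance⟩, by positivity⟩⟩
  rw [hcard]
  constructor
  · rintro ⟨c, hc⟩
    exact ⟨_, hc⟩
  · rintro ⟨bs, hbs⟩
    -- An accepting path may be shorter or longer than `T`. Padding it keeps the outcome because it
    -- has halted; cutting it at `T` keeps the outcome because every path has halted by then.
    have h1 : M.outcome w ((bs ++ List.replicate T false).take T) = some true := by
      rw [← h.outcome_take (by simp), outcome_append M (by simp [hbs]), hbs]
    refine ⟨⟨fun i => ((bs ++ List.replicate T false).take T).get (i.cast (by simp)), ?_⟩⟩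
    rw [← h1]
    congr 1
    apply List.ext_get
    · simp
    · intro i h1 h2; simp

theorem haltsWithin_after (hm : 0 < m) {w w' : List Letter}
    {σ : Fin m ⊕ Fin (M.k + 1) → List Letter} {B T : ℕ}
    (p : F.RunsIn (Function.update (fun _ => []) (Sum.inl ⟨0, hm⟩) w) σ B)
    (hσ : ∀ j, σ (Sum.inr j) = if j = 0 then w' else []) (h : M.HaltsWithin w' T) :
    (after M F).HaltsWithin w (B + T) := by
  obtain ⟨t, ht, p⟩ := p
  apply HaltsWithin.mono (T := t + T) _ (by omega)
  intro bs hbs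
  rw [outcome_after M F hm p hσ, if_neg (by omega)]
  exact h _ (by simp; omega)

theorem nAccepts_after (hm : 0 < m) {w w' : List Letter}
    {σ : Fin m ⊕ Fin (M.k + 1) → List Letter} {B : ℕ}
    (p : F.RunsIn (Function.update (fun _ => []) (Sum.inl ⟨0, hm⟩) w) σ B)
    (hσ : ∀ j, σ (Sum.inr j) = if j = 0 then w' else []) :
    (after M F).NAccepts w ↔ M.NAccepts w' := by
  obtain ⟨t, ht, p⟩ := p
  constructor
  · rintro ⟨bs, hbs⟩
    rw [outcome_after M F hm p hσ] at hbs
    split_ifs at hbs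
    exact ⟨_, hbs⟩
  · rintro ⟨bs, hbs⟩
    -- The bits consumed by the translation are arbitrary, since it is deterministic.
    refine ⟨List.replicate t false ++ bs, ?_⟩
    rw [outcome_after M F hm p hσ, if_neg (by simp)]
    simpa using hbs

end Machine

/-! ## Gate lists with indices in an arbitrary type -/

/-- Gates whose qubits are named by elements of `I`. -/
inductive RGate (I : Type) : Type
  | x (i : I) : RGate I
  | h (i : I) : RGate I
  | tof (i j k : I) : RGate I

namespace RGate

/-- Rename the qubits. -/
def map {I J : Type} (f : I → J) : RGate I → RGate J
  | x i => x (f i)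
  | h i => h (f i)
  | tof i j k => tof (f i) (f j) (f k)

/-- Description of a gate. -/
def enc : RGate ℕ → List Letter
  | x i => Letter.qx :: unary i
  | h i => Letter.qh :: unary i
  | tof i j k => Letter.qtoffoli :: (unary i ++ unary j ++ unary k)

/-- The gate acts on distinct qubits with indices below `N`. -/
def Valid (N : ℕ) : RGate ℕ → Prop
  | x i => i < N
  | h i => i < N
  | tof i j k => i < N ∧ j < N ∧ k < N ∧ i ≠ j ∧ i ≠ k ∧ j ≠ k

/-- The gate on `N` qubits as a circuit; nothing if it is not valid. -/
def toCircuit (N : ℕ) : RGate ℕ → List (QGate N)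
  | x i => if hi : i < N then [QGate.x ⟨i, hi⟩] else []
  | h i => if hi : i < N then [QGate.h ⟨i, hi⟩] else []
  | tof i j k =>
    if hv : i < N ∧ j < N ∧ k < N ∧ i ≠ j ∧ i ≠ k ∧ j ≠ k then
      [QGate.toffoli ⟨i, hv.1⟩ ⟨j, hv.2.1⟩ ⟨k, hv.2.2.1⟩ (by simpa using hv.2.2.2.1)
        (by simpa using hv.2.2.2.2.1) (by simpa using hv.2.2.2.2.2)]
    else []

/-- Description of a list of gates. -/
def encs (gs : List (RGate ℕ)) : List Letter := gs.flatMap enc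

@[simp] theorem encs_nil : encs [] = [] := rfl

@[simp] theorem encs_append (gs gs' : List (RGate ℕ)) : encs (gs ++ gs') = encs gs ++ encs gs' :=
  List.flatMap_append

theorem length_unary (k : ℕ) : (unary k).length = k + 1 := by simp [unary]

theorem Valid.length_enc_le {N : ℕ} {g : RGate ℕ} (h : g.Valid N) : g.enc.length ≤ 3 * N + 1 := by
  cases g <;> simp only [Valid] at h <;> simp [enc, length_unary] <;> omega

theorem length_encs_le {N : ℕ} {gs : List (RGate ℕ)} (h : ∀ g ∈ gs, g.Valid N) :
    (encs gs).length ≤ gs.length * (3 * N + 1) := by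
  induction gs with
  | nil => simp
  | cons g gs ih =>
    have h1 := (h g (by simp)).length_enc_le
    have h2 := ih fun g' hg' => h g' (by simp [hg'])
    simp only [encs, List.flatMap_cons, List.length_append, List.length_cons] at *
    linarith [add_mul gs.length 1 (3 * N + 1)]

theorem encode_toCircuit {N : ℕ} {gs : List (RGate ℕ)} (h : ∀ g ∈ gs, g.Valid N) :
    (gs.flatMap (toCircuit N)).flatMap QGate.encode = encs gs := by
  induction gs with
  | nil => rfl
  | cons g gs ih =>
    have h1 := h g (by simp)
    have h2 := ih fun g' hg' => h g' (by simp [hg'])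
    simp only [encs, List.flatMap_cons, List.flatMap_append] at *
    rw [h2]
    congr 1
    cases g <;> simp only [Valid] at h1
    · simp [toCircuit, h1, QGate.encode, enc]
    · simp [toCircuit, h1, QGate.encode, enc]
    · simp only [toCircuit, dif_pos h1]
      simp [QGate.encode, enc]

theorem length_toCircuit_le (N : ℕ) (gs : List (RGate ℕ)) :
    (gs.flatMap (toCircuit N)).length ≤ gs.length := by
  induction gs with
  | nil => rfl
  | cons g gs ih =>
    have : (toCircuit N g).length ≤ 1 := by
      cases g <;> simp only [toCircuit] <;> split_ifs <;> simp
    simp only [List.flatMap_cons, List.length_append, List.length_cons]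
    omega

end RGate

open RGate (tof)

/-! ## The one-clean-qubit circuit of a Boolean circuit

Qubit `0` is the clean qubit, qubit `1` a scratch qubit, qubit `2` an auxiliary input, qubit
`4 + 2 w` stands for the wire `w`, and the qubits `3 + 2 j` carry the chain of conjunctions. -/

section blocks
variable {I : Type}

/-- Flip `d'` if `d` is set and `t = ¬ i`. -/
def notBlock (d t d' i : I) : List (RGate I) := [tof d t d', tof d i d']

/-- Flip `d'` if `d` is set and `t = (i ∧ j)`; `e` is a scratch qubit in an arbitrary state. -/
def andBlock (e d t d' i j : I) : List (RGate I) :=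
  [tof e j d', tof d i e, tof e j d', tof d i e, .x t, tof d t d', .x t]

/-- Flip `d'` if `d` is set and `t = (i ∨ j)`; `e` is a scratch qubit in an arbitrary state. -/
def orBlock (e d t d' i j : I) : List (RGate I) :=
  tof d i d' :: tof d j d' :: andBlock e d t d' i j

end blocks

namespace BoolCircuit

variable {n : ℕ}

/-- The checks of all gates in descending order, after the start of the chain. -/
def desc : {s : ℕ} → BoolCircuit n s → List (RGate ℕ)
  | _, .nil => [.x (2 * n + 3)]
  | _, .not (s := s) C i =>
    notBlock (2 * (n + s) + 3) (2 * (n + s) + 4) (2 * (n + s) + 5) (2 * i + 4) ++ C.desc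
  | _, .and (s := s) C i j =>
    andBlock 1 (2 * (n + s) + 3) (2 * (n + s) + 4) (2 * (n + s) + 5) (2 * i + 4) (2 * j + 4) ++
      C.desc
  | _, .or (s := s) C i j =>
    orBlock 1 (2 * (n + s) + 3) (2 * (n + s) + 4) (2 * (n + s) + 5) (2 * i + 4) (2 * j + 4) ++
      C.desc

/-- The checks of all gates in ascending order. -/
def asc : {s : ℕ} → BoolCircuit n s → List (RGate ℕ)
  | _, .nil => []
  | _, .not (s := s) C i =>
    C.asc ++ notBlock (2 * (n + s) + 3) (2 * (n + s) + 4) (2 * (n + s) + 5) (2 * i + 4)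
  | _, .and (s := s) C i j =>
    C.asc ++
      andBlock 1 (2 * (n + s) + 3) (2 * (n + s) + 4) (2 * (n + s) + 5) (2 * i + 4) (2 * j + 4)
  | _, .or (s := s) C i j =>
    C.asc ++
      orBlock 1 (2 * (n + s) + 3) (2 * (n + s) + 4) (2 * (n + s) + 5) (2 * i + 4) (2 * j + 4)

end BoolCircuit

/-- The checks that the first `m` wires are set, in descending order. -/
def onesDesc : ℕ → List (RGate ℕ)
  | 0 => [.x 3]
  | m + 1 => tof (2 * m + 3) (2 * m + 4) (2 * m + 5) :: onesDesc m

/-- The checks that the first `m` wires are set, in ascending order. -/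
def onesAsc : ℕ → List (RGate ℕ)
  | 0 => []
  | m + 1 => onesAsc m ++ [tof (2 * m + 3) (2 * m + 4) (2 * m + 5)]

/-- Hadamard gates on the auxiliary input and on the first `m` wires. -/
def hadamards : ℕ → List (RGate ℕ)
  | 0 => [.h 2]
  | m + 1 => .h (2 * m + 4) :: hadamards m

/-- Half of the flip of the clean qubit when all wires and the auxiliary input are set. -/
def onesHalf (m : ℕ) : List (RGate ℕ) := onesDesc m ++ (onesAsc m ++ [tof (2 * m + 3) 2 0])

/-- The phase flip of the auxiliary input. -/
def auxPhase : List (RGate ℕ) := [.h 2, .x 2, .h 2]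

namespace BoolCircuit

variable {n s : ℕ}

/-- Half of the flip of the clean qubit when all gates are consistent and the last wire differs
from the auxiliary input. -/
def checkHalf (C : BoolCircuit n s) : List (RGate ℕ) :=
  C.desc ++ (C.asc ++ [tof (2 * (n + s) + 3) (2 * (n + s) + 2) 0, tof (2 * (n + s) + 3) 2 0])

/-- One round of the circuit. -/
def round (C : BoolCircuit n s) : List (RGate ℕ) :=
  C.checkHalf ++ (C.checkHalf ++ (auxPhase ++ (hadamards (n + s) ++ (onesHalf (n + s) ++
    (onesHalf (n + s) ++ hadamards (n + s))))))

/-- The list of all gates. -/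
def rgates (C : BoolCircuit n s) : List (RGate ℕ) :=
  C.round ++ (C.round ++ (C.round ++ (C.round ++ [.x 0])))

/-- The DQC1 model of a Boolean circuit, with `k` idle qubits. -/
def toDQC1 (C : BoolCircuit n s) (k : ℕ) : DQC1 where
  mixed := 2 * (n + s) + 3 + k
  gates := C.rgates.flatMap (RGate.toCircuit (2 * (n + s) + 3 + k + 1))

/-! ### Validity and length of the gate lists. -/

theorem valid_desc {N : ℕ} (C : BoolCircuit n s) (hN : 2 * (n + s) + 4 ≤ N) :
    ∀ g ∈ C.desc, g.Valid N := by
  induction C with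
  | nil => simp [desc, RGate.Valid]; omega
  | not C i ih =>
    have := ih (by omega)
    simp only [desc, notBlock, List.mem_append, List.mem_cons, List.not_mem_nil]
    rintro g ((rfl | rfl | h) | h)
    · simp [RGate.Valid]; omega
    · simp [RGate.Valid]; omega
    · exact h.elim
    · exact this g h
  | and C i j ih =>
    have := ih (by omega)
    simp only [desc, andBlock, List.mem_append, List.mem_cons, List.not_mem_nil]
    rintro g ((rfl | rfl | rfl | rfl | rfl | rfl | rfl | h) | h)
    on_goal 8 => exact h.elim
    on_goal 8 => exact this g h
    all_goals simp [RGate.Valid]; omega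
  | or C i j ih =>
    have := ih (by omega)
    simp only [desc, andBlock, orBlock, List.mem_append, List.mem_cons, List.not_mem_nil]
    rintro g ((rfl | rfl | rfl | rfl | rfl | rfl | rfl | rfl | rfl | h) | h)
    on_goal 10 => exact h.elim
    on_goal 10 => exact this g h
    all_goals simp [RGate.Valid]; omega

theorem mem_desc_of_mem_asc (C : BoolCircuit n s) : ∀ g ∈ C.asc, g ∈ C.desc := by
  induction C with
  | nil => simp [asc]
  | not C i ih =>
    simp only [asc, desc, List.mem_append]
    exact fun g hg => hg.symm.imp_right (ih g)
  | and C i j ih =>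
    simp only [asc, desc, List.mem_append]
    exact fun g hg => hg.symm.imp_right (ih g)
  | or C i j ih =>
    simp only [asc, desc, List.mem_append]
    exact fun g hg => hg.symm.imp_right (ih g)

theorem length_desc_le (C : BoolCircuit n s) : C.desc.length ≤ 9 * s + 1 := by
  induction C with
  | nil => simp [desc]
  | not C i ih => simp [desc, notBlock]; omega
  | and C i j ih => simp [desc, andBlock]; omega
  | or C i j ih => simp [desc, orBlock, andBlock]; omega

theorem length_asc_le (C : BoolCircuit n s) : C.asc.length ≤ 9 * s := by
  induction C with
  | nil => simp [asc]
  | not C i ih => simp [asc, notBlock]; omega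
  | and C i j ih => simp [asc, andBlock]; omega
  | or C i j ih => simp [asc, orBlock, andBlock]; omega

end BoolCircuit

theorem valid_onesDesc {N m : ℕ} (hN : 2 * m + 4 ≤ N) : ∀ g ∈ onesDesc m, g.Valid N := by
  induction m with
  | zero => simp [onesDesc, RGate.Valid]; omega
  | succ m ih =>
    simp only [onesDesc, List.mem_cons]
    rintro g (rfl | h)
    · simp [RGate.Valid]; omega
    · exact ih (by omega) g h

theorem mem_onesDesc_of_mem_onesAsc (m : ℕ) : ∀ g ∈ onesAsc m, g ∈ onesDesc m := by
  induction m with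
  | zero => simp [onesAsc]
  | succ m ih =>
    simp only [onesAsc, onesDesc, List.mem_append, List.mem_cons, List.not_mem_nil, or_false]
    exact fun g hg => hg.symm.imp_right (ih g)

theorem valid_hadamards {N m : ℕ} (hN : 2 * m + 4 ≤ N) : ∀ g ∈ hadamards m, g.Valid N := by
  induction m with
  | zero => simp [hadamards, RGate.Valid]; omega
  | succ m ih =>
    simp only [hadamards, List.mem_cons]
    rintro g (rfl | h)
    · simp [RGate.Valid]; omega
    · exact ih (by omega) g h

theorem length_onesDesc (m : ℕ) : (onesDesc m).length = m + 1 := by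
  induction m <;> simp_all [onesDesc]

theorem length_onesAsc (m : ℕ) : (onesAsc m).length = m := by
  induction m <;> simp_all [onesAsc]

theorem length_hadamards (m : ℕ) : (hadamards m).length = m + 1 := by
  induction m <;> simp_all [hadamards]

theorem valid_onesHalf {N m : ℕ} (hN : 2 * m + 4 ≤ N) : ∀ g ∈ onesHalf m, g.Valid N := by
  simp only [onesHalf, List.mem_append, List.mem_singleton]
  rintro g (h | h | rfl)
  · exact valid_onesDesc hN g h
  · exact valid_onesDesc hN g (mem_onesDesc_of_mem_onesAsc m g h)
  · simp [RGate.Valid]; omega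

theorem length_onesHalf (m : ℕ) : (onesHalf m).length = 2 * m + 2 := by
  simp [onesHalf, length_onesDesc, length_onesAsc]; omega

theorem valid_auxPhase {N : ℕ} (hN : 4 ≤ N) : ∀ g ∈ auxPhase, g.Valid N := by
  simp [auxPhase, RGate.Valid]; omega

namespace BoolCircuit

variable {n s : ℕ}

theorem valid_checkHalf {N : ℕ} (C : BoolCircuit n s) (hs : 0 < s) (hN : 2 * (n + s) + 4 ≤ N) :
    ∀ g ∈ C.checkHalf, g.Valid N := by
  simp only [checkHalf, List.mem_append, List.mem_cons, List.not_mem_nil, or_false]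
  rintro g (h | h | rfl | rfl)
  · exact C.valid_desc hN g h
  · exact C.valid_desc hN g (C.mem_desc_of_mem_asc g h)
  · simp [RGate.Valid]; omega
  · simp [RGate.Valid]; omega

theorem length_checkHalf_le (C : BoolCircuit n s) : C.checkHalf.length ≤ 18 * s + 3 := by
  have := C.length_desc_le
  have := C.length_asc_le
  simp [checkHalf]; omega

theorem valid_round {N : ℕ} (C : BoolCircuit n s) (hs : 0 < s) (hN : 2 * (n + s) + 4 ≤ N) :
    ∀ g ∈ C.round, g.Valid N := by
  simp only [round, List.mem_append]
  rintro g (h | h | h | h | h | h | h)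
  · exact C.valid_checkHalf hs hN g h
  · exact C.valid_checkHalf hs hN g h
  · exact valid_auxPhase (by omega) g h
  · exact valid_hadamards hN g h
  · exact valid_onesHalf hN g h
  · exact valid_onesHalf hN g h
  · exact valid_hadamards hN g h

theorem length_round_le (C : BoolCircuit n s) : C.round.length ≤ 50 * (n + s + 1) := by
  have := C.length_checkHalf_le
  simp only [round, auxPhase, List.length_append, length_hadamards, length_onesHalf,
    List.length_cons, List.length_nil]
  omega

theorem valid_rgates {N : ℕ} (C : BoolCircuit n s) (hs : 0 < s) (hN : 2 * (n + s) + 4 ≤ N) :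
    ∀ g ∈ C.rgates, g.Valid N := by
  simp only [rgates, List.mem_append, List.mem_singleton]
  rintro g (h | h | h | h | rfl)
  on_goal 5 => simp [RGate.Valid]; omega
  all_goals exact C.valid_round hs hN g h

theorem length_rgates_le (C : BoolCircuit n s) : C.rgates.length ≤ 201 * (n + s + 1) := by
  have := C.length_round_le
  simp only [rgates, List.length_append, List.length_singleton]
  omega

/-- Validity is essential: `RGate.toCircuit` drops invalid gates, and a dropped gate would be
missing from the description that the program writes. -/
theorem encode_toDQC1 (C : BoolCircuit n s) (hs : 0 < s) (k : ℕ) :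
    (C.toDQC1 k).encode = unary (2 * (n + s) + 4 + k) ++ RGate.encs C.rgates := by
  rw [DQC1.encode, toDQC1]
  simp only [DQC1.numQubits]
  rw [RGate.encode_toCircuit (C.valid_rgates hs (by omega))]
  congr 2
  omega

theorem numQubits_toDQC1 (C : BoolCircuit n s) (k : ℕ) :
    (C.toDQC1 k).numQubits = 2 * (n + s) + 4 + k := by
  simp only [DQC1.numQubits, toDQC1]; omega

theorem length_gates_toDQC1_le (C : BoolCircuit n s) (k : ℕ) :
    (C.toDQC1 k).gates.length ≤ 201 * (C.toDQC1 k).numQubits := by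
  rw [numQubits_toDQC1]
  have := C.length_rgates_le
  have := RGate.length_toCircuit_le (2 * (n + s) + 3 + k + 1) C.rgates
  simp only [toDQC1]
  omega

end BoolCircuit

/-! ## Writing descriptions of circuits -/

/-- Used twice: a fragment may remember a letter in its state, and machines with standard state sets
have countably many transition tables. -/
instance : Finite Letter :=
  Finite.of_surjective (fun i : Fin 8 => match i with
    | 0 => Letter.one | 1 => Letter.sep | 2 => Letter.bnot | 3 => Letter.band
    | 4 => Letter.bor | 5 => Letter.qx | 6 => Letter.qh | 7 => Letter.qtoffoli)
    (by
      intro a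
      cases a
      exacts [⟨0, rfl⟩, ⟨1, rfl⟩, ⟨2, rfl⟩, ⟨3, rfl⟩, ⟨4, rfl⟩, ⟨5, rfl⟩, ⟨6, rfl⟩, ⟨7, rfl⟩])

/-- Test whether the top of a stack is the letter `1`. -/
def isOne : Option Letter → Bool
  | some Letter.one => true
  | _ => false

namespace Frag

variable {ι W : Type}

/-! ### Moving, copying and reading stacks. -/

section
variable [DecidableEq ι]

/-- Move the top of the stack `r` to all stacks in `o`. -/
def transfer (r : ι) (o : ι → Bool) : Frag ι W where
  S := Option Letter
  start := none
  trans s h := match s with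
    | none => (some ((h r).letter.getD Letter.one), fun j =>
        if j = r then (none, some Turing.Dir.right)
        else if o j then (h j, some Turing.Dir.left) else (h j, none))
    | some a => (none, fun j => if o j then (some (Sum.inl a), none) else (h j, none))

/-- The state carries the letter through the single step in which the heads of the receiving stacks
move to a free cell. The default letter in `transfer` would matter only for an empty stack, which
`h` excludes. -/
theorem runs_transfer {r : ι} {o : ι → Bool} (hr : o r = false) {σ : ι → List Letter} {a : Letter}
    {l : List Letter} (h : σ r = a :: l) :
    (transfer r o : Frag ι W).RunsIn σ
      (fun j => if j = r then l else if o j then a :: σ j else σ j) 2 := by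
  refine ⟨2, le_rfl, ?_⟩
  have h1 : (transfer r o : Frag ι W).trans none (fun j => (tapesOf W σ j).head) =
      (some (some a), fun j => if j = r then (none, some Turing.Dir.right)
        else if o j then ((tapesOf W σ j).head, some Turing.Dir.left)
        else ((tapesOf W σ j).head, none)) := by
    simp only [transfer, tapesOf, letter_head_stackTape, h]
    rfl
  have p2 := Path.exit (F := (transfer r o : Frag ι W)) (s := some a)
    (T := fun j => Machine.act (tapesOf W σ j) (if j = r then (none, some Turing.Dir.right)
        else if o j then ((tapesOf W σ j).head, some Turing.Dir.left)
        else ((tapesOf W σ j).head, none))) rfl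
  refine (Path.step h1 p2).of_eq ?_
  funext j
  by_cases hj : j = r
  · subst hj
    simp [Machine.act, tapesOf, hr, stackTape_pop, h, Turing.Tape.write_self]
  · by_cases ho : o j = true
    · simp [Machine.act, tapesOf, hj, ho, stackTape_push, Turing.Tape.write_self]
    · simp [Machine.act, tapesOf, hj, ho, Turing.Tape.write_self]

/-- Move the stack `r` in reverse order onto the stack `o`. -/
def pour (r o : ι) : Frag ι W := loop r Option.isSome (transfer r fun j => decide (j = o))

theorem runs_pour {r o : ι} (hro : r ≠ o) (l : List Letter) :
    ∀ σ : ι → List Letter, σ r = l → (pour r o : Frag ι W).RunsIn σ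
      (Function.update (Function.update σ r []) o (l.reverse ++ σ o)) (3 * l.length + 1) := by
  induction l with
  | nil =>
    intro σ h
    have := runs_loop_exit (r := r) (c := Option.isSome)
      (F := (transfer r fun j => decide (j = o) : Frag ι W)) (σ := σ) (by simp [h])
    refine this.cast (by simp) ?_
    funext j
    by_cases hj : j = o
    · simp [hj]
    · by_cases hr : j = r
      · subst hr; simp [hj, h]
      · simp [hj, hr]
  | cons a l ih =>
    intro σ h
    have h1 := runs_transfer (W := W) (r := r) (o := fun j => decide (j = o)) (by simpa using hro) h
    have h2 := ih (fun j => if j = r then l else if decide (j = o) then a :: σ j else σ j)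
      (by simp)
    have h3 := h1.loop_step (c := Option.isSome) (by simp [h]) h2
    refine h3.cast (by simp; omega) ?_
    funext j
    by_cases hj : j = o
    · simp [hj, hro.symm]
    · by_cases hr : j = r
      · subst hr; simp [hj]
      · simp [hj, hr]

/-- Move the stack `r` in reverse order onto the stacks `o` and `o'`. -/
def pour₂ (r o o' : ι) : Frag ι W :=
  loop r Option.isSome (transfer r fun j => decide (j = o ∨ j = o'))

theorem runs_pour₂ {r o o' : ι} (hro : r ≠ o) (hro' : r ≠ o') (hoo : o ≠ o') (l : List Letter) :
    ∀ σ : ι → List Letter, σ r = l → (pour₂ r o o' : Frag ι W).RunsIn σ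
      (Function.update (Function.update (Function.update σ r []) o (l.reverse ++ σ o)) o'
        (l.reverse ++ σ o')) (3 * l.length + 1) := by
  induction l with
  | nil =>
    intro σ h
    have := runs_loop_exit (r := r) (c := Option.isSome)
      (F := (transfer r fun j => decide (j = o ∨ j = o') : Frag ι W)) (σ := σ) (by simp [h])
    refine this.cast (by simp) ?_
    funext j
    by_cases hj' : j = o'
    · simp [hj']
    · by_cases hj : j = o
      · subst hj; simp [hj']
      · by_cases hr : j = r
        · subst hr; simp [hj, hj', h]
        · simp [hj, hj', hr]
  | cons a l ih =>
    intro σ h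
    have h1 := runs_transfer (W := W) (r := r) (o := fun j => decide (j = o ∨ j = o'))
      (by simp [hro, hro']) h
    have h2 := ih (fun j => if j = r then l else if decide (j = o ∨ j = o') then a :: σ j else σ j)
      (by simp)
    have h3 := h1.loop_step (c := Option.isSome) (by simp [h]) h2
    refine h3.cast (by simp; omega) ?_
    funext j
    by_cases hj' : j = o'
    · simp [hj', hro'.symm]
    · by_cases hj : j = o
      · subst hj; simp [hj', hro.symm]
      · by_cases hr : j = r
        · subst hr; simp [hj, hj']
        · simp [hj, hj', hr]

/-- Put a copy of the stack `r` on top of the stack `o`. -/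
def copy (tmp r o : ι) : Frag ι W := seq (pour r tmp) (pour₂ tmp r o)

/-- Pouring reverses a stack, so two pours through `tmp` restore the order, and the second one
rebuilds `r` while filling `o`. Each pour takes three steps per letter. -/
theorem runs_copy {tmp r o : ι} (hr : r ≠ tmp) (ho : tmp ≠ o) (hro : r ≠ o)
    {σ : ι → List Letter} (h : σ tmp = []) :
    (copy tmp r o : Frag ι W).RunsIn σ (Function.update σ o (σ r ++ σ o))
      (6 * (σ r).length + 2) := by
  have h1 := runs_pour (W := W) hr _ σ rfl
  have h2 := runs_pour₂ (W := W) (r := tmp) (o := r) (o' := o) hr.symm ho hro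
    (σ r).reverse (Function.update (Function.update σ r []) tmp ((σ r).reverse ++ σ tmp))
    (by simp [h])
  refine (h1.seq h2).cast (by simp; omega) ?_
  funext j
  by_cases hj' : j = o
  · subst hj'; simp [hro.symm, ho.symm]
  · by_cases hj : j = r
    · subst hj; simp [hj', hr]
    · by_cases hr : j = tmp
      · subst hr; simp [hj, hj', h]
      · simp [hj, hj', hr]

/-- Move the stack `r` on top of the stack `o`. -/
def prepend (tmp r o : ι) : Frag ι W := seq (pour r tmp) (pour tmp o)

theorem runs_prepend {tmp r o : ι} (hr : r ≠ tmp) (ho : tmp ≠ o) (hro : r ≠ o)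
    {σ : ι → List Letter} (h : σ tmp = []) :
    (prepend tmp r o : Frag ι W).RunsIn σ
      (Function.update (Function.update σ r []) o (σ r ++ σ o))
      (6 * (σ r).length + 2) := by
  have h1 := runs_pour (W := W) hr _ σ rfl
  have h2 := runs_pour (W := W) (r := tmp) (o := o) ho
    (σ r).reverse (Function.update (Function.update σ r []) tmp ((σ r).reverse ++ σ tmp))
    (by simp [h])
  refine (h1.seq h2).cast (by simp; omega) ?_
  funext j
  by_cases hj' : j = o
  · subst hj'; simp [hro.symm, ho.symm]
  · by_cases hj : j = r
    · subst hj; simp [hj', hr]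
    · by_cases hr : j = tmp
      · subst hr; simp [hj, hj', h]
      · simp [hj, hj', hr]

/-- Move the letters `1` on top of `r` to `o`. -/
def readOnes (r o : ι) : Frag ι W := loop r isOne (transfer r fun j => decide (j = o))

theorem runs_readOnes {r o : ι} (hro : r ≠ o) (v : ℕ) :
    ∀ (σ : ι → List Letter) (l : List Letter), σ r = unary v ++ l →
      (readOnes r o : Frag ι W).RunsIn σ
        (Function.update (Function.update σ r (Letter.sep :: l)) o
          (List.replicate v Letter.one ++ σ o)) (3 * v + 1) := by
  induction v with
  | zero =>
    intro σ l h
    have := runs_loop_exit (r := r) (c := isOne)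
      (F := (transfer r fun j => decide (j = o) : Frag ι W)) (σ := σ) (by simp [h, unary, isOne])
    refine this.cast (by simp) ?_
    funext j
    by_cases hj : j = o
    · simp [hj]
    · by_cases hr : j = r
      · subst hr; simp [hj, h, unary]
      · simp [hj, hr]
  | succ v ih =>
    intro σ l h
    have h' : σ r = Letter.one :: (unary v ++ l) := by
      simpa [unary, List.replicate_succ] using h
    have h1 := runs_transfer (W := W) (r := r) (o := fun j => decide (j = o))
      (by simpa using hro) h'
    have h2 := ih (fun j => if j = r then unary v ++ l
      else if decide (j = o) then Letter.one :: σ j else σ j) l (by simp)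
    have h3 := h1.loop_step (c := isOne) (by simp [h', isOne]) h2
    refine h3.cast (by omega) ?_
    funext j
    by_cases hj : j = o
    · simp [hj, hro.symm, List.replicate_succ']
    · by_cases hr : j = r
      · subst hr; simp [hj]
      · simp [hj, hr]

/-- Move a number in unary from the input `r` to `o`. -/
def readNum (r o : ι) : Frag ι W := seq (readOnes r o) (pop r)

theorem runs_readNum {r o : ι} (hro : r ≠ o) {v : ℕ} {σ : ι → List Letter} {l : List Letter}
    (h : σ r = unary v ++ l) :
    (readNum r o : Frag ι W).RunsIn σ
      (Function.update (Function.update σ r l) o (List.replicate v Letter.one ++ σ o))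
      (3 * v + 2) := by
  have h1 := runs_readOnes (W := W) hro v σ l h
  refine (h1.seq (runs_pop r _)).cast (by omega) ?_
  funext j
  by_cases hj : j = o
  · simp [hj, hro.symm]
  · by_cases hr : j = r
    · subst hr; simp [hj]
    · simp [hj, hr]

/-- Push `2 v` letters `1` onto `o` when `r` holds `v` letters `1`. -/
def pushDouble (tmp r o : ι) : Frag ι W := seq (copy tmp r o) (copy tmp r o)

end

/-- Items of a text to be written: a letter, or `2 v` ones where `v` is the number in a register. -/
inductive Tok (ι : Type) : Type
  | lit (a : Letter) : Tok ι
  | dbl (r : ι) : Tok ι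

/-- The text of an item. -/
def Tok.text (σ : ι → List Letter) : Tok ι → List Letter
  | lit a => [a]
  | dbl r => σ r ++ σ r

section
variable [DecidableEq ι]

/-- Write the items one after the other onto the stack `o`. -/
def emit (tmp o : ι) (ts : List (Tok ι)) : Frag ι W :=
  seqs (ts.map fun
    | .lit a => push o a
    | .dbl r => pushDouble tmp r o)

end

/-- The registers used by an item hold numbers at most `L`. -/
def Tok.Ok (tmp o : ι) (L : ℕ) (σ : ι → List Letter) : Tok ι → Prop
  | lit _ => True
  | dbl r => r ≠ tmp ∧ r ≠ o ∧ ∃ v ≤ L, σ r = List.replicate v Letter.one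

/-- The text of an item is a single letter or a run of ones, hence a palindrome. Reversing the list
of items therefore reverses the whole text, and one program `emit` serves both reading order and
reverse order. -/
theorem Tok.Ok.reverse_text {tmp o : ι} {L : ℕ} {σ : ι → List Letter} {t : Tok ι}
    (h : t.Ok tmp o L σ) : (t.text σ).reverse = t.text σ := by
  cases t with
  | lit a => rfl
  | dbl r =>
    obtain ⟨_, _, v, _, hv⟩ := h
    simp [Tok.text, hv]

/-- The registers used by the items differ from `o` and `tmp`, so all texts can be computed in the
initial store. The cost `12 L + 4` of an item is that of two copies of a number at most `L`. -/
theorem runs_emit [DecidableEq ι] {tmp o : ι} (hto : tmp ≠ o) {L : ℕ} (ts : List (Tok ι)) :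
    ∀ σ : ι → List Letter, σ tmp = [] → (∀ t ∈ ts, t.Ok tmp o L σ) →
      (emit tmp o ts : Frag ι W).RunsIn σ
        (Function.update σ o ((ts.flatMap (Tok.text σ)).reverse ++ σ o))
        ((12 * L + 4) * ts.length + 1) := by
  induction ts with
  | nil =>
    intro σ _ _
    have := runs_seqs_nil (W := W) σ
    simpa [emit] using this
  | cons t ts ih =>
    intro σ htmp hok
    have ht := hok t (by simp)
    have hts : ∀ t ∈ ts, t.Ok tmp o L σ := fun t' h => hok t' (by simp [h])
    have key : ∀ l, (Function.update σ o l) tmp = [] ∧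
        (∀ t ∈ ts, t.Ok tmp o L (Function.update σ o l)) ∧
        ts.flatMap (Tok.text (Function.update σ o l)) = ts.flatMap (Tok.text σ) := by
      intro l
      have h0 : ∀ t ∈ ts, t.Ok tmp o L (Function.update σ o l) ∧
          Tok.text (Function.update σ o l) t = Tok.text σ t := by
        intro t ht
        have := hts t ht
        cases t with
        | lit a => exact ⟨trivial, rfl⟩
        | dbl r =>
          obtain ⟨h1, h2, h3⟩ := this
          refine ⟨⟨h1, h2, ?_⟩, ?_⟩
          · simpa [h2] using h3
          · simp [Tok.text, h2]
      exact ⟨by simp [hto, htmp], fun t ht => (h0 t ht).1,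
        List.flatMap_congr fun t ht => (h0 t ht).2⟩
    have main : ∀ F : Frag ι W, F.RunsIn σ (Function.update σ o ((t.text σ).reverse ++ σ o))
        (12 * L + 4) → (seqs (F :: ts.map fun
          | .lit a => push o a
          | .dbl r => pushDouble tmp r o)).RunsIn σ
        (Function.update σ o (((t :: ts).flatMap (Tok.text σ)).reverse ++ σ o))
        ((12 * L + 4) * (t :: ts).length + 1) := by
      intro F hF
      obtain ⟨k1, k2, k3⟩ := key ((t.text σ).reverse ++ σ o)
      have h2 := ih _ k1 k2
      refine (hF.seqs_cons h2).cast (by simp; linarith) ?_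
      simp [k3]
    cases t with
    | lit a => exact main _ ((runs_push o a σ).mono (by omega))
    | dbl r =>
      obtain ⟨h1, h2, v, hv, hr⟩ := ht
      refine main (pushDouble tmp r o) ?_
      have c1 := runs_copy (W := W) h1 hto h2 htmp
      have c2 := runs_copy (W := W) (σ := Function.update σ o (σ r ++ σ o)) h1 hto h2
        (by simp [hto, htmp])
      refine RunsIn.mono (B := 12 * v + 4) ?_ (by omega)
      refine (c1.seq c2).cast (by simp [h2, hr]; omega) ?_
      simp [Tok.text, h2, hr, ← List.append_assoc]

/-- A symbolic number: twice the number in a register (if any), plus a constant. -/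
structure Idx (ι : Type) where
  reg : Option ι
  off : ℕ

/-- The value of a symbolic number. -/
def Idx.val (σ : ι → List Letter) (i : Idx ι) : ℕ :=
  (i.reg.elim 0 fun r => 2 * (σ r).length) + i.off

/-- The unary code of a symbolic number. -/
def Idx.toks (i : Idx ι) : List (Tok ι) :=
  (i.reg.elim [] fun r => [.dbl r]) ++
    (List.replicate i.off (Tok.lit Letter.one) ++ [.lit Letter.sep])

/-- The register of a symbolic number holds a number at most `L`. -/
def Idx.Ok (tmp o : ι) (L : ℕ) (σ : ι → List Letter) (i : Idx ι) : Prop :=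
  ∀ r ∈ i.reg, r ≠ tmp ∧ r ≠ o ∧ ∃ v ≤ L, σ r = List.replicate v Letter.one

theorem Idx.Ok.toks {tmp o : ι} {L : ℕ} {σ : ι → List Letter} {i : Idx ι}
    (h : i.Ok tmp o L σ) : ∀ t ∈ i.toks, t.Ok tmp o L σ := by
  obtain ⟨r, k⟩ := i
  have hl : ∀ a, Tok.Ok tmp o L σ (.lit a) := fun _ => trivial
  cases r with
  | none =>
    simp only [Idx.toks, Option.elim_none, List.nil_append, List.mem_append, List.mem_replicate,
      List.mem_singleton]
    rintro t (⟨_, rfl⟩ | rfl) <;> exact hl _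
  | some r =>
    simp only [Idx.toks, Option.elim_some, List.mem_append, List.mem_replicate, List.mem_singleton]
    rintro t (rfl | ⟨_, rfl⟩ | rfl)
    · exact h r rfl
    · exact hl _
    · exact hl _

theorem Idx.Ok.text_toks {tmp o : ι} {L : ℕ} {σ : ι → List Letter} {i : Idx ι}
    (h : i.Ok tmp o L σ) : i.toks.flatMap (Tok.text σ) = unary (i.val σ) := by
  obtain ⟨r, k⟩ := i
  have hrep : (List.replicate k (Tok.lit (ι := ι) Letter.one)).flatMap (Tok.text σ) =
      List.replicate k Letter.one := by
    induction k with
    | zero => rfl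
    | succ k ih =>
      simp only [List.replicate_succ, List.flatMap_cons]
      rw [ih h]; rfl
  cases r with
  | none => simp [Idx.toks, Idx.val, unary, List.flatMap_append, hrep, Tok.text]
  | some r =>
    obtain ⟨_, _, v, _, hv⟩ := h r rfl
    simp [Idx.toks, Idx.val, unary, List.flatMap_append, hrep, Tok.text, hv, two_mul,
      ← List.append_assoc]

/-- The description of a symbolic gate. -/
def gateToks : RGate (Idx ι) → List (Tok ι)
  | .x i => .lit Letter.qx :: i.toks
  | .h i => .lit Letter.qh :: i.toks
  | .tof i j k => .lit Letter.qtoffoli :: (i.toks ++ j.toks ++ k.toks)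

/-- All symbolic numbers in a gate are admissible. -/
def GateOk (tmp o : ι) (L : ℕ) (σ : ι → List Letter) : RGate (Idx ι) → Prop
  | .x i => i.Ok tmp o L σ
  | .h i => i.Ok tmp o L σ
  | .tof i j k => i.Ok tmp o L σ ∧ j.Ok tmp o L σ ∧ k.Ok tmp o L σ

theorem GateOk.toks {tmp o : ι} {L : ℕ} {σ : ι → List Letter} {g : RGate (Idx ι)}
    (h : GateOk tmp o L σ g) : ∀ t ∈ gateToks g, t.Ok tmp o L σ := by
  have hl : ∀ a, Tok.Ok tmp o L σ (.lit a) := fun _ => trivial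
  cases g with
  | x i => exact List.forall_mem_cons.2 ⟨hl _, Idx.Ok.toks h⟩
  | h i => exact List.forall_mem_cons.2 ⟨hl _, Idx.Ok.toks h⟩
  | tof i j k =>
    obtain ⟨h1, h2, h3⟩ := h
    exact List.forall_mem_cons.2 ⟨hl _, List.forall_mem_append.2
      ⟨List.forall_mem_append.2 ⟨h1.toks, h2.toks⟩, h3.toks⟩⟩

theorem GateOk.text_toks {tmp o : ι} {L : ℕ} {σ : ι → List Letter} {g : RGate (Idx ι)}
    (h : GateOk tmp o L σ g) :
    (gateToks g).flatMap (Tok.text σ) = (g.map (Idx.val σ)).enc := by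
  cases g with
  | x i => simp [gateToks, RGate.map, RGate.enc, Tok.text, Idx.Ok.text_toks h]
  | h i => simp [gateToks, RGate.map, RGate.enc, Tok.text, Idx.Ok.text_toks h]
  | tof i j k =>
    obtain ⟨h1, h2, h3⟩ := h
    simp [gateToks, RGate.map, RGate.enc, Tok.text, h1.text_toks, h2.text_toks, h3.text_toks,
      List.flatMap_append]

/-- Write the description of a gate list in reading order from the top of the stack `o`. -/
def emitGates [DecidableEq ι] (tmp o : ι) (gs : List (RGate (Idx ι))) : Frag ι W :=
  emit tmp o (gs.flatMap gateToks).reverse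

/-- Write the description of a gate list in reverse order onto the stack `o`. -/
def emitGatesRev [DecidableEq ι] (tmp o : ι) (gs : List (RGate (Idx ι))) : Frag ι W :=
  emit tmp o (gs.flatMap gateToks)

theorem text_gates {tmp o : ι} {L : ℕ} {σ : ι → List Letter} {gs : List (RGate (Idx ι))}
    (h : ∀ g ∈ gs, GateOk tmp o L σ g) :
    (gs.flatMap gateToks).flatMap (Tok.text σ) = RGate.encs (gs.map (RGate.map (Idx.val σ))) := by
  induction gs with
  | nil => rfl
  | cons g gs ih =>
    simp only [List.flatMap_cons, List.flatMap_append, List.map_cons, RGate.encs]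
    rw [(h g (by simp)).text_toks, ih fun g' hg' => h g' (by simp [hg'])]
    rfl

theorem ok_gates {tmp o : ι} {L : ℕ} {σ : ι → List Letter} {gs : List (RGate (Idx ι))}
    (h : ∀ g ∈ gs, GateOk tmp o L σ g) : ∀ t ∈ gs.flatMap gateToks, t.Ok tmp o L σ := by
  intro t ht
  obtain ⟨g, hg, htg⟩ := List.mem_flatMap.1 ht
  exact (h g hg).toks t htg

theorem reverse_text_reverse {tmp o : ι} {L : ℕ} {σ : ι → List Letter} {ts : List (Tok ι)}
    (h : ∀ t ∈ ts, t.Ok tmp o L σ) :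
    (ts.reverse.flatMap (Tok.text σ)).reverse = ts.flatMap (Tok.text σ) := by
  rw [List.reverse_flatMap, List.reverse_reverse]
  exact List.flatMap_congr fun t ht => (h t ht).reverse_text

theorem runs_emitGates [DecidableEq ι] {tmp o : ι} (hto : tmp ≠ o) {L : ℕ}
    {gs : List (RGate (Idx ι))}
    {σ : ι → List Letter} (htmp : σ tmp = []) (h : ∀ g ∈ gs, GateOk tmp o L σ g) :
    (emitGates tmp o gs : Frag ι W).RunsIn σ
      (Function.update σ o (RGate.encs (gs.map (RGate.map (Idx.val σ))) ++ σ o))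
      ((12 * L + 4) * (gs.flatMap gateToks).length + 1) := by
  have := runs_emit (W := W) hto (gs.flatMap gateToks).reverse σ htmp
    (fun t ht => ok_gates h t (List.mem_reverse.1 ht))
  rwa [reverse_text_reverse (ok_gates h), text_gates h, List.length_reverse] at this

theorem runs_emitGatesRev [DecidableEq ι] {tmp o : ι} (hto : tmp ≠ o) {L : ℕ}
    {gs : List (RGate (Idx ι))}
    {σ : ι → List Letter} (htmp : σ tmp = []) (h : ∀ g ∈ gs, GateOk tmp o L σ g) :
    (emitGatesRev tmp o gs : Frag ι W).RunsIn σ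
      (Function.update σ o ((RGate.encs (gs.map (RGate.map (Idx.val σ)))).reverse ++ σ o))
      ((12 * L + 4) * (gs.flatMap gateToks).length + 1) := by
  have := runs_emit (W := W) hto (gs.flatMap gateToks) σ htmp (ok_gates h)
  rwa [text_gates h] at this

/-- Write the unary code of a symbolic number on top of the stack `o`. -/
def emitNum [DecidableEq ι] (tmp o : ι) (i : Idx ι) : Frag ι W := emit tmp o i.toks.reverse

theorem runs_emitNum [DecidableEq ι] {tmp o : ι} (hto : tmp ≠ o) {L : ℕ} {i : Idx ι}
    {σ : ι → List Letter} (htmp : σ tmp = []) (h : i.Ok tmp o L σ) :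
    (emitNum tmp o i : Frag ι W).RunsIn σ (Function.update σ o (unary (i.val σ) ++ σ o))
      ((12 * L + 4) * i.toks.length + 1) := by
  have := runs_emit (W := W) hto i.toks.reverse σ htmp
    (fun t ht => h.toks t (List.mem_reverse.1 ht))
  rwa [reverse_text_reverse h.toks, h.text_toks, List.length_reverse] at this

end Frag

/-! ## The translation of Boolean circuits as a program -/

/-- The registers of the translation: twelve own stacks, and the tapes of a machine. -/
abbrev Reg (k : ℕ) : Type := Fin 12 ⊕ Fin (k + 1)

/-- The contents of the registers: the remaining input, the number of wires read so far, the
arguments of the current gate, the parts of the circuit, and the output. -/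
structure Regs where
  inp : List Letter
  w : ℕ
  a : ℕ
  b : ℕ
  asV : List Letter
  dnV : List Letter
  asA : List Letter
  dnA : List Letter
  hs : List Letter
  cV : List Letter
  cA : List Letter
  out : List Letter

namespace Regs

variable {k : ℕ}

/-- A string of `n` letters `1`. -/
abbrev ones (n : ℕ) : List Letter := List.replicate n Letter.one

/-- The stacks holding the given contents. -/
def store (k : ℕ) (s : Regs) : Reg k → List Letter
  | Sum.inl j => ![s.inp, ones s.w, ones s.a, ones s.b, [], s.asV, s.dnV, s.asA, s.dnA, s.hs,
      s.cV, s.cA] j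
  | Sum.inr j => if j = 0 then s.out else []

/-- The input register. -/
abbrev rInp : Reg k := Sum.inl 0
/-- The wire counter. -/
abbrev rW : Reg k := Sum.inl 1
/-- The first argument. -/
abbrev rA : Reg k := Sum.inl 2
/-- The second argument. -/
abbrev rB : Reg k := Sum.inl 3
/-- The scratch register. -/
abbrev rTmp : Reg k := Sum.inl 4
/-- The ascending checks, reversed. -/
abbrev rAsV : Reg k := Sum.inl 5
/-- The descending checks. -/
abbrev rDnV : Reg k := Sum.inl 6
/-- The ascending checks for ones, reversed. -/
abbrev rAsA : Reg k := Sum.inl 7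
/-- The descending checks for ones. -/
abbrev rDnA : Reg k := Sum.inl 8
/-- The Hadamard gates. -/
abbrev rHs : Reg k := Sum.inl 9
/-- The check of all gates. -/
abbrev rCV : Reg k := Sum.inl 10
/-- The check for ones. -/
abbrev rCA : Reg k := Sum.inl 11
/-- The output register. -/
abbrev rOut : Reg k := Sum.inr 0

variable (s : Regs) (l : List Letter) (n : ℕ)

theorem update_inp : Function.update (s.store k) rInp l = store k { s with inp := l } := by
  funext j; rcases j with j | j
  · fin_cases j <;> rfl
  · rfl

theorem update_w : Function.update (s.store k) rW (ones n) = store k { s with w := n } := by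
  funext j; rcases j with j | j
  · fin_cases j <;> rfl
  · rfl

theorem update_a : Function.update (s.store k) rA (ones n) = store k { s with a := n } := by
  funext j; rcases j with j | j
  · fin_cases j <;> rfl
  · rfl

theorem update_b : Function.update (s.store k) rB (ones n) = store k { s with b := n } := by
  funext j; rcases j with j | j
  · fin_cases j <;> rfl
  · rfl

theorem update_asV : Function.update (s.store k) rAsV l = store k { s with asV := l } := by
  funext j; rcases j with j | j
  · fin_cases j <;> rfl
  · rfl

theorem update_dnV : Function.update (s.store k) rDnV l = store k { s with dnV := l } := by
  funext j; rcases j with j | j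
  · fin_cases j <;> rfl
  · rfl

theorem update_asA : Function.update (s.store k) rAsA l = store k { s with asA := l } := by
  funext j; rcases j with j | j
  · fin_cases j <;> rfl
  · rfl

theorem update_dnA : Function.update (s.store k) rDnA l = store k { s with dnA := l } := by
  funext j; rcases j with j | j
  · fin_cases j <;> rfl
  · rfl

theorem update_hs : Function.update (s.store k) rHs l = store k { s with hs := l } := by
  funext j; rcases j with j | j
  · fin_cases j <;> rfl
  · rfl

theorem update_cV : Function.update (s.store k) rCV l = store k { s with cV := l } := by
  funext j; rcases j with j | j
  · fin_cases j <;> rfl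
  · rfl

theorem update_cA : Function.update (s.store k) rCA l = store k { s with cA := l } := by
  funext j; rcases j with j | j
  · fin_cases j <;> rfl
  · rfl

theorem update_out : Function.update (s.store k) rOut l = store k { s with out := l } := by
  funext j; rcases j with j | j
  · rfl
  · by_cases hj : j = 0
    · subst hj; simp [store]
    · simp [store, hj]

end Regs

open Regs

/-- Symbolic numbers: a constant, or twice one of the three counters plus a constant. -/
inductive SymIdx : Type
  | cst (c : ℕ) : SymIdx
  | w (c : ℕ) : SymIdx
  | a (c : ℕ) : SymIdx
  | b (c : ℕ) : SymIdx

namespace SymIdx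

variable {k : ℕ}

/-- The value of a symbolic number. -/
def val (s : Regs) : SymIdx → ℕ
  | cst c => c
  | w c => 2 * s.w + c
  | a c => 2 * s.a + c
  | b c => 2 * s.b + c

/-- The symbolic number in terms of registers. -/
def toIdx (k : ℕ) : SymIdx → Frag.Idx (Reg k)
  | cst c => ⟨none, c⟩
  | w c => ⟨some rW, c⟩
  | a c => ⟨some rA, c⟩
  | b c => ⟨some rB, c⟩

theorem val_toIdx (s : Regs) (i : SymIdx) : (i.toIdx k).val (s.store k) = i.val s := by
  cases i <;> simp [toIdx, val, Frag.Idx.val, store]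

/-- A register that can be written while the counters are read. -/
def Target (o : Reg k) : Prop := rTmp ≠ o ∧ rW ≠ o ∧ rA ≠ o ∧ rB ≠ o

theorem ok_toIdx {o : Reg k} (ho : Target o) {s : Regs} {L : ℕ} (hL : s.w ≤ L ∧ s.a ≤ L ∧ s.b ≤ L)
    (i : SymIdx) : (i.toIdx k).Ok rTmp o L (s.store k) := by
  obtain ⟨h1, h2, h3, h4⟩ := ho
  obtain ⟨l1, l2, l3⟩ := hL
  intro r hr
  cases i with
  | cst c => simp [toIdx] at hr
  | w c =>
    obtain rfl : rW = r := by simpa [toIdx] using hr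
    exact ⟨by simp, h2, s.w, l1, rfl⟩
  | a c =>
    obtain rfl : rA = r := by simpa [toIdx] using hr
    exact ⟨by simp, h3, s.a, l2, rfl⟩
  | b c =>
    obtain rfl : rB = r := by simpa [toIdx] using hr
    exact ⟨by simp, h4, s.b, l3, rfl⟩

theorem ok_gates {o : Reg k} (ho : Target o) {s : Regs} {L : ℕ}
    (hL : s.w ≤ L ∧ s.a ≤ L ∧ s.b ≤ L) (gs : List (RGate SymIdx)) :
    ∀ g ∈ gs.map (RGate.map (toIdx k)), Frag.GateOk rTmp o L (s.store k) g := by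
  intro g hg
  obtain ⟨g, _, rfl⟩ := List.mem_map.1 hg
  cases g with
  | x i => exact ok_toIdx ho hL i
  | h i => exact ok_toIdx ho hL i
  | tof i j l => exact ⟨ok_toIdx ho hL i, ok_toIdx ho hL j, ok_toIdx ho hL l⟩

theorem map_val_toIdx (s : Regs) (gs : List (RGate SymIdx)) :
    (gs.map (RGate.map (toIdx k))).map (RGate.map (Frag.Idx.val (s.store k))) =
      gs.map (RGate.map (val s)) := by
  rw [List.map_map]
  refine List.map_congr_left fun g _ => ?_
  cases g <;> simp [RGate.map, val_toIdx]

end SymIdx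

/-- The number of items in the description of a symbolic gate list. -/
def symCost (gs : List (RGate SymIdx)) : ℕ :=
  ((gs.map (RGate.map (SymIdx.toIdx 0))).flatMap Frag.gateToks).length

/-- The number of items does not depend on how many tapes the later machine has. Taking `k = 0` in
`symCost` makes the cost of each concrete gate list a numeral that holds by `rfl`. -/
theorem length_gateToks (k : ℕ) (gs : List (RGate SymIdx)) :
    ((gs.map (RGate.map (SymIdx.toIdx k))).flatMap Frag.gateToks).length = symCost gs := by
  have hi : ∀ i : SymIdx, (i.toIdx k).toks.length = (i.toIdx 0).toks.length := by
    intro i; cases i <;> simp [SymIdx.toIdx, Frag.Idx.toks]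
  induction gs with
  | nil => rfl
  | cons g gs ih =>
    simp only [symCost, List.map_cons, List.flatMap_cons, List.length_append] at *
    rw [ih]
    congr 1
    cases g <;> simp [RGate.map, Frag.gateToks, hi]

/-! ### Emitting gates whose qubit numbers depend on the counters. -/

section emit
variable {k : ℕ} {W : Type}

/-- Write the description of a symbolic gate list in reading order. -/
def emitSym (o : Reg k) (gs : List (RGate SymIdx)) : Frag (Reg k) W :=
  Frag.emitGates rTmp o (gs.map (RGate.map (SymIdx.toIdx k)))

/-- Write the description of a symbolic gate list in reverse order. -/
def emitSymRev (o : Reg k) (gs : List (RGate SymIdx)) : Frag (Reg k) W :=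
  Frag.emitGatesRev rTmp o (gs.map (RGate.map (SymIdx.toIdx k)))

theorem runs_emitSym {o : Reg k} (ho : SymIdx.Target o) {s : Regs} {L : ℕ}
    (hL : s.w ≤ L ∧ s.a ≤ L ∧ s.b ≤ L) (gs : List (RGate SymIdx)) :
    (emitSym o gs : Frag (Reg k) W).RunsIn (s.store k)
      (Function.update (s.store k) o
          (RGate.encs (gs.map (RGate.map (SymIdx.val s))) ++ s.store k o))
      ((12 * L + 4) * symCost gs + 1) := by
  have := Frag.runs_emitGates (W := W) ho.1 (σ := s.store k) rfl (SymIdx.ok_gates ho hL gs)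
  rwa [SymIdx.map_val_toIdx, length_gateToks] at this

theorem runs_emitSymRev {o : Reg k} (ho : SymIdx.Target o) {s : Regs} {L : ℕ}
    (hL : s.w ≤ L ∧ s.a ≤ L ∧ s.b ≤ L) (gs : List (RGate SymIdx)) :
    (emitSymRev o gs : Frag (Reg k) W).RunsIn (s.store k)
      (Function.update (s.store k) o
        ((RGate.encs (gs.map (RGate.map (SymIdx.val s)))).reverse ++ s.store k o))
      ((12 * L + 4) * symCost gs + 1) := by
  have := Frag.runs_emitGatesRev (W := W) ho.1 (σ := s.store k) rfl (SymIdx.ok_gates ho hL gs)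
  rwa [SymIdx.map_val_toIdx, length_gateToks] at this

theorem runs_emitSymRev_AsV {s : Regs} {L : ℕ} (hL : s.w ≤ L ∧ s.a ≤ L ∧ s.b ≤ L)
    (gs : List (RGate SymIdx)) :
    (emitSymRev rAsV gs : Frag (Reg k) W).RunsIn (s.store k)
      (store k { s with asV := (RGate.encs (gs.map (RGate.map (SymIdx.val s)))).reverse ++ s.asV })
      ((12 * L + 4) * symCost gs + 1) :=
  (runs_emitSymRev (o := rAsV) (by simp [SymIdx.Target]) hL gs).cast le_rfl (update_asV s _).symm

theorem runs_emitSym_DnV {s : Regs} {L : ℕ} (hL : s.w ≤ L ∧ s.a ≤ L ∧ s.b ≤ L)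
    (gs : List (RGate SymIdx)) :
    (emitSym rDnV gs : Frag (Reg k) W).RunsIn (s.store k)
      (store k { s with dnV := RGate.encs (gs.map (RGate.map (SymIdx.val s))) ++ s.dnV })
      ((12 * L + 4) * symCost gs + 1) :=
  (runs_emitSym (o := rDnV) (by simp [SymIdx.Target]) hL gs).cast le_rfl (update_dnV s _).symm

theorem runs_emitSymRev_AsA {s : Regs} {L : ℕ} (hL : s.w ≤ L ∧ s.a ≤ L ∧ s.b ≤ L)
    (gs : List (RGate SymIdx)) :
    (emitSymRev rAsA gs : Frag (Reg k) W).RunsIn (s.store k)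
      (store k { s with asA := (RGate.encs (gs.map (RGate.map (SymIdx.val s)))).reverse ++ s.asA })
      ((12 * L + 4) * symCost gs + 1) :=
  (runs_emitSymRev (o := rAsA) (by simp [SymIdx.Target]) hL gs).cast le_rfl (update_asA s _).symm

theorem runs_emitSym_DnA {s : Regs} {L : ℕ} (hL : s.w ≤ L ∧ s.a ≤ L ∧ s.b ≤ L)
    (gs : List (RGate SymIdx)) :
    (emitSym rDnA gs : Frag (Reg k) W).RunsIn (s.store k)
      (store k { s with dnA := RGate.encs (gs.map (RGate.map (SymIdx.val s))) ++ s.dnA })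
      ((12 * L + 4) * symCost gs + 1) :=
  (runs_emitSym (o := rDnA) (by simp [SymIdx.Target]) hL gs).cast le_rfl (update_dnA s _).symm

theorem runs_emitSym_Hs {s : Regs} {L : ℕ} (hL : s.w ≤ L ∧ s.a ≤ L ∧ s.b ≤ L)
    (gs : List (RGate SymIdx)) :
    (emitSym rHs gs : Frag (Reg k) W).RunsIn (s.store k)
      (store k { s with hs := RGate.encs (gs.map (RGate.map (SymIdx.val s))) ++ s.hs })
      ((12 * L + 4) * symCost gs + 1) :=
  (runs_emitSym (o := rHs) (by simp [SymIdx.Target]) hL gs).cast le_rfl (update_hs s _).symm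

theorem runs_emitSym_CV {s : Regs} {L : ℕ} (hL : s.w ≤ L ∧ s.a ≤ L ∧ s.b ≤ L)
    (gs : List (RGate SymIdx)) :
    (emitSym rCV gs : Frag (Reg k) W).RunsIn (s.store k)
      (store k { s with cV := RGate.encs (gs.map (RGate.map (SymIdx.val s))) ++ s.cV })
      ((12 * L + 4) * symCost gs + 1) :=
  (runs_emitSym (o := rCV) (by simp [SymIdx.Target]) hL gs).cast le_rfl (update_cV s _).symm

theorem runs_emitSym_CA {s : Regs} {L : ℕ} (hL : s.w ≤ L ∧ s.a ≤ L ∧ s.b ≤ L)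
    (gs : List (RGate SymIdx)) :
    (emitSym rCA gs : Frag (Reg k) W).RunsIn (s.store k)
      (store k { s with cA := RGate.encs (gs.map (RGate.map (SymIdx.val s))) ++ s.cA })
      ((12 * L + 4) * symCost gs + 1) :=
  (runs_emitSym (o := rCA) (by simp [SymIdx.Target]) hL gs).cast le_rfl (update_cA s _).symm

theorem runs_emitSym_Out {s : Regs} {L : ℕ} (hL : s.w ≤ L ∧ s.a ≤ L ∧ s.b ≤ L)
    (gs : List (RGate SymIdx)) :
    (emitSym rOut gs : Frag (Reg k) W).RunsIn (s.store k)
      (store k { s with out := RGate.encs (gs.map (RGate.map (SymIdx.val s))) ++ s.out })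
      ((12 * L + 4) * symCost gs + 1) :=
  (runs_emitSym (o := rOut) (by simp [SymIdx.Target]) hL gs).cast le_rfl (update_out s _).symm

end emit

/-- The check that the current wire is set. -/
def symOnes : List (RGate SymIdx) := [tof (.w 3) (.w 4) (.w 5)]

/-- The Hadamard gate on the current wire. -/
def symHadamard : List (RGate SymIdx) := [.h (.w 4)]

namespace Regs

/-- The contents after a wire with checks `gs` has been processed. -/
def addWire (s : Regs) (gs : List (RGate ℕ)) : Regs :=
  { s with
    w := s.w + 1
    asV := (RGate.encs gs).reverse ++ s.asV
    dnV := RGate.encs gs ++ s.dnV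
    asA := (RGate.encs [tof (2 * s.w + 3) (2 * s.w + 4) (2 * s.w + 5)]).reverse ++ s.asA
    dnA := RGate.encs [tof (2 * s.w + 3) (2 * s.w + 4) (2 * s.w + 5)] ++ s.dnA
    hs := RGate.encs [.h (2 * s.w + 4)] ++ s.hs }

end Regs

/-! ### Processing one wire, and the operations on single registers. -/

section program
variable {k : ℕ} {W : Type}

/-- Process a wire with checks `gs`. -/
def wireStep (gs : List (RGate SymIdx)) : Frag (Reg k) W :=
  Frag.seqs [emitSymRev rAsV gs, emitSym rDnV gs, emitSymRev rAsA symOnes, emitSym rDnA symOnes,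
    emitSym rHs symHadamard, Frag.push rW Letter.one]

/-- The checks of a new wire come last in the ascending list and first in the descending one. The
former is therefore kept reversed, so that both lists grow at the top of a stack. The counter is
incremented at the end because the qubit numbers refer to its old value. -/
theorem runs_wireStep {s : Regs} {L : ℕ}
    (hL : s.w ≤ L ∧ s.a ≤ L ∧ s.b ≤ L) (gs : List (RGate SymIdx)) :
    (wireStep gs : Frag (Reg k) W).RunsIn (s.store k)
      ((s.addWire (gs.map (RGate.map (SymIdx.val s)))).store k)
      ((12 * L + 4) * (2 * symCost gs + 100) + 8) := by
  have h6 : ∀ s' : Regs, (Frag.push rW Letter.one : Frag (Reg k) W).RunsIn (s'.store k)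
      (store k { s' with w := s'.w + 1 }) 2 := fun s' =>
    (Frag.runs_push (W := W) (rW : Reg k) Letter.one (s'.store k)).cast le_rfl
      (update_w s' (s'.w + 1)).symm
  refine ((runs_emitSymRev_AsV hL gs).seqs_cons ((runs_emitSym_DnV (by exact hL) gs).seqs_cons
    ((runs_emitSymRev_AsA (by exact hL) symOnes).seqs_cons
    ((runs_emitSym_DnA (by exact hL) symOnes).seqs_cons
    ((runs_emitSym_Hs (by exact hL) symHadamard).seqs_cons
    ((h6 _).seqs_cons (Frag.runs_seqs_nil _))))))).cast ?_ rfl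
  -- The `100` covers the fixed items, `19 + 19 + 7` in number. The `8` is one step for each of the
  -- five emissions, two for the push and one for the end of the sequence.
  have e1 : symCost symOnes = 19 := rfl
  have e2 : symCost symHadamard = 7 := rfl
  rw [e1, e2]
  nlinarith

namespace Frag

/-- Empty the stack `r`. -/
def clear {ι : Type} [DecidableEq ι] (r : ι) : Frag ι W := loop r Option.isSome (pop r)

theorem runs_clear {ι : Type} [DecidableEq ι] {r : ι} (l : List Letter) :
    ∀ σ : ι → List Letter, σ r = l →
      (clear r : Frag ι W).RunsIn σ (Function.update σ r []) (2 * l.length + 1) := by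
  induction l with
  | nil =>
    intro σ h
    refine (runs_loop_exit (by simp [h])).cast (by simp) ?_
    rw [← h, Function.update_eq_self]
  | cons a l ih =>
    intro σ h
    have h1 := ih (Function.update σ r (σ r).tail) (by simp [h])
    refine ((runs_pop r σ).loop_step (by simp [h]) h1).cast (by simp; omega) (by simp)

end Frag

namespace Regs

theorem runs_pop_inp (s : Regs) : (Frag.pop rInp : Frag (Reg k) W).RunsIn (s.store k)
    (store k { s with inp := s.inp.tail }) 1 :=
  (Frag.runs_pop rInp (s.store k)).cast le_rfl (update_inp s _).symm

theorem runs_readNum_a {s : Regs} {v : ℕ} {l : List Letter} (h : s.inp = unary v ++ l)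
    (ha : s.a = 0) : (Frag.readNum rInp rA : Frag (Reg k) W).RunsIn (s.store k)
      (store k { s with inp := l, a := v }) (3 * v + 2) := by
  refine (Frag.runs_readNum (r := rInp) (o := rA) (by simp) (σ := s.store k) h).cast le_rfl ?_
  rw [update_inp, show ones v ++ s.store k rA = ones v by
    change ones v ++ ones s.a = ones v; simp [ha], update_a]

theorem runs_readNum_b {s : Regs} {v : ℕ} {l : List Letter} (h : s.inp = unary v ++ l)
    (hb : s.b = 0) : (Frag.readNum rInp rB : Frag (Reg k) W).RunsIn (s.store k)
      (store k { s with inp := l, b := v }) (3 * v + 2) := by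
  refine (Frag.runs_readNum (r := rInp) (o := rB) (by simp) (σ := s.store k) h).cast le_rfl ?_
  rw [update_inp, show ones v ++ s.store k rB = ones v by
    change ones v ++ ones s.b = ones v; simp [hb], update_b]

theorem runs_clear_a (s : Regs) : (Frag.clear rA : Frag (Reg k) W).RunsIn (s.store k)
    (store k { s with a := 0 }) (2 * s.a + 1) :=
  (Frag.runs_clear (ones s.a) (s.store k) rfl).cast (by simp) (update_a s 0).symm

theorem runs_clear_b (s : Regs) : (Frag.clear rB : Frag (Reg k) W).RunsIn (s.store k)
    (store k { s with b := 0 }) (2 * s.b + 1) :=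
  (Frag.runs_clear (ones s.b) (s.store k) rfl).cast (by simp) (update_b s 0).symm

theorem runs_pour_asV (s : Regs) : (Frag.pour rAsV rCV : Frag (Reg k) W).RunsIn (s.store k)
    (store k { s with asV := [], cV := s.asV.reverse ++ s.cV }) (3 * s.asV.length + 1) := by
  refine (Frag.runs_pour (by simp) s.asV (s.store k) rfl).cast le_rfl ?_
  rw [update_asV]; exact (update_cV { s with asV := [] } _).symm

theorem runs_pour_asA (s : Regs) : (Frag.pour rAsA rCA : Frag (Reg k) W).RunsIn (s.store k)
    (store k { s with asA := [], cA := s.asA.reverse ++ s.cA }) (3 * s.asA.length + 1) := by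
  refine (Frag.runs_pour (by simp) s.asA (s.store k) rfl).cast le_rfl ?_
  rw [update_asA]; exact (update_cA { s with asA := [] } _).symm

theorem runs_prepend_dnV (s : Regs) :
    (Frag.prepend rTmp rDnV rCV : Frag (Reg k) W).RunsIn (s.store k)
      (store k { s with dnV := [], cV := s.dnV ++ s.cV }) (6 * s.dnV.length + 2) := by
  refine (Frag.runs_prepend (by simp) (by simp) (by simp) (σ := s.store k) rfl).cast le_rfl ?_
  rw [update_dnV]; exact (update_cV { s with dnV := [] } _).symm

theorem runs_prepend_dnA (s : Regs) :
    (Frag.prepend rTmp rDnA rCA : Frag (Reg k) W).RunsIn (s.store k)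
      (store k { s with dnA := [], cA := s.dnA ++ s.cA }) (6 * s.dnA.length + 2) := by
  refine (Frag.runs_prepend (by simp) (by simp) (by simp) (σ := s.store k) rfl).cast le_rfl ?_
  rw [update_dnA]; exact (update_cA { s with dnA := [] } _).symm

theorem runs_copy_hs (s : Regs) :
    (Frag.copy rTmp rHs rOut : Frag (Reg k) W).RunsIn (s.store k)
      (store k { s with out := s.hs ++ s.out }) (6 * s.hs.length + 2) :=
  (Frag.runs_copy (by simp) (by simp) (by simp) (σ := s.store k) rfl).cast le_rfl
    (update_out s _).symm

theorem runs_copy_cV (s : Regs) :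
    (Frag.copy rTmp rCV rOut : Frag (Reg k) W).RunsIn (s.store k)
      (store k { s with out := s.cV ++ s.out }) (6 * s.cV.length + 2) :=
  (Frag.runs_copy (by simp) (by simp) (by simp) (σ := s.store k) rfl).cast le_rfl
    (update_out s _).symm

theorem runs_copy_cA (s : Regs) :
    (Frag.copy rTmp rCA rOut : Frag (Reg k) W).RunsIn (s.store k)
      (store k { s with out := s.cA ++ s.out }) (6 * s.cA.length + 2) :=
  (Frag.runs_copy (by simp) (by simp) (by simp) (σ := s.store k) rfl).cast le_rfl
    (update_out s _).symm

end Regs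

end program

theorem Regs.store_inp (k : ℕ) (s : Regs) : s.store k rInp = s.inp := rfl

theorem Regs.store_tmp (k : ℕ) (s : Regs) : s.store k rTmp = [] := rfl

theorem Regs.store_inr (k : ℕ) (s : Regs) (j : Fin (k + 1)) :
    s.store k (Sum.inr j) = if j = 0 then s.out else [] := rfl

theorem Regs.store_start (k : ℕ) (w : List Letter) :
    Regs.store k ⟨w, 0, 0, 0, [], [], [], [], [], [], [], []⟩ =
      Function.update (fun _ => []) (Sum.inl 0) w := by
  funext j
  rcases j with j | j
  · fin_cases j <;> rfl
  · by_cases hj : j = 0 <;> simp [store, hj]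

-- From here on stores are compared through their records `Regs`: contents are read by the four
-- preceding lemmas and changed by the `update` lemmas.
attribute [irreducible] Regs.store

/-! ### Loop invariants and running time of the translation. -/

section program
variable {k : ℕ} {W : Type}

/-- The contents after `m` input wires. -/
def inputRegs (m : ℕ) (inp : List Letter) : Regs where
  inp := inp
  w := m
  a := 0
  b := 0
  asV := []
  dnV := []
  asA := (RGate.encs (onesAsc m)).reverse
  dnA := RGate.encs (onesDesc m)
  hs := RGate.encs (hadamards m)
  cV := []
  cA := []
  out := []

/-- The contents after the gates of the circuit `C`. -/
def gateRegs {n s : ℕ} (C : BoolCircuit n s) (inp : List Letter) : Regs :=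
  { inputRegs (n + s) inp with
    asV := (RGate.encs C.asc).reverse
    dnV := RGate.encs C.desc }

/-- Process the input wires. -/
def inputLoop : Frag (Reg k) W := Frag.loop rInp isOne (Frag.seq (Frag.pop rInp) (wireStep []))

/-- Each letter `1` of the input count is one input wire. An input wire is subject to no consistency
check, so only its link in the chain for ones and its Hadamard gate are recorded. -/
theorem runs_inputLoop {L : ℕ} (v : ℕ) : ∀ (m : ℕ) (inp : List Letter), m + v ≤ L →
    (inputLoop : Frag (Reg k) W).RunsIn ((inputRegs m (unary v ++ inp)).store k)
      ((inputRegs (m + v) (Letter.sep :: inp)).store k) (v * (2000 * (L + 1)) + 1) := by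
  induction v with
  | zero =>
    intro m inp _
    exact (Frag.runs_loop_exit (by rw [Regs.store_inp]; rfl)).cast (by simp) rfl
  | succ v ih =>
    intro m inp hm
    have h1 := Regs.runs_pop_inp (k := k) (W := W) (inputRegs m (unary (v + 1) ++ inp))
    have h2 := runs_wireStep (k := k) (W := W)
      (s := inputRegs m (unary v ++ inp)) (L := L)
      ⟨show m ≤ L by omega, Nat.zero_le _, Nat.zero_le _⟩ []
    have h3 := ih (m + 1) inp (by omega)
    have e : (inputRegs m (unary v ++ inp)).addWire
        (([] : List (RGate SymIdx)).map (RGate.map (SymIdx.val (inputRegs m (unary v ++ inp))))) =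
        inputRegs (m + 1) (unary v ++ inp) := by
      simp [addWire, inputRegs, onesAsc, onesDesc, hadamards, RGate.encs]
    rw [e] at h2
    refine (Frag.RunsIn.loop_step (by rw [Regs.store_inp]; rfl) (h1.seq h2) h3).cast ?_ ?_
    · simp only [symCost, List.map_nil, List.flatMap_nil, List.length_nil]
      nlinarith
    · rw [Nat.add_right_comm]; rfl

/-- Process a NOT gate. -/
def notStep : Frag (Reg k) W :=
  Frag.seqs [Frag.pop rInp, Frag.readNum rInp rA,
    wireStep (notBlock (.w 3) (.w 4) (.w 5) (.a 4)), Frag.clear rA]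

/-- Process a gate with two arguments. -/
def binaryStep (gs : List (RGate SymIdx)) : Frag (Reg k) W :=
  Frag.seqs [Frag.pop rInp, Frag.readNum rInp rA, Frag.readNum rInp rB,
    wireStep gs, Frag.clear rA, Frag.clear rB]

/-- Test for the letter of a NOT gate. -/
def isNot : Option Letter → Bool
  | some Letter.bnot => true
  | _ => false

/-- Test for the letter of an AND gate. -/
def isAnd : Option Letter → Bool
  | some Letter.band => true
  | _ => false

/-- Process a gate. -/
def gateStep : Frag (Reg k) W :=
  Frag.ite rInp isNot notStep (Frag.ite rInp isAnd
    (binaryStep (andBlock (.cst 1) (.w 3) (.w 4) (.w 5) (.a 4) (.b 4)))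
    (binaryStep (orBlock (.cst 1) (.w 3) (.w 4) (.w 5) (.a 4) (.b 4))))

variable {n s : ℕ}

theorem runs_notStep {L : ℕ} (hL : n + s ≤ L) (C : BoolCircuit n s) (i : Fin (n + s))
    (inp : List Letter) : (notStep : Frag (Reg k) W).RunsIn
      ((gateRegs C (Letter.bnot :: (unary i ++ inp))).store k)
      ((gateRegs (C.not i) inp).store k) (10000 * (L + 1)) := by
  have hi := i.isLt
  have h3 := runs_wireStep (k := k) (W := W) (s := { gateRegs C inp with a := i }) (L := L)
    ⟨hL, by dsimp only; omega, Nat.zero_le _⟩ (notBlock (.w 3) (.w 4) (.w 5) (.a 4))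
  refine ((Regs.runs_pop_inp _).seqs_cons ((Regs.runs_readNum_a (v := i) (l := inp) rfl
    rfl).seqs_cons (h3.seqs_cons ((Regs.runs_clear_a _).seqs_cons
    (Frag.runs_seqs_nil _))))).cast ?_ ?_
  · have e : symCost (notBlock (.w 3) (.w 4) (.w 5) (.a 4)) = 38 := rfl
    rw [e]
    simp only [addWire]
    omega
  · congr 1
    simp [gateRegs, inputRegs, addWire, BoolCircuit.asc, BoolCircuit.desc, onesAsc, onesDesc,
      hadamards, RGate.encs, notBlock, RGate.map, SymIdx.val, ← Nat.add_assoc]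

theorem runs_andStep {L : ℕ} (hL : n + s ≤ L) (C : BoolCircuit n s) (i j : Fin (n + s))
    (inp : List Letter) :
    (binaryStep (andBlock (.cst 1) (.w 3) (.w 4) (.w 5) (.a 4) (.b 4)) : Frag (Reg k) W).RunsIn
      ((gateRegs C (Letter.band :: (unary i ++ unary j ++ inp))).store k)
      ((gateRegs (C.and i j) inp).store k) (10000 * (L + 1)) := by
  have hi := i.isLt
  have hj := j.isLt
  have h3 := runs_wireStep (k := k) (W := W) (s := { gateRegs C inp with a := i, b := j }) (L := L)
    ⟨hL, by dsimp only; omega, by dsimp only; omega⟩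
    (andBlock (.cst 1) (.w 3) (.w 4) (.w 5) (.a 4) (.b 4))
  refine ((Regs.runs_pop_inp _).seqs_cons ((Regs.runs_readNum_a (v := i) (l := unary j ++ inp)
    (by simp [gateRegs, inputRegs]) rfl).seqs_cons ((Regs.runs_readNum_b (v := j) (l := inp) rfl
    rfl).seqs_cons (h3.seqs_cons ((Regs.runs_clear_a _).seqs_cons ((Regs.runs_clear_b _).seqs_cons
    (Frag.runs_seqs_nil _))))))).cast ?_ ?_
  · have e : symCost (andBlock (.cst 1) (.w 3) (.w 4) (.w 5) (.a 4) (.b 4)) = 93 := rfl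
    rw [e]
    simp only [addWire]
    omega
  · congr 1
    simp [gateRegs, inputRegs, addWire, BoolCircuit.asc, BoolCircuit.desc, onesAsc, onesDesc,
      hadamards, RGate.encs, andBlock, RGate.map, SymIdx.val, ← Nat.add_assoc]

theorem runs_orStep {L : ℕ} (hL : n + s ≤ L) (C : BoolCircuit n s) (i j : Fin (n + s))
    (inp : List Letter) :
    (binaryStep (orBlock (.cst 1) (.w 3) (.w 4) (.w 5) (.a 4) (.b 4)) : Frag (Reg k) W).RunsIn
      ((gateRegs C (Letter.bor :: (unary i ++ unary j ++ inp))).store k)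
      ((gateRegs (C.or i j) inp).store k) (10000 * (L + 1)) := by
  have hi := i.isLt
  have hj := j.isLt
  have h3 := runs_wireStep (k := k) (W := W) (s := { gateRegs C inp with a := i, b := j }) (L := L)
    ⟨hL, by dsimp only; omega, by dsimp only; omega⟩
    (orBlock (.cst 1) (.w 3) (.w 4) (.w 5) (.a 4) (.b 4))
  refine ((Regs.runs_pop_inp _).seqs_cons ((Regs.runs_readNum_a (v := i) (l := unary j ++ inp)
    (by simp [gateRegs, inputRegs]) rfl).seqs_cons ((Regs.runs_readNum_b (v := j) (l := inp) rfl
    rfl).seqs_cons (h3.seqs_cons ((Regs.runs_clear_a _).seqs_cons ((Regs.runs_clear_b _).seqs_cons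
    (Frag.runs_seqs_nil _))))))).cast ?_ ?_
  · have e : symCost (orBlock (.cst 1) (.w 3) (.w 4) (.w 5) (.a 4) (.b 4)) = 131 := rfl
    rw [e]
    simp only [addWire]
    omega
  · congr 1
    simp [gateRegs, inputRegs, addWire, BoolCircuit.asc, BoolCircuit.desc, onesAsc, onesDesc,
      hadamards, RGate.encs, andBlock, orBlock, RGate.map, SymIdx.val, ← Nat.add_assoc]

/-- The part of the description of a circuit that lists the gates. -/
def BoolCircuit.gateWord : {s : ℕ} → BoolCircuit n s → List Letter
  | _, .nil => []
  | _, .not C i => C.gateWord ++ Letter.bnot :: unary i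
  | _, .and C i j => C.gateWord ++ Letter.band :: (unary i ++ unary j)
  | _, .or C i j => C.gateWord ++ Letter.bor :: (unary i ++ unary j)

theorem BoolCircuit.encode_eq (C : BoolCircuit n s) : C.encode = unary n ++ C.gateWord := by
  induction C with
  | nil => simp [encode, gateWord]
  | not C i ih => simp [encode, gateWord, ih]
  | and C i j ih => simp [encode, gateWord, ih]
  | or C i j ih => simp [encode, gateWord, ih]

/-- Process all gates. -/
def gateLoop : Frag (Reg k) W := Frag.loop rInp Option.isSome gateStep

/-- Circuits grow at the end, whereas the loop reads from the front. The statement is therefore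
about prolonging an arbitrary run that starts after the gates of `C`, and the induction moves its
starting point back by one gate at a time. -/
theorem runs_gateLoop {L : ℕ} (C : BoolCircuit n s) : n + s ≤ L → ∀ (inp : List Letter)
    (σ : Reg k → List Letter) (B : ℕ),
    (gateLoop : Frag (Reg k) W).RunsIn ((gateRegs C inp).store k) σ B →
    (gateLoop : Frag (Reg k) W).RunsIn
      ((gateRegs (BoolCircuit.nil (n := n)) (C.gateWord ++ inp)).store k) σ
      (B + s * (20000 * (L + 1))) := by
  induction C with
  | nil => intro _ inp σ B h; simpa [BoolCircuit.gateWord] using h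
  | not C i ih =>
    intro hL inp σ B h
    have h1 := runs_notStep (k := k) (W := W) (L := L) (by omega) C i inp
    have h2 : (gateStep : Frag (Reg k) W).RunsIn _ _ _ :=
        Frag.RunsIn.ite_true (by rw [Regs.store_inp]; rfl) h1
    have h3 := ih (by omega) _ σ _ (Frag.RunsIn.loop_step (by rw [Regs.store_inp]; rfl) h2 h)
    simp only [BoolCircuit.gateWord, List.append_assoc, List.cons_append] at h3 ⊢
    exact h3.mono (by nlinarith)
  | and C i j ih =>
    intro hL inp σ B h
    have h1 := runs_andStep (k := k) (W := W) (L := L) (by omega) C i j inp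
    have h2 : (gateStep : Frag (Reg k) W).RunsIn _ _ _ :=
      Frag.RunsIn.ite_false (by rw [Regs.store_inp]; rfl)
          (Frag.RunsIn.ite_true (by rw [Regs.store_inp]; rfl) h1)
    have h3 := ih (by omega) _ σ _ (Frag.RunsIn.loop_step (by rw [Regs.store_inp]; rfl) h2 h)
    simp only [BoolCircuit.gateWord, List.append_assoc, List.cons_append] at h3 ⊢
    exact h3.mono (by nlinarith)
  | or C i j ih =>
    intro hL inp σ B h
    have h1 := runs_orStep (k := k) (W := W) (L := L) (by omega) C i j inp
    have h2 : (gateStep : Frag (Reg k) W).RunsIn _ _ _ :=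
      Frag.RunsIn.ite_false (by rw [Regs.store_inp]; rfl)
          (Frag.RunsIn.ite_false (by rw [Regs.store_inp]; rfl) h1)
    have h3 := ih (by omega) _ σ _ (Frag.RunsIn.loop_step (by rw [Regs.store_inp]; rfl) h2 h)
    simp only [BoolCircuit.gateWord, List.append_assoc, List.cons_append] at h3 ⊢
    exact h3.mono (by nlinarith)

/-- Write one round of the circuit. -/
def roundStep : Frag (Reg k) W :=
  Frag.seqs [Frag.copy rTmp rHs rOut, Frag.copy rTmp rCA rOut, Frag.copy rTmp rCA rOut,
    Frag.copy rTmp rHs rOut, emitSym rOut [.h (.cst 2), .x (.cst 2), .h (.cst 2)],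
    Frag.copy rTmp rCV rOut, Frag.copy rTmp rCV rOut]

/-- The contents when the output is written. -/
def outRegs (C : BoolCircuit n s) (out : List Letter) : Regs :=
  { inputRegs (n + s) [] with
    asA := []
    dnA := []
    cV := RGate.encs C.checkHalf
    cA := RGate.encs (onesHalf (n + s))
    out := out }

/-- The output is a stack, so the round is written from its last gate to its first. Six copies of
texts of length at most `R` account for `36 R`. -/
theorem runs_roundStep {R : ℕ} (C : BoolCircuit n s) (hV : (RGate.encs C.checkHalf).length ≤ R)
    (hA : (RGate.encs (onesHalf (n + s))).length ≤ R)
    (hH : (RGate.encs (hadamards (n + s))).length ≤ R) (out : List Letter) :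
    (roundStep : Frag (Reg k) W).RunsIn ((outRegs C out).store k)
      ((outRegs C (RGate.encs C.round ++ out)).store k)
      (36 * R + 200 * (n + s) + 200) := by
  have c1 : ∀ o, (Frag.copy rTmp rHs rOut : Frag (Reg k) W).RunsIn ((outRegs C o).store k)
      ((outRegs C (RGate.encs (hadamards (n + s)) ++ o)).store k) (6 * R + 2) :=
    fun o => (Regs.runs_copy_hs (k := k) (W := W) (outRegs C o)).mono
      (show _ ≤ 6 * R + 2 from Nat.add_le_add_right (Nat.mul_le_mul_left 6 hH) 2)
  have c2 : ∀ o, (Frag.copy rTmp rCA rOut : Frag (Reg k) W).RunsIn ((outRegs C o).store k)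
      ((outRegs C (RGate.encs (onesHalf (n + s)) ++ o)).store k) (6 * R + 2) :=
    fun o => (Regs.runs_copy_cA (k := k) (W := W) (outRegs C o)).mono
      (show _ ≤ 6 * R + 2 from Nat.add_le_add_right (Nat.mul_le_mul_left 6 hA) 2)
  have c3 : ∀ o, (Frag.copy rTmp rCV rOut : Frag (Reg k) W).RunsIn ((outRegs C o).store k)
      ((outRegs C (RGate.encs C.checkHalf ++ o)).store k) (6 * R + 2) :=
    fun o => (Regs.runs_copy_cV (k := k) (W := W) (outRegs C o)).mono
      (show _ ≤ 6 * R + 2 from Nat.add_le_add_right (Nat.mul_le_mul_left 6 hV) 2)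
  have c4 : ∀ o, (emitSym rOut [.h (.cst 2), .x (.cst 2), .h (.cst 2)] :
      Frag (Reg k) W).RunsIn ((outRegs C o).store k)
      ((outRegs C (RGate.encs auxPhase ++ o)).store k)
      ((12 * (n + s) + 4) * symCost [.h (.cst 2), .x (.cst 2), .h (.cst 2)] + 1) :=
    fun o => runs_emitSym_Out (k := k) (W := W) (s := outRegs C o) (L := n + s)
    ⟨le_rfl, Nat.zero_le _, Nat.zero_le _⟩ [.h (.cst 2), .x (.cst 2), .h (.cst 2)]
  have e : symCost [.h (.cst 2), .x (.cst 2), .h (.cst 2)] = 12 := rfl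
  rw [e] at c4
  have c := (c1 out).seqs_cons ((c2 _).seqs_cons ((c2 _).seqs_cons ((c1 _).seqs_cons
    ((c4 _).seqs_cons ((c3 _).seqs_cons ((c3 _).seqs_cons (Frag.runs_seqs_nil _)))))))
  refine Frag.RunsIn.cast c (by omega) (congrArg (store k) ?_)
  simp [BoolCircuit.round]

/-- Assemble the two checks. -/
def assemble : Frag (Reg k) W :=
  Frag.seqs [emitSym rCV [tof (.w 3) (.w 2) (.cst 0), tof (.w 3) (.cst 2) (.cst 0)],
    Frag.pour rAsV rCV, Frag.prepend rTmp rDnV rCV,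
    emitSym rCA [tof (.w 3) (.cst 2) (.cst 0)],
    Frag.pour rAsA rCA, Frag.prepend rTmp rDnA rCA]

/-- Again from back to front: the final Toffoli gates, then the ascending list, whose reversed
storage is undone by a pour, then the descending list, moved with its order preserved. -/
theorem runs_assemble {R : ℕ} (C : BoolCircuit n s) (h1 : (RGate.encs C.desc).length ≤ R)
    (h2 : (RGate.encs C.asc).length ≤ R) (h3 : (RGate.encs (onesDesc (n + s))).length ≤ R)
    (h4 : (RGate.encs (onesAsc (n + s))).length ≤ R) :
    (assemble : Frag (Reg k) W).RunsIn ((gateRegs C []).store k) ((outRegs C []).store k)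
      (18 * R + 500 * (n + s) + 500) := by
  refine ((runs_emitSym_CV (L := n + s) ⟨le_rfl, Nat.zero_le _, Nat.zero_le _⟩ _).seqs_cons
    ((Regs.runs_pour_asV _).seqs_cons ((Regs.runs_prepend_dnV _).seqs_cons
    ((runs_emitSym_CA (L := n + s) ⟨le_rfl, Nat.zero_le _, Nat.zero_le _⟩ _).seqs_cons
    ((Regs.runs_pour_asA _).seqs_cons ((Regs.runs_prepend_dnA _).seqs_cons
    (Frag.runs_seqs_nil _))))))).cast ?_ ?_
  · have e1 : symCost [tof (.w 3) (.w 2) (.cst 0), tof (.w 3) (.cst 2) (.cst 0)] = 21 := rfl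
    have e2 : symCost [tof (.w 3) (.cst 2) (.cst 0)] = 10 := rfl
    rw [e1, e2]
    simp only [gateRegs, inputRegs, List.length_reverse]
    omega
  · congr 1
    simp [outRegs, gateRegs, inputRegs, BoolCircuit.checkHalf, onesHalf, RGate.map, SymIdx.val]

/-- The translation program. -/
def translation (k c : ℕ) (W : Type) : Frag (Reg k) W :=
  Frag.seqs [emitSym rDnA [.x (.cst 3)], emitSym rHs [.h (.cst 2)], inputLoop, Frag.pop rInp,
    emitSym rDnV [.x (.w 3)], gateLoop, assemble,
    emitSym rOut [.x (.cst 0)], roundStep, roundStep, roundStep, roundStep,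
    Frag.emitNum rTmp rOut (SymIdx.toIdx k (.w (4 + c)))]

theorem runs_emitNum_out {s : Regs} {L : ℕ} (hL : s.w ≤ L ∧ s.a ≤ L ∧ s.b ≤ L) (i : SymIdx) :
    (Frag.emitNum rTmp rOut (i.toIdx k) : Frag (Reg k) W).RunsIn (s.store k)
      (store k { s with out := unary (i.val s) ++ s.out })
      ((12 * L + 4) * (i.toIdx k).toks.length + 1) := by
  have h := Frag.runs_emitNum (W := W) (tmp := rTmp) (o := (rOut : Reg k)) (by simp)
    (σ := s.store k) (Regs.store_tmp k s) (SymIdx.ok_toIdx (by simp [SymIdx.Target]) hL i)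
  rw [SymIdx.val_toIdx, Regs.store_inr, if_pos rfl] at h
  exact h.cast le_rfl (update_out s _).symm

/-- The translation writes the description of the one-clean-qubit circuit, in quadratic time. -/
theorem runs_translation (c : ℕ) {n s : ℕ} (C : BoolCircuit n s) (hs : 0 < s) :
    ∃ σ : Reg k → List Letter,
      (translation k c W).RunsIn (Function.update (fun _ => []) (Sum.inl 0) C.encode) σ
        ((1000000 + 100 * c) * (n + s + 1) ^ 2) ∧
      ∀ j, σ (Sum.inr j) = if j = 0 then (C.toDQC1 c).encode else [] := by
  set L := n + s with hL
  have hN : 2 * (n + s) + 4 ≤ 2 * L + 4 := le_rfl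
  -- Each of the seven texts has at most `18 L + 3` gates with at most `3 (2 L + 4) + 1 = 6 L + 13`
  -- letters each, which is within `300 (L + 1)^2`.
  have q1 : (RGate.encs C.desc).length ≤ 300 * (L + 1) ^ 2 := by
    refine (RGate.length_encs_le (C.valid_desc hN)).trans ?_
    have := C.length_desc_le
    nlinarith
  have q2 : (RGate.encs C.asc).length ≤ 300 * (L + 1) ^ 2 := by
    refine (RGate.length_encs_le (N := 2 * L + 4)
      fun g hg => C.valid_desc hN g (C.mem_desc_of_mem_asc g hg)).trans ?_
    have := C.length_asc_le
    nlinarith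
  have q3 : (RGate.encs (onesDesc L)).length ≤ 300 * (L + 1) ^ 2 := by
    refine (RGate.length_encs_le (valid_onesDesc hN)).trans ?_
    rw [length_onesDesc]
    nlinarith
  have q4 : (RGate.encs (onesAsc L)).length ≤ 300 * (L + 1) ^ 2 := by
    refine (RGate.length_encs_le (N := 2 * L + 4)
      fun g hg => valid_onesDesc hN g (mem_onesDesc_of_mem_onesAsc _ g hg)).trans ?_
    rw [length_onesAsc]
    nlinarith
  have q5 : (RGate.encs (hadamards L)).length ≤ 300 * (L + 1) ^ 2 := by
    refine (RGate.length_encs_le (valid_hadamards hN)).trans ?_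
    rw [length_hadamards]
    nlinarith
  have q6 : (RGate.encs C.checkHalf).length ≤ 300 * (L + 1) ^ 2 := by
    refine (RGate.length_encs_le (C.valid_checkHalf hs hN)).trans ?_
    have := C.length_checkHalf_le
    nlinarith
  have q7 : (RGate.encs (onesHalf L)).length ≤ 300 * (L + 1) ^ 2 := by
    refine (RGate.length_encs_le (valid_onesHalf hN)).trans ?_
    rw [length_onesHalf]
    nlinarith
  have h1 := runs_emitSym_DnA (k := k) (W := W) (s := ⟨C.encode, 0, 0, 0, [], [], [], [], [], [],
    [], []⟩) (L := 0) ⟨le_rfl, le_rfl, le_rfl⟩ [.x (.cst 3)]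
  have h2 := runs_emitSym_Hs (k := k) (W := W) (s := ⟨C.encode, 0, 0, 0, [], [], [],
    RGate.encs [.x 3], [], [], [], []⟩) (L := 0) ⟨le_rfl, le_rfl, le_rfl⟩ [.h (.cst 2)]
  have h3 := runs_inputLoop (k := k) (W := W) (L := L) n 0 C.gateWord (by omega)
  have h4 := Regs.runs_pop_inp (k := k) (W := W) (inputRegs (0 + n) (Letter.sep :: C.gateWord))
  have h5 := runs_emitSym_DnV (k := k) (W := W) (s := inputRegs (0 + n) C.gateWord) (L := L)
    ⟨show 0 + n ≤ L by omega, Nat.zero_le _, Nat.zero_le _⟩ [.x (.w 3)]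
  -- The run to be prolonged is the exit of the loop on exhausted input.
  have h6 := runs_gateLoop (k := k) (W := W) (L := L) C le_rfl [] _ _
    (Frag.runs_loop_exit (by rw [Regs.store_inp]; rfl))
  have h7 := runs_assemble (k := k) (W := W) C q1 q2 q3 q4
  have h8 := runs_emitSym_Out (k := k) (W := W) (s := outRegs C []) (L := L)
    ⟨le_rfl, Nat.zero_le _, Nat.zero_le _⟩ [.x (.cst 0)]
  have h9 := fun out => runs_roundStep (k := k) (W := W) C q6 q7 q5 out
  have h10 := runs_emitNum_out (k := k) (W := W) (s := outRegs C (RGate.encs C.rgates)) (L := L)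
    ⟨le_rfl, Nat.zero_le _, Nat.zero_le _⟩ (.w (4 + c))
  rw [Regs.store_start] at h1
  have e2 : ({ (⟨C.encode, 0, 0, 0, [], [], [], RGate.encs [.x 3], [], [], [], []⟩ : Regs) with
      hs := RGate.encs [.h 2] } : Regs) = inputRegs 0 (unary n ++ C.gateWord) := by
    simp [inputRegs, C.encode_eq, onesAsc, onesDesc, hadamards]
  have e5 : ({ inputRegs (0 + n) C.gateWord with
      dnV := RGate.encs [.x (2 * (0 + n) + 3)] ++ [] } : Regs) =
      gateRegs (BoolCircuit.nil (n := n)) (C.gateWord ++ []) := by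
    simp [gateRegs, inputRegs, BoolCircuit.asc, BoolCircuit.desc]
  have e9 : RGate.encs C.round ++ (RGate.encs C.round ++ (RGate.encs C.round ++
      (RGate.encs C.round ++ RGate.encs [.x 0]))) = RGate.encs C.rgates := by
    simp [BoolCircuit.rgates]
  refine ⟨_, (h1.seqs_cons ((h2.cast le_rfl (congrArg (store k) e2).symm).seqs_cons
    (h3.seqs_cons (h4.seqs_cons ((h5.cast le_rfl (congrArg (store k) e5).symm).seqs_cons
    (h6.seqs_cons (h7.seqs_cons (h8.seqs_cons ((h9 _).seqs_cons ((h9 _).seqs_cons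
    ((h9 _).seqs_cons (((h9 _).cast le_rfl (congrArg (fun l => store k (outRegs C l))
    e9).symm).seqs_cons (h10.seqs_cons (Frag.runs_seqs_nil _)))))))))))))).mono ?_, ?_⟩
  · have c1 : symCost [.x (.cst 3)] = 5 := rfl
    have c2 : symCost [.h (.cst 2)] = 4 := rfl
    have c3 : symCost [.x (.w 3)] = 6 := rfl
    have c4 : symCost [.x (.cst 0)] = 2 := rfl
    -- The number `c` of idle qubits is built into the program and written letter by letter; this is
    -- the source of the term `100 * c`.
    have c5 : (SymIdx.toIdx k (.w (4 + c))).toks.length = 6 + c := by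
      simp [SymIdx.toIdx, Frag.Idx.toks]; omega
    rw [c1, c2, c3, c4, c5]
    have hn : n ≤ L + 1 := by omega
    have hs' : s ≤ L + 1 := by omega
    clear_value L
    clear q1 q2 q3 q4 q5 q6 q7 h1 h2 h3 h4 h5 h6 h7 h8 h9 h10 e2 e5 e9 c1 c2 c3 c4 c5
    have a1 : n * (L + 1) ≤ (L + 1) ^ 2 := by nlinarith
    have a2 : s * (L + 1) ≤ (L + 1) ^ 2 := by nlinarith
    have a3 : L + 1 ≤ (L + 1) ^ 2 := by nlinarith
    have a4 : c * (L + 1) ≤ c * (L + 1) ^ 2 := Nat.mul_le_mul_left c a3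
    rw [← hL]
    nlinarith
  · intro j
    rw [Regs.store_inr, C.encode_toDQC1 hs]
    simp only [outRegs, SymIdx.val, inputRegs, ← hL, Nat.add_assoc]

end program

/-! ## Classical gate lists acting on bit strings -/

namespace RGate

/-- The action of a classical gate on bits numbered by `ℕ`. -/
def act : RGate ℕ → (ℕ → Bool) → ℕ → Bool
  | x i, b => Function.update b i (!b i)
  | h _, b => b
  | tof i j k, b => Function.update b k (xor (b k) (b i && b j))

/-- The action of a list of classical gates, the head being applied first. -/
def acts (gs : List (RGate ℕ)) (b : ℕ → Bool) : ℕ → Bool := gs.foldl (fun b g => g.act b) b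

theorem acts_cons (g : RGate ℕ) (gs : List (RGate ℕ)) (b : ℕ → Bool) :
    acts (g :: gs) b = acts gs (g.act b) := rfl

theorem acts_nil (b : ℕ → Bool) : acts [] b = b := rfl

theorem acts_append (gs gs' : List (RGate ℕ)) (b : ℕ → Bool) :
    acts (gs ++ gs') b = acts gs' (acts gs b) := List.foldl_append

end RGate

open RGate (acts acts_cons acts_nil acts_append)

/-- Flip the bit `d'` if the bit `d` and the condition `κ` hold. -/
def condFlip (d d' : ℕ) (κ : (ℕ → Bool) → Bool) (b : ℕ → Bool) : ℕ → Bool :=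
  Function.update b d' (xor (b d') (b d && κ b))

/-- `κ` depends only on the bits with positive even number. -/
def EvenDep (κ : (ℕ → Bool) → Bool) : Prop :=
  ∀ b b' : ℕ → Bool, (∀ v, v % 2 = 0 → v ≠ 0 → b v = b' v) → κ b = κ b'

theorem EvenDep.update {κ : (ℕ → Bool) → Bool} (h : EvenDep κ) (b : ℕ → Bool) {v : ℕ}
    (hv : v % 2 = 1 ∨ v = 0) (z : Bool) : κ (Function.update b v z) = κ b := by
  refine h _ _ fun u hu hu0 => Function.update_of_ne ?_ _ _
  omega

theorem acts_notBlock {d t d' i : ℕ} (h1 : d' ≠ d) (h2 : d' ≠ i) (b : ℕ → Bool) :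
    acts (notBlock d t d' i) b = condFlip d d' (fun b => xor (b t) (b i)) b := by
  funext v
  simp only [notBlock, acts_cons, acts_nil, RGate.act, condFlip]
  by_cases hv : v = d'
  · subst hv
    simp [h1.symm, h2.symm]
    cases b v <;> cases b d <;> cases b t <;> cases b i <;> rfl
  · simp [hv]

/-- The first four Toffoli gates form a commutator: they add `d ∧ i ∧ j` to `d'` and restore `e`,
whatever its value. The last three gates add `d ∧ ¬ t`, and `¬ t ⊕ (i ∧ j)` is the negation of `t ⊕
(i ∧ j)`. -/
theorem acts_andBlock {e d t d' i j : ℕ} (h1 : e ≠ d) (h2 : e ≠ t) (h3 : e ≠ d') (h4 : e ≠ i)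
    (h5 : e ≠ j) (h6 : d' ≠ d) (h7 : d' ≠ t) (h8 : d' ≠ i) (h9 : d' ≠ j) (h10 : d ≠ t)
    (b : ℕ → Bool) :
    acts (andBlock e d t d' i j) b = condFlip d d' (fun b => !xor (b t) (b i && b j)) b := by
  funext v
  simp only [andBlock, acts_cons, acts_nil, RGate.act, condFlip]
  by_cases hv : v = d'
  · subst hv
    simp [h3, h7, h10, h1.symm, h2.symm, h3.symm, h4.symm, h5.symm,
      h6.symm, h7.symm, h8.symm, h9.symm]
    cases b v <;> cases b d <;> cases b t <;> cases b i <;> cases b j <;> cases b e <;> rfl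
  · by_cases hv2 : v = e
    · subst hv2
      simp [h2, h3, h7, h10, h1.symm, h2.symm, h3.symm, h4.symm, h5.symm,
        h6.symm, h7.symm, h8.symm, h9.symm]
    · by_cases hv3 : v = t
      · subst hv3
        simp [h3, h7, h10, h1.symm, h2.symm, h3.symm, h4.symm, h5.symm,
          h6.symm, h7.symm, h8.symm, h9.symm]
      · simp [hv, hv2, hv3]

/-- Over the two-element field `i ∨ j = i + j + i j`, so two more Toffoli gates turn the check for
AND into one for OR. -/
theorem acts_orBlock {e d t d' i j : ℕ} (h1 : e ≠ d) (h2 : e ≠ t) (h3 : e ≠ d') (h4 : e ≠ i)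
    (h5 : e ≠ j) (h6 : d' ≠ d) (h7 : d' ≠ t) (h8 : d' ≠ i) (h9 : d' ≠ j) (h10 : d ≠ t)
    (b : ℕ → Bool) :
    acts (orBlock e d t d' i j) b = condFlip d d' (fun b => !xor (b t) (b i || b j)) b := by
  rw [orBlock, acts_cons, acts_cons, acts_andBlock h1 h2 h3 h4 h5 h6 h7 h8 h9 h10]
  funext v
  simp only [RGate.act, condFlip]
  by_cases hv : v = d'
  · subst hv
    simp [h6.symm, h7.symm, h8.symm, h9.symm]
    cases b v <;> cases b d <;> cases b t <;> cases b i <;> cases b j <;> rfl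
  · simp [hv]

/-- `F` flips the bit `2 m + 3` if `B` holds, is an involution, and changes only odd bits up to
this one. -/
structure Toggles (m : ℕ) (B : (ℕ → Bool) → Bool) (F : (ℕ → Bool) → ℕ → Bool) : Prop where
  dep : EvenDep B
  inv : ∀ b, F (F b) = b
  same : ∀ b v, v % 2 = 0 ∨ 2 * m + 3 < v → F b v = b v
  top : ∀ b, F b (2 * m + 3) = xor (b (2 * m + 3)) (B b)
  indep : ∀ b z, F (Function.update b 0 z) = Function.update (F b) 0 z

theorem Toggles.congr {m : ℕ} {B : (ℕ → Bool) → Bool} {F F' : (ℕ → Bool) → ℕ → Bool}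
    (h : Toggles m B F) (hF : ∀ b, F' b = F b) : Toggles m B F' := by
  rwa [funext hF]

theorem toggles_x (m : ℕ) : Toggles m (fun _ => true) (acts [.x (2 * m + 3)]) where
  dep := fun _ _ _ => rfl
  inv b := by simp [acts_cons, acts_nil, RGate.act]
  same b v hv := by
    simp only [acts_cons, acts_nil, RGate.act]
    exact Function.update_of_ne (by omega) _ _
  top b := by simp [acts_cons, acts_nil, RGate.act]
  indep b z := by
    simp only [acts_cons, acts_nil, RGate.act]
    rw [Function.update_comm (by omega), Function.update_of_ne (by omega)]

theorem condFlip_condFlip {d d' : ℕ} {κ : (ℕ → Bool) → Bool} (hκ : EvenDep κ) (hd : d' ≠ d)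
    (hd' : d' % 2 = 1 ∨ d' = 0) (b : ℕ → Bool) :
    condFlip d d' κ (condFlip d d' κ b) = b := by
  unfold condFlip
  rw [hκ.update b hd', Function.update_self, Function.update_of_ne hd.symm,
    Function.update_idem]
  simp

/-- The bit `2 m + 5` receives `d ∧ κ` before and `(d ⊕ B) ∧ κ` after the inner toggle, where `d` is
the unknown bit `2 m + 3`; the sum is `B ∧ κ`. As a conjugate of an involution the new map is again
an involution, so a second application will also restore the lower chain bits, which it leaves
disturbed. -/
theorem Toggles.step {m : ℕ} {B : (ℕ → Bool) → Bool} {F : (ℕ → Bool) → ℕ → Bool}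
    (h : Toggles m B F) {κ : (ℕ → Bool) → Bool} (hκ : EvenDep κ) :
    Toggles (m + 1) (fun b => B b && κ b) (fun b =>
      condFlip (2 * m + 3) (2 * m + 5) κ (F (condFlip (2 * m + 3) (2 * m + 5) κ b))) where
  dep b b' hb := by
    dsimp only
    rw [h.dep b b' hb, hκ b b' hb]
  inv b := by
    rw [condFlip_condFlip hκ (by omega) (by omega), h.inv,
      condFlip_condFlip hκ (by omega) (by omega)]
  same b v hv := by
    unfold condFlip
    rw [Function.update_of_ne (by omega), h.same _ _ (by omega), Function.update_of_ne (by omega)]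
  top b := by
    have hF : ∀ b, κ (F b) = κ b := fun b => hκ _ _ fun v hv _ => h.same b v (Or.inl hv)
    unfold condFlip
    rw [show 2 * (m + 1) + 3 = 2 * m + 5 by ring, Function.update_self,
      h.same _ (2 * m + 5) (Or.inr (by omega)), h.top, hF, hκ.update _ (by omega),
      h.dep.update _ (by omega), Function.update_self, Function.update_of_ne (by omega)]
    cases b (2 * m + 5) <;> cases b (2 * m + 3) <;> cases κ b <;> cases B b <;> rfl
  indep b z := by
    have hc : ∀ b z, condFlip (2 * m + 3) (2 * m + 5) κ (Function.update b 0 z) =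
        Function.update (condFlip (2 * m + 3) (2 * m + 5) κ b) 0 z := by
      intro b z
      unfold condFlip
      rw [hκ.update _ (Or.inr rfl), Function.update_of_ne (by omega),
        Function.update_of_ne (by omega), Function.update_comm (by omega)]
    rw [hc, h.indep, hc]

/-- Conjugating the last flip by the chain flips bit `0` under the conjunction of all conditions. -/
theorem Toggles.flip {m : ℕ} {B : (ℕ → Bool) → Bool} {F : (ℕ → Bool) → ℕ → Bool}
    (h : Toggles m B F) {τ : (ℕ → Bool) → Bool} (hτ : EvenDep τ) (b : ℕ → Bool) :
    condFlip (2 * m + 3) 0 τ (F (condFlip (2 * m + 3) 0 τ (F b))) =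
      Function.update b 0 (xor (b 0) (B b && τ b)) := by
  have hF : ∀ b, τ (F b) = τ b := fun b => hτ _ _ fun v hv _ => h.same b v (Or.inl hv)
  have h0 : ∀ b, F b 0 = b 0 := fun b => h.same b 0 (Or.inl rfl)
  -- After the first half, bit `0` still contains the unknown chain bit. The second application of
  -- `F` restores the chain, and the last conditional flip adds the unknown bit again, which removes
  -- it.
  have e1 : condFlip (2 * m + 3) 0 τ (F b) =
      Function.update (F b) 0 (xor (b 0) ((xor (b (2 * m + 3)) (B b)) && τ b)) := by
    unfold condFlip
    rw [h0, h.top, hF]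
  rw [e1, h.indep, h.inv]
  unfold condFlip
  rw [hτ.update _ (Or.inr rfl), Function.update_self, Function.update_of_ne (by omega),
    Function.update_idem]
  congr 1
  cases b 0 <;> cases b (2 * m + 3) <;> cases τ b <;> cases B b <;> rfl

namespace BoolCircuit

variable {n : ℕ}

/-- The wires in the bits `4, 6, …` carry the values of a computation of the circuit. -/
def consistent : {s : ℕ} → BoolCircuit n s → (ℕ → Bool) → Bool
  | _, .nil, _ => true
  | _, .not (s := s) C i, b => C.consistent b && xor (b (2 * (n + s) + 4)) (b (2 * i + 4))
  | _, .and (s := s) C i j, b =>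
    C.consistent b && !xor (b (2 * (n + s) + 4)) (b (2 * i + 4) && b (2 * j + 4))
  | _, .or (s := s) C i j, b =>
    C.consistent b && !xor (b (2 * (n + s) + 4)) (b (2 * i + 4) || b (2 * j + 4))

variable {s : ℕ}

/-- The single `X` gate at the turning point starts the chain, and each gate of the circuit
contributes one link whose condition is its own consistency. Wires sit at positive even positions,
so the conditions are unaffected by what happens in the chain. -/
theorem toggles_chain (C : BoolCircuit n s) :
    Toggles (n + s) C.consistent (acts (C.desc ++ C.asc)) := by
  induction C with
  | nil => exact toggles_x n
  | not C i ih =>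
    have hi := i.isLt
    rename_i s
    have h := ih.step (κ := fun b => xor (b (2 * (n + s) + 4)) (b (2 * i + 4)))
      (fun b b' hb => by
        dsimp only
        rw [hb _ (by omega) (by omega), hb _ (by omega) (by omega)])
    refine h.congr fun b => ?_
    simp only [desc, asc, acts_append]
    rw [acts_notBlock (by omega) (by omega), acts_notBlock (by omega) (by omega)]
  | and C i j ih =>
    have hi := i.isLt
    have hj := j.isLt
    rename_i s
    have h := ih.step (κ := fun b => !xor (b (2 * (n + s) + 4)) (b (2 * i + 4) && b (2 * j + 4)))
      (fun b b' hb => by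
        dsimp only
        rw [hb _ (by omega) (by omega), hb _ (by omega) (by omega),
          hb _ (by omega) (by omega)])
    refine h.congr fun b => ?_
    simp only [desc, asc, acts_append]
    rw [acts_andBlock, acts_andBlock]
    all_goals omega
  | or C i j ih =>
    have hi := i.isLt
    have hj := j.isLt
    rename_i s
    have h := ih.step (κ := fun b => !xor (b (2 * (n + s) + 4)) (b (2 * i + 4) || b (2 * j + 4)))
      (fun b b' hb => by
        dsimp only
        rw [hb _ (by omega) (by omega), hb _ (by omega) (by omega),
          hb _ (by omega) (by omega)])
    refine h.congr fun b => ?_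
    simp only [desc, asc, acts_append]
    rw [acts_orBlock, acts_orBlock]
    all_goals omega

theorem acts_checkHalf (C : BoolCircuit n s) (b : ℕ → Bool) :
    acts (C.checkHalf ++ C.checkHalf) b = Function.update b 0
      (xor (b 0) (C.consistent b && xor (b (2 * (n + s) + 2)) (b 2))) := by
  have hτ : EvenDep fun b => xor (b (2 * (n + s) + 2)) (b 2) := fun b b' hb => by
    dsimp only
    rw [hb _ (by omega) (by omega), hb _ (by omega) (by omega)]
  rw [← C.toggles_chain.flip hτ]
  -- Two Toffoli gates sharing a control and a target add up to a flip conditioned on the exclusive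
  -- or of their other controls.
  have hT : ∀ b, acts [tof (2 * (n + s) + 3) (2 * (n + s) + 2) 0, tof (2 * (n + s) + 3) 2 0] b =
      condFlip (2 * (n + s) + 3) 0 (fun b => xor (b (2 * (n + s) + 2)) (b 2)) b := by
    intro b
    simp only [acts_cons, acts_nil, RGate.act, condFlip]
    rw [Function.update_idem, Function.update_self, Function.update_of_ne (by omega),
      Function.update_of_ne (by omega)]
    congr 1
    cases b 0 <;> cases b (2 * (n + s) + 3) <;> cases b 2 <;> cases b (2 * (n + s) + 2) <;> rfl
  simp only [checkHalf, acts_append, hT]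

end BoolCircuit

/-- All wires in the bits `4, 6, …, 2 m + 2` are set. -/
def allOnes : ℕ → (ℕ → Bool) → Bool
  | 0, _ => true
  | m + 1, b => allOnes m b && b (2 * m + 4)

theorem toggles_ones (m : ℕ) : Toggles m (allOnes m) (acts (onesDesc m ++ onesAsc m)) := by
  induction m with
  | zero => exact toggles_x 0
  | succ m ih =>
    have h := ih.step (κ := fun b => b (2 * m + 4)) (fun b b' hb => hb _ (by omega) (by omega))
    refine h.congr fun b => ?_
    simp only [onesDesc, onesAsc, acts_append, acts_cons, acts_nil, List.cons_append]
    rfl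

theorem acts_onesHalf (m : ℕ) (b : ℕ → Bool) :
    acts (onesHalf m ++ onesHalf m) b = Function.update b 0 (xor (b 0) (allOnes m b && b 2)) := by
  rw [← (toggles_ones m).flip (τ := fun b => b 2) (fun b b' hb => hb _ (by omega) (by omega))]
  simp only [onesHalf, acts_append, acts_cons, acts_nil]
  rfl

theorem allOnes_eq_true_iff (m : ℕ) (b : ℕ → Bool) :
    allOnes m b = true ↔ ∀ w < m, b (2 * w + 4) = true := by
  induction m with
  | zero => simp [allOnes]
  | succ m ih =>
    simp only [allOnes, Bool.and_eq_true, ih]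
    exact ⟨fun h w hw => (Nat.lt_succ_iff_lt_or_eq.1 hw).elim (h.1 w) fun e => e ▸ h.2,
      fun h => ⟨fun w hw => h w (by omega), h m (by omega)⟩⟩

/-! ## Operators given by functions on bit strings -/

/-- The bits of `y`, continued by `false`. -/
def extBits {N : ℕ} (y : Fin N → Bool) (i : ℕ) : Bool := if h : i < N then y ⟨i, h⟩ else false

/-- Flip the bit `i`. -/
def flipBit (i : ℕ) (b : ℕ → Bool) : ℕ → Bool := Function.update b i (!b i)

/-- The indicator of a Boolean value. -/
def ind (p : Bool) : ℂ := if p then 1 else 0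

/-- The sign `(-1)^p`. -/
def sgn (p : Bool) : ℂ := if p then -1 else 1

section operators
variable {N : ℕ}

theorem extBits_val (y : Fin N → Bool) (i : Fin N) : extBits y i = y i := by
  simp [extBits]

theorem extBits_injective : Function.Injective (extBits (N := N)) := fun y z h => by
  funext i
  rw [← extBits_val y, h, extBits_val]

theorem extBits_update (y : Fin N → Bool) (i : Fin N) (z : Bool) :
    extBits (Function.update y i z) = Function.update (extBits y) i z := by
  funext j
  by_cases hj : j = i
  · subst hj; rw [extBits_val]; simp
  · rw [Function.update_of_ne hj]
    unfold extBits
    split_ifs with h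
    · exact Function.update_of_ne (fun e => hj (by rw [← e])) _ _
    · rfl

/-- The diagonal operator with entries given by a function of the bits. -/
def dg (v : (ℕ → Bool) → ℂ) : QOp N := Matrix.diagonal fun y => v (extBits y)

open Classical in
/-- The operator permuting the basis by `F`. -/
noncomputable def pm (F : (ℕ → Bool) → ℕ → Bool) : QOp N :=
  Matrix.of fun z y => if extBits z = F (extBits y) then 1 else 0

theorem pm_apply {F : (ℕ → Bool) → ℕ → Bool} {z y : Fin N → Bool} {P : Prop} [Decidable P]
    (h : extBits z = F (extBits y) ↔ P) : (pm F : QOp N) z y = if P then 1 else 0 := by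
  by_cases hP : P
  · simp [pm, hP, h.2 hP]
  · simp [pm, hP, mt h.1 hP]

theorem pm_congr {F G : (ℕ → Bool) → ℕ → Bool} {z y y' : Fin N → Bool}
    (h : F (extBits y) = G (extBits y')) : (pm F : QOp N) z y = (pm G : QOp N) z y' := by
  classical
  rw [pm_apply (P := extBits z = F (extBits y)) Iff.rfl,
    pm_apply (F := G) (P := extBits z = F (extBits y)) (by rw [h])]

/-- `F` maps strings of `N` bits to strings of `N` bits. -/
def Local (N : ℕ) (F : (ℕ → Bool) → ℕ → Bool) : Prop :=
  ∀ y : Fin N → Bool, ∃ y' : Fin N → Bool, extBits y' = F (extBits y)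

theorem dg_mul (u v : (ℕ → Bool) → ℂ) : (dg u * dg v : QOp N) = dg fun b => u b * v b :=
  Matrix.diagonal_mul_diagonal _ _

theorem dg_add (u v : (ℕ → Bool) → ℂ) : (dg u + dg v : QOp N) = dg fun b => u b + v b :=
  Matrix.diagonal_add _ _

theorem dg_sub (u v : (ℕ → Bool) → ℂ) : (dg u - dg v : QOp N) = dg fun b => u b - v b :=
  Matrix.diagonal_sub _ _

theorem dg_smul (c : ℂ) (u : (ℕ → Bool) → ℂ) : (c • dg u : QOp N) = dg fun b => c * u b :=
  (Matrix.diagonal_smul _ _).symm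

theorem dg_one : (dg fun _ => 1 : QOp N) = 1 := Matrix.diagonal_one

theorem dg_commute (u v : (ℕ → Bool) → ℂ) : Commute (dg u : QOp N) (dg v) := by
  rw [Commute, SemiconjBy, dg_mul, dg_mul]
  congr 1; funext b; ring

/-- Locality of `G` guarantees that the intermediate string is among the `N`-bit strings over which
the matrix product sums. -/
theorem pm_mul (F : (ℕ → Bool) → ℕ → Bool) {G : (ℕ → Bool) → ℕ → Bool} (hG : Local N G) :
    (pm F * pm G : QOp N) = pm fun b => F (G b) := by
  ext z y
  obtain ⟨y', hy'⟩ := hG y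
  rw [Matrix.mul_apply, Finset.sum_eq_single y']
  · rw [pm_apply (F := G) (P := True) (by simp [hy']), if_pos trivial, mul_one]
    exact pm_congr (by rw [hy'])
  · intro w _ hw
    have : ¬ extBits w = G (extBits y) := fun e => hw (extBits_injective (e.trans hy'.symm))
    simp [pm, this]
  · simp

theorem dg_mul_pm (F : (ℕ → Bool) → ℕ → Bool) (v : (ℕ → Bool) → ℂ) :
    (dg v * pm F : QOp N) = pm F * dg fun b => v (F b) := by
  ext z y
  rw [dg, dg, Matrix.diagonal_mul, Matrix.mul_diagonal]
  simp only [pm, Matrix.of_apply]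
  split_ifs with h
  · rw [h]; ring
  · simp

theorem pm_id : (pm (fun b => b) : QOp N) = 1 := by
  ext z y
  simp [pm, Matrix.one_apply, extBits_injective.eq_iff]

theorem local_flipBit {i : ℕ} (hi : i < N) : Local N (flipBit i) := fun y =>
  ⟨Function.update y ⟨i, hi⟩ (!y ⟨i, hi⟩), by
    rw [extBits_update, flipBit, ← extBits_val y ⟨i, hi⟩]⟩

theorem flipBit_flipBit (i : ℕ) (b : ℕ → Bool) : flipBit i (flipBit i b) = b := by
  simp [flipBit]

theorem flipBit_comm (i j : ℕ) (b : ℕ → Bool) :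
    flipBit i (flipBit j b) = flipBit j (flipBit i b) := by
  by_cases h : i = j
  · rw [h]
  · unfold flipBit
    rw [Function.update_of_ne h, Function.update_of_ne (Ne.symm h), Function.update_comm h]

theorem flipBit_self (i : ℕ) (b : ℕ → Bool) : flipBit i b i = !b i := by simp [flipBit]

theorem flipBit_of_ne {i j : ℕ} (h : j ≠ i) (b : ℕ → Bool) : flipBit i b j = b j := by
  simp [flipBit, h]

theorem pm_flipBit_sq {i : ℕ} (hi : i < N) : (pm (flipBit i) * pm (flipBit i) : QOp N) = 1 := by
  rw [pm_mul _ (local_flipBit hi), ← pm_id]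
  congr 1; funext b; exact flipBit_flipBit i b

theorem pm_flipBit_commute {i j : ℕ} (hi : i < N) (hj : j < N) :
    Commute (pm (flipBit i) : QOp N) (pm (flipBit j)) := by
  rw [Commute, SemiconjBy, pm_mul _ (local_flipBit hi), pm_mul _ (local_flipBit hj)]
  congr 1; funext b; exact flipBit_comm i j b

/-- The unitary of a list of gates with qubits numbered by `ℕ`. -/
noncomputable def unitaryOf (N : ℕ) (gs : List (RGate ℕ)) : QOp N :=
  circuitUnitary (gs.flatMap (RGate.toCircuit N))

theorem circuitUnitary_append (gs gs' : List (QGate N)) :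
    circuitUnitary (gs ++ gs') = circuitUnitary gs' * circuitUnitary gs := by
  have key : ∀ (gs : List (QGate N)) (U : QOp N),
      gs.foldl (fun U g => g.matrix * U) U = circuitUnitary gs * U := by
    intro gs
    induction gs with
    | nil => intro U; simp [circuitUnitary]
    | cons g gs ih =>
      intro U
      rw [circuitUnitary, List.foldl_cons, List.foldl_cons, ih, ih]
      simp [mul_assoc]
  rw [circuitUnitary, List.foldl_append, key]
  rfl

theorem unitaryOf_append (gs gs' : List (RGate ℕ)) :
    unitaryOf N (gs ++ gs') = unitaryOf N gs' * unitaryOf N gs := by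
  rw [unitaryOf, List.flatMap_append, circuitUnitary_append]
  rfl

theorem unitaryOf_singleton (g : RGate ℕ) :
    unitaryOf N [g] = circuitUnitary (g.toCircuit N) := by
  simp [unitaryOf]

theorem act_local {g : RGate ℕ} (hv : g.Valid N) : Local N g.act := by
  cases g with
  | x i => exact local_flipBit hv
  | h i => exact fun y => ⟨y, rfl⟩
  | tof i j k =>
    obtain ⟨hi, hj, hk, -⟩ := hv
    refine fun y => ⟨Function.update y ⟨k, hk⟩ (xor (y ⟨k, hk⟩) (y ⟨i, hi⟩ && y ⟨j, hj⟩)), ?_⟩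
    rw [extBits_update, RGate.act, ← extBits_val y ⟨i, hi⟩, ← extBits_val y ⟨j, hj⟩,
      ← extBits_val y ⟨k, hk⟩]

theorem unitaryOf_eq_pm_act {g : RGate ℕ} (hv : g.Valid N) (hg : ∀ i, g ≠ .h i) :
    unitaryOf N [g] = pm g.act := by
  rw [unitaryOf_singleton]
  cases g with
  | x i =>
    have hi : i < N := hv
    simp only [RGate.toCircuit, dif_pos hi, circuitUnitary, List.foldl_cons, List.foldl_nil,
      mul_one]
    ext z y
    refine (pm_apply ?_).symm
    rw [← extBits_injective.eq_iff, extBits_update, RGate.act, ← extBits_val y ⟨i, hi⟩]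
  | h i => exact absurd rfl (hg i)
  | tof i j k =>
    rw [RGate.toCircuit, dif_pos (show i < N ∧ j < N ∧ k < N ∧ i ≠ j ∧ i ≠ k ∧ j ≠ k from hv)]
    simp only [circuitUnitary, List.foldl_cons, List.foldl_nil, mul_one]
    obtain ⟨hi, hj, hk, -⟩ := hv
    ext z y
    refine (pm_apply ?_).symm
    rw [← extBits_injective.eq_iff, extBits_update, RGate.act, ← extBits_val y ⟨i, hi⟩,
      ← extBits_val y ⟨j, hj⟩, ← extBits_val y ⟨k, hk⟩]

theorem unitaryOf_eq_pm {gs : List (RGate ℕ)} (hv : ∀ g ∈ gs, g.Valid N)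
    (hg : ∀ i, .h i ∉ gs) : unitaryOf N gs = pm (acts gs) := by
  induction gs with
  | nil => exact pm_id.symm
  | cons g gs ih =>
    rw [← List.singleton_append, unitaryOf_append,
      ih (fun g hg => hv g (by simp [hg])) (fun i hi => hg i (by simp [hi])),
      unitaryOf_eq_pm_act (hv g (by simp)) (fun i hi => hg i (by simp [hi])),
      pm_mul _ (act_local (hv g (by simp)))]
    rfl

/-- A controlled flip of the bit `i`. -/
theorem pm_ctrl_flip (i : ℕ) (β : (ℕ → Bool) → Bool) :
    (pm (fun b => Function.update b i (xor (b i) (β b))) : QOp N) =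
      1 - dg (fun b => ind (β b)) + pm (flipBit i) * dg (fun b => ind (β b)) := by
  ext z y
  rw [Matrix.add_apply, Matrix.sub_apply, dg, Matrix.mul_diagonal, Matrix.diagonal_apply,
    Matrix.one_apply]
  cases h : β (extBits y)
  · rw [pm_apply (P := z = y) (by rw [h, Bool.xor_false, Function.update_eq_self,
      extBits_injective.eq_iff])]
    split_ifs with e
    · subst e; simp [ind, h]
    · simp [ind]
  · have e2 : (pm (fun b => Function.update b i (xor (b i) (β b))) : QOp N) z y =
        pm (flipBit i) z y :=
      pm_congr (by rw [h, Bool.xor_true, flipBit])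
    rw [e2]
    split_ifs with e
    · subst e; simp [ind, h]
    · simp [ind]

/-! ### Hadamard gates -/

/-- The Hadamard gate on the qubit `i`. -/
noncomputable def had (N i : ℕ) : QOp N :=
  ((Real.sqrt 2 : ℝ) : ℂ)⁻¹ • (pm (flipBit i) + dg fun b => sgn (b i))

/-- Writing the gate as `(X + Z) / √2` reduces all its relations to `X² = Z² = 1` and `Z X = - X Z`.
-/
theorem unitaryOf_h {i : ℕ} (hi : i < N) : unitaryOf N [.h i] = had N i := by
  rw [unitaryOf_singleton]
  simp only [RGate.toCircuit, dif_pos hi, circuitUnitary, List.foldl_cons, List.foldl_nil,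
    mul_one]
  ext z y
  rw [had, Matrix.smul_apply, Matrix.add_apply]
  simp only [QGate.matrix, dg, Matrix.of_apply, Matrix.diagonal_apply]
  have e1 : extBits z = flipBit i (extBits y) ↔ z = Function.update y ⟨i, hi⟩ (!y ⟨i, hi⟩) := by
    rw [← extBits_injective.eq_iff, extBits_update, flipBit, ← extBits_val y ⟨i, hi⟩]
  have e2 : extBits y i = y ⟨i, hi⟩ := extBits_val y ⟨i, hi⟩
  have e3 : extBits z i = z ⟨i, hi⟩ := extBits_val z ⟨i, hi⟩
  rw [pm_apply e1]
  by_cases h : ∀ j, j ≠ (⟨i, hi⟩ : Fin N) → z j = y j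
  · rw [if_pos h]
    have hz : z = Function.update y ⟨i, hi⟩ (z ⟨i, hi⟩) :=
      funext fun j => by
        by_cases hj : j = ⟨i, hi⟩
        · subst hj; simp
        · rw [Function.update_of_ne hj, h j hj]
    have h1 : z = y ↔ z ⟨i, hi⟩ = y ⟨i, hi⟩ :=
      ⟨fun e => by rw [e], fun e => by rw [hz, e]; simp⟩
    have h2 : z = Function.update y ⟨i, hi⟩ (!y ⟨i, hi⟩) ↔ z ⟨i, hi⟩ = !y ⟨i, hi⟩ :=
      ⟨fun e => by rw [e]; simp, fun e => by rw [hz, e]⟩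
    rw [if_congr h1 rfl rfl, if_congr h2 rfl rfl]
    rw [e3]
    cases z ⟨i, hi⟩ <;> cases y ⟨i, hi⟩ <;> simp [sgn]
  · rw [if_neg h, if_neg (fun e => h fun j hj => by rw [e, Function.update_of_ne hj]),
      if_neg (fun e => h fun j _ => by rw [e])]
    simp

theorem inv_sqrt_two_sq : ((Real.sqrt 2 : ℝ) : ℂ)⁻¹ * ((Real.sqrt 2 : ℝ) : ℂ)⁻¹ = 1 / 2 := by
  rw [← mul_inv, ← Complex.ofReal_mul, Real.mul_self_sqrt (by norm_num)]
  norm_num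

theorem sgn_mul_self (p : Bool) : sgn p * sgn p = 1 := by cases p <;> simp [sgn]

theorem sgn_not (p : Bool) : sgn (!p) = - sgn p := by cases p <;> simp [sgn]

theorem ind_mul_self (p : Bool) : ind p * ind p = ind p := by cases p <;> simp [ind]

theorem ind_and (p q : Bool) : ind (p && q) = ind p * ind q := by
  cases p <;> cases q <;> simp [ind]

theorem dg_sgn_sq (i : ℕ) : (dg (fun b => sgn (b i)) * dg (fun b => sgn (b i)) : QOp N) = 1 := by
  rw [dg_mul, ← dg_one]; congr 1; funext b; exact sgn_mul_self _

theorem dg_sgn_mul_flip (i : ℕ) : (dg (fun b => sgn (b i)) * pm (flipBit i) : QOp N) =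
    - (pm (flipBit i) * dg (fun b => sgn (b i))) := by
  rw [dg_mul_pm, ← mul_neg, ← neg_one_smul ℂ (dg _), dg_smul]
  congr 2; funext b; rw [flipBit_self, sgn_not]; ring

theorem had_sq {i : ℕ} (hi : i < N) : had N i * had N i = 1 := by
  rw [had, smul_mul_smul_comm, inv_sqrt_two_sq, add_mul, mul_add, mul_add, pm_flipBit_sq hi,
    dg_sgn_sq, dg_sgn_mul_flip, show ∀ a b : QOp N, a + b + (-b + a) = (2 : ℂ) • a from
      fun a b => by rw [two_smul]; abel, smul_smul]
  norm_num

theorem commute_pm_dg {i : ℕ} {v : (ℕ → Bool) → ℂ} (hv : ∀ b, v (flipBit i b) = v b) :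
    Commute (pm (flipBit i) : QOp N) (dg v) := by
  rw [Commute, SemiconjBy, dg_mul_pm]
  congr 2; funext b; rw [hv]

theorem commute_had_dg {i : ℕ} {v : (ℕ → Bool) → ℂ} (hv : ∀ b, v (flipBit i b) = v b) :
    Commute (had N i) (dg v) :=
  Commute.smul_left ((commute_pm_dg hv).add_left (dg_commute _ _)) _

theorem commute_had_pm {i j : ℕ} (hi : i < N) (hj : j < N) (hij : i ≠ j) :
    Commute (had N i) (pm (flipBit j)) :=
  Commute.smul_left ((pm_flipBit_commute hi hj).add_left
    (commute_pm_dg fun b => by rw [flipBit_of_ne hij]).symm) _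

theorem commute_had_had {i j : ℕ} (hi : i < N) (hj : j < N) (hij : i ≠ j) :
    Commute (had N i) (had N j) :=
  Commute.smul_right ((commute_had_pm hi hj hij).add_right
    (commute_had_dg fun b => by rw [flipBit_of_ne hij.symm])) _

theorem had_mul_flip_mul_had {i : ℕ} (hi : i < N) :
    had N i * pm (flipBit i) * had N i = dg fun b => sgn (b i) := by
  have h1 := pm_flipBit_sq (N := N) hi
  have h2 := dg_sgn_sq (N := N) i
  have h3 := dg_sgn_mul_flip (N := N) i
  set x : QOp N := pm (flipBit i)
  set z : QOp N := dg fun b => sgn (b i) with hz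
  have : (x + z) * x * (x + z) = (2 : ℂ) • z := by
    rw [add_mul, h1, h3, add_mul, one_mul, neg_mul, mul_assoc, mul_add z, h2, h3, mul_add,
      mul_neg, ← mul_assoc, h1, two_smul]
    noncomm_ring
  rw [had, smul_mul_assoc, smul_mul_smul_comm, inv_sqrt_two_sq, this, smul_smul]
  norm_num

/-- The mean of `v` over both values of the bit `i`. -/
noncomputable def bitMean (i : ℕ) (v : (ℕ → Bool) → ℂ) (b : ℕ → Bool) : ℂ :=
  (v b + v (flipBit i b)) / 2

/-- This is `⟨1| H v H |1⟩` on the qubit `i`. After expanding both factors `X + Z`, the terms with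
exactly one `X` vanish between projectors onto bit value `1`; the other two contribute `v` at the
flipped and at the original string. -/
theorem dg_had_dg_had_dg {i : ℕ} (hi : i < N) (v : (ℕ → Bool) → ℂ) :
    dg (fun b => ind (b i)) * had N i * dg v * had N i * dg (fun b => ind (b i)) =
      dg (bitMean i v) * dg (fun b => ind (b i)) := by
  have h1 := pm_flipBit_sq (N := N) hi
  have t1 : dg (fun b => ind (b i)) * pm (flipBit i) * dg v * pm (flipBit i) *
      dg (fun b => ind (b i)) = (dg fun b => v (flipBit i b) * ind (b i) : QOp N) := by
    rw [mul_assoc _ (dg v), dg_mul_pm _ v, mul_assoc (dg _), ← mul_assoc (pm _) (pm _), h1,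
      one_mul, dg_mul, dg_mul]
    congr 1; funext b; rw [mul_right_comm, ind_mul_self, mul_comm]
  have t2 : dg (fun b => ind (b i)) * pm (flipBit i) * dg v * dg (fun b => sgn (b i)) *
      dg (fun b => ind (b i)) = (0 : QOp N) := by
    rw [dg_mul_pm, mul_assoc, mul_assoc, mul_assoc, dg_mul, dg_mul, dg_mul]
    convert mul_zero (pm (flipBit i) : QOp N)
    ext z y
    simp only [dg, Matrix.diagonal_apply, flipBit_self, Matrix.zero_apply]
    cases extBits z i <;> simp [ind]
  have t3 : dg (fun b => ind (b i)) * dg (fun b => sgn (b i)) * dg v * pm (flipBit i) *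
      dg (fun b => ind (b i)) = (0 : QOp N) := by
    rw [dg_mul, dg_mul, dg_mul_pm, mul_assoc, dg_mul]
    convert mul_zero (pm (flipBit i) : QOp N)
    ext z y
    simp only [dg, Matrix.diagonal_apply, flipBit_self, Matrix.zero_apply]
    cases extBits z i <;> simp [ind]
  have t4 : dg (fun b => ind (b i)) * dg (fun b => sgn (b i)) * dg v * dg (fun b => sgn (b i)) *
      dg (fun b => ind (b i)) = (dg fun b => v b * ind (b i) : QOp N) := by
    simp only [dg_mul]
    congr 1; funext b
    cases b i <;> simp [ind, sgn]
  simp only [had, mul_smul_comm, smul_mul_assoc, smul_smul, inv_sqrt_two_sq]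
  simp only [mul_add, add_mul, t1, t2, t3, t4, add_zero, zero_add]
  simp only [dg_mul, dg_add, dg_smul, bitMean]
  congr 1; funext b; ring

end operators

/-! ## Means over the inputs and the wires -/

/-- The mean of `v` over the values of the first `m` wires. -/
noncomputable def wireMean : ℕ → ((ℕ → Bool) → ℂ) → (ℕ → Bool) → ℂ
  | 0, v => v
  | m + 1, v => wireMean m (bitMean (2 * m + 4) v)

theorem wireMean_sub (m : ℕ) (u v : (ℕ → Bool) → ℂ) (b : ℕ → Bool) :
    wireMean m (fun b => u b - v b) b = wireMean m u b - wireMean m v b := by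
  induction m generalizing u v with
  | zero => rfl
  | succ m ih =>
    simp only [wireMean]
    rw [← ih]
    congr 1
    funext b
    simp only [bitMean]
    ring

theorem wireMean_of_aux (m : ℕ) (g : Bool → ℂ) (b : ℕ → Bool) :
    wireMean m (fun b => g (b 2)) b = g (b 2) := by
  induction m with
  | zero => rfl
  | succ m ih =>
    rw [wireMean, ← ih]
    congr 1
    funext b
    rw [bitMean, flipBit_of_ne (by omega)]
    ring

theorem sum_bool_snoc {M : Type*} [AddCommMonoid M] {n : ℕ} (g : (Fin (n + 1) → Bool) → M) :
    ∑ x, g x = ∑ x : Fin n → Bool,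
      (g (Fin.snoc (α := fun _ => Bool) x true) + g (Fin.snoc (α := fun _ => Bool) x false)) := by
  rw [← (Fin.snocEquiv fun _ => Bool).sum_comp, Fintype.sum_prod_type_right]
  simp [Fin.snocEquiv]

theorem wires_eq_snoc (m : ℕ) (b : ℕ → Bool) :
    (fun w : Fin (m + 1) => b (2 * w + 4)) =
      Fin.snoc (α := fun _ => Bool) (fun w : Fin m => b (2 * w + 4)) (b (2 * m + 4)) := by
  funext w
  refine Fin.lastCases ?_ (fun w => ?_) w
  · simp
  · simp

theorem wires_flipBit (m : ℕ) (b : ℕ → Bool) :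
    (fun w : Fin m => flipBit (2 * m + 4) b (2 * w + 4)) = fun w : Fin m => b (2 * w + 4) :=
  funext fun w => flipBit_of_ne (by have := w.isLt; omega) _

/-- The mean over the top wire, as a function of the lower wires and the auxiliary input. -/
theorem bitMean_top (m : ℕ) (g : (Fin (m + 1) → Bool) → Bool → ℂ) (b : ℕ → Bool) :
    bitMean (2 * m + 4) (fun b => g (fun w => b (2 * w + 4)) (b 2)) b =
      (g (Fin.snoc (α := fun _ => Bool) (fun w : Fin m => b (2 * w + 4)) true) (b 2) +
        g (Fin.snoc (α := fun _ => Bool) (fun w : Fin m => b (2 * w + 4)) false) (b 2)) / 2 := by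
  simp only [bitMean]
  rw [wires_eq_snoc, wires_eq_snoc, wires_flipBit, flipBit_self, flipBit_of_ne (by omega)]
  cases b (2 * m + 4) <;> simp [add_comm]

theorem wireMean_eq_sum (m : ℕ) (g : (Fin m → Bool) → Bool → ℂ) (b : ℕ → Bool) :
    wireMean m (fun b => g (fun w => b (2 * w + 4)) (b 2)) b = (1 / 2) ^ m * ∑ x, g x (b 2) := by
  induction m with
  | zero =>
    rw [wireMean, Fintype.sum_unique]
    simp only [pow_zero, one_mul]
    congr 1
    exact Subsingleton.elim _ _
  | succ m ih =>
    rw [wireMean, funext (bitMean_top m g), ih fun x z =>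
      (g (Fin.snoc (α := fun _ => Bool) x true) z + g (Fin.snoc (α := fun _ => Bool) x false) z)
        / 2, sum_bool_snoc, ← Finset.sum_div, pow_succ]
    ring

/-! ### The mean phase is the normalised gap. -/

namespace BoolCircuit

variable {n s : ℕ}

/-- Whether values of all wires are consistent with the gates. -/
def wiresOk : {s : ℕ} → BoolCircuit n s → (Fin (n + s) → Bool) → Bool
  | _, .nil, _ => true
  | _, .not (s := s) C i, t =>
    C.wiresOk (Fin.init (α := fun _ => Bool) t) && xor (t (Fin.last (n + s))) (t i.castSucc)
  | _, .and (s := s) C i j, t =>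
    C.wiresOk (Fin.init (α := fun _ => Bool) t) &&
      !xor (t (Fin.last (n + s))) (t i.castSucc && t j.castSucc)
  | _, .or (s := s) C i j, t =>
    C.wiresOk (Fin.init (α := fun _ => Bool) t) &&
      !xor (t (Fin.last (n + s))) (t i.castSucc || t j.castSucc)

theorem consistent_eq (C : BoolCircuit n s) (b : ℕ → Bool) :
    C.consistent b = C.wiresOk fun w => b (2 * w + 4) := by
  induction C with
  | nil => rfl
  | not C i ih => simp only [consistent, ih, wiresOk]; rfl
  | and C i j ih => simp only [consistent, ih, wiresOk]; rfl
  | or C i j ih => simp only [consistent, ih, wiresOk]; rfl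

/-- The earlier wires determine the value of a gate, so exactly one of the two values of the top
wire survives. Inductively, consistent assignments correspond to inputs. -/
theorem sum_wiresOk (C : BoolCircuit n s) (g : (Fin (n + s) → Bool) → ℂ) :
    ∑ t, ind (C.wiresOk t) * g t = ∑ x, g (C.wires x) := by
  have key : ∀ {m : ℕ} (B : (Fin m → Bool) → Bool) (f : (Fin m → Bool) → Bool)
      (κ : (Fin (m + 1) → Bool) → Bool) (g : (Fin (m + 1) → Bool) → ℂ),
      (∀ t z, κ (Fin.snoc (α := fun _ => Bool) t z) = !xor z (f t)) →
      ∑ t, ind (B (Fin.init (α := fun _ => Bool) t) && κ t) * g t =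
        ∑ t, ind (B t) * g (Fin.snoc (α := fun _ => Bool) t (f t)) := by
    intro m B f κ g hκ
    rw [sum_bool_snoc]
    refine Finset.sum_congr rfl fun t _ => ?_
    rw [hκ, hκ, Fin.init_snoc, Fin.init_snoc]
    cases f t <;> cases B t <;> simp [ind]
  induction C with
  | nil => simp [wiresOk, wires, ind]
  | not C i ih =>
    refine (key C.wiresOk (fun t => !t i) (fun t => xor (t (Fin.last _)) (t i.castSucc)) g
      fun t z => ?_).trans (ih fun t => g (Fin.snoc (α := fun _ => Bool) t (!t i)))
    simp
  | and C i j ih =>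
    refine (key C.wiresOk (fun t => t i && t j)
      (fun t => !xor (t (Fin.last _)) (t i.castSucc && t j.castSucc)) g
      fun t z => ?_).trans (ih fun t => g (Fin.snoc (α := fun _ => Bool) t (t i && t j)))
    simp
  | or C i j ih =>
    refine (key C.wiresOk (fun t => t i || t j)
      (fun t => !xor (t (Fin.last _)) (t i.castSucc || t j.castSucc)) g
      fun t z => ?_).trans (ih fun t => g (Fin.snoc (α := fun _ => Bool) t (t i || t j)))
    simp

/-- The phase by which the checks and the phase flip of the auxiliary input multiply a basis
state, when the clean qubit is in the state `|-⟩`. -/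
def phase (C : BoolCircuit n s) (b : ℕ → Bool) : ℂ :=
  sgn (b 2) * (1 - 2 * ind (C.consistent b && xor (b (2 * (n + s) + 2)) (b 2)))

/-- The auxiliary bit exists for this cancellation. Its sign averages to zero, which removes
everything except the assignments marked by the check, and the sign that is left there depends only
on the output. -/
theorem mean_phase (C : BoolCircuit n (s + 1)) (b : ℕ → Bool) :
    bitMean 2 (wireMean (n + (s + 1)) C.phase) b = (1 / 2) ^ (n + (s + 1)) * (C.gap : ℂ) := by
  have h1 : ∀ b, wireMean (n + (s + 1)) C.phase b = sgn (b 2) -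
      (1 / 2) ^ (n + (s + 1)) * ∑ x, 2 * sgn (b 2) * ind (xor (C.eval x) (b 2)) := by
    intro b
    have e : C.phase = fun b => sgn (b 2) - ind (C.wiresOk fun w => b (2 * w + 4)) *
        (2 * sgn (b 2) * ind (xor (b (2 * (n + s) + 4)) (b 2))) := by
      funext b
      rw [phase, consistent_eq, ind_and, show 2 * (n + (s + 1)) + 2 = 2 * (n + s) + 4 by ring]
      ring
    rw [e, wireMean_sub, wireMean_of_aux _ sgn]
    congr 1
    refine (wireMean_eq_sum (n + (s + 1)) (fun t z =>
      ind (C.wiresOk t) * (2 * sgn z * ind (xor (t (Fin.last (n + s))) z))) b).trans ?_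
    rw [sum_wiresOk C fun t => 2 * sgn (b 2) * ind (xor (t (Fin.last (n + s))) (b 2))]
    rfl
  have h2 : (C.gap : ℂ) = ∑ x, sgn (C.eval x) := by
    rw [gap, Int.cast_sum]
    refine Finset.sum_congr rfl fun x _ => ?_
    cases C.eval x <;> simp [sgn]
  rw [bitMean, h1, h1, flipBit_self, sgn_not, h2]
  -- For each input only the auxiliary value different from the output contributes, with sign
  -- opposite to `(-1)^{f(x)}`. The sum of both terms is thus `-2 (-1)^{f(x)}`.
  have h3 : ∑ x, sgn (C.eval x) = - (1 / 2) * (∑ x, 2 * sgn (b 2) * ind (xor (C.eval x) (b 2)) +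
      ∑ x, 2 * (-sgn (b 2)) * ind (xor (C.eval x) (!b 2))) := by
    rw [← Finset.sum_add_distrib, Finset.mul_sum]
    refine Finset.sum_congr rfl fun x _ => ?_
    cases C.eval x <;> cases b 2 <;> simp [sgn, ind]
  rw [h3]
  ring

theorem abs_gap_le (C : BoolCircuit n (s + 1)) : |C.gap| ≤ 2 ^ n := by
  refine (Finset.abs_sum_le_sum_abs _ _).trans (le_of_eq ?_)
  simp

end BoolCircuit

/-! ## Layers of Hadamard gates -/

section hadamards
variable {N : ℕ}

theorem unitaryOf_hadamards_zero (hN : 4 ≤ N) : unitaryOf N (hadamards 0) = had N 2 :=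
  unitaryOf_h (by omega)

theorem unitaryOf_hadamards_succ {m : ℕ} (hN : 2 * (m + 1) + 4 ≤ N) :
    unitaryOf N (hadamards (m + 1)) = unitaryOf N (hadamards m) * had N (2 * m + 4) := by
  rw [hadamards, ← List.singleton_append, unitaryOf_append, unitaryOf_h (by omega)]

theorem commute_hadamards {m : ℕ} (hN : 2 * m + 4 ≤ N) {A : QOp N}
    (h : ∀ j, 2 ≤ j → j ≤ 2 * m + 2 → Commute (had N j) A) :
    Commute (unitaryOf N (hadamards m)) A := by
  induction m with
  | zero => rw [unitaryOf_hadamards_zero hN]; exact h 2 le_rfl le_rfl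
  | succ m ih =>
    rw [unitaryOf_hadamards_succ hN]
    exact (ih (by omega) fun j h1 h2 => h j h1 (by omega)).mul_left
      (h _ (by omega) (by omega))

theorem commute_hadamards_had {m : ℕ} (hN : 2 * (m + 1) + 4 ≤ N) :
    Commute (unitaryOf N (hadamards m)) (had N (2 * m + 4)) :=
  commute_hadamards (by omega) fun j _ hj =>
    commute_had_had (by omega) (by omega) (by omega)

theorem hadamards_sq {m : ℕ} (hN : 2 * m + 4 ≤ N) :
    unitaryOf N (hadamards m) * unitaryOf N (hadamards m) = 1 := by
  induction m with
  | zero => rw [unitaryOf_hadamards_zero hN, had_sq (by omega)]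
  | succ m ih =>
    rw [unitaryOf_hadamards_succ hN]
    nth_rewrite 2 [(commute_hadamards_had hN).eq]
    rw [mul_assoc, ← mul_assoc (had _ _), had_sq (by omega), one_mul, ih (by omega)]

/-- The projector onto the strings with all of the first `m` wires and the auxiliary input set. -/
def onesProj (N m : ℕ) : QOp N := dg fun b => ind (allOnes m b && b 2)

theorem onesProj_succ (m : ℕ) :
    onesProj N (m + 1) = onesProj N m * dg fun b => ind (b (2 * m + 4)) := by
  rw [onesProj, onesProj, dg_mul]
  congr 1
  funext b
  rw [← ind_and, allOnes]
  congr 1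
  cases b 2 <;> simp

/-- The Hadamard gates on the other qubits commute with the projector for the top wire, so this
projector can be moved next to the Hadamard gates of the top wire. The one-qubit case replaces `v`
by its mean over that wire, and the lower wires follow by induction. -/
theorem onesProj_sandwich {m : ℕ} (hN : 2 * m + 4 ≤ N) (v : (ℕ → Bool) → ℂ) :
    onesProj N m * unitaryOf N (hadamards m) * dg v * unitaryOf N (hadamards m) * onesProj N m =
      dg (bitMean 2 (wireMean m v)) * onesProj N m := by
  induction m generalizing v with
  | zero =>
    rw [unitaryOf_hadamards_zero hN]
    simp only [onesProj, allOnes, Bool.true_and, wireMean]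
    exact dg_had_dg_had_dg (by omega) v
  | succ m ih =>
    have e1 : Commute (unitaryOf N (hadamards m)) (dg fun b => ind (b (2 * m + 4))) :=
      commute_hadamards (by omega) fun j _ hj => commute_had_dg fun b => by
        rw [flipBit_of_ne (by omega)]
    have e2 : Commute (dg fun b => ind (b (2 * m + 4))) (onesProj N m) := dg_commute _ _
    have e3 := commute_hadamards_had hN
    have e4 := dg_had_dg_had_dg (N := N) (i := 2 * m + 4) (by omega) v
    have e5 := ih (by omega) (bitMean (2 * m + 4) v)
    rw [onesProj_succ, unitaryOf_hadamards_succ hN, wireMean]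
    set H := unitaryOf N (hadamards m)
    set h := had N (2 * m + 4)
    set d : QOp N := dg fun b => ind (b (2 * m + 4))
    set D := onesProj N m
    calc D * d * (H * h) * dg v * (H * h) * (D * d)
        = D * (d * H) * h * dg v * (H * h) * (D * d) := by noncomm_ring
      _ = D * H * d * h * dg v * h * H * (d * D) := by rw [← e1.eq, e3.eq, e2.eq]; noncomm_ring
      _ = D * H * d * h * dg v * h * (H * d) * D := by noncomm_ring
      _ = D * H * (d * h * dg v * h * d) * H * D := by rw [e1.eq]; noncomm_ring
      _ = D * H * dg (bitMean (2 * m + 4) v) * (d * H) * D := by rw [e4]; noncomm_ring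
      _ = D * H * dg (bitMean (2 * m + 4) v) * H * (d * D) := by rw [← e1.eq]; noncomm_ring
      _ = D * H * dg (bitMean (2 * m + 4) v) * H * D * d := by rw [e2.eq]; noncomm_ring
      _ = _ := by rw [e5, mul_assoc]

end hadamards

/-! ## Interleaved reflections -/

section algebra
variable {R : Type*} [Ring R]

/-- Applied with `e = 1 + x` and `e = 1 - x`, multiples of the projectors onto the eigenspaces of
`x`: under such a factor every operator may be replaced by its restriction to the eigenspace. -/
theorem mul_mul_absorb {e A A' B B' : R} (hA : e * A = e * A') (hB : e * B = e * B')
    (h : Commute e A') : e * (A * B) = e * (A' * B') := by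
  rw [← mul_assoc, hA, h.eq, mul_assoc, hB, ← mul_assoc, ← h.eq, mul_assoc]

theorem mul_pow_absorb {e A A' : R} (hA : e * A = e * A') (h : Commute e A') (k : ℕ) :
    e * A ^ k = e * A' ^ k := by
  induction k with
  | zero => simp
  | succ k ih => rw [pow_succ', pow_succ', mul_mul_absorb hA ih h]

/-- The square of a product of controlled reflections, compressed by the projector `n` onto
the clean state of the controlling qubit, vanishes only if the reflections compose to `1`. -/
theorem compress_eq_zero_iff (h2 : ∀ a : R, a + a = 0 → a = 0) {n x P E Z : R} (hx : x * x = 1)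
    (hn : n * n = n) (hnx : n * x * n = 0) (hxn : x * n * x = 1 - n) (xP : Commute x P)
    (xE : Commute x E) (xZ : Commute x Z) (nP : Commute n P) (nE : Commute n E)
    (nZ : Commute n Z) (hZ : Z * Z = 1) :
    n * (x * ((1 - P + x * P) * Z * (1 - E + x * E)) ^ 4) * n = 0 ↔
      ((1 - 2 * P) * (Z * (1 - 2 * E))) ^ 4 = 1 := by
  set Rd := (1 - P + x * P) * Z * (1 - E + x * E) with hRd
  set W := ((1 - 2 * P) * (Z * (1 - 2 * E))) ^ 4 with hW
  have c2 : ∀ {a b : R}, Commute a b → Commute a (1 - 2 * b) := fun h =>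
    (Commute.one_right _).sub_right ((Commute.ofNat_right _ 2).mul_right h)
  have cV : ∀ {a : R}, Commute a P → Commute a E → Commute a Z →
      Commute a ((1 - 2 * P) * (Z * (1 - 2 * E))) := fun hP hE hZ =>
    (c2 hP).mul_right (hZ.mul_right (c2 hE))
  -- On the eigenspace `x = 1` a controlled flip is trivial, on `x = -1` it is a reflection.
  have plus : ∀ A : R, (1 + x) * (1 - A + x * A) = (1 + x) * 1 := fun A => by
    have : (1 + x) * (1 - A + x * A) = 1 + x - A + x * x * A := by noncomm_ring
    rw [this, hx]; noncomm_ring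
  have minus : ∀ A : R, (1 - x) * (1 - A + x * A) = (1 - x) * (1 - 2 * A) := fun A => by
    have : (1 - x) * (1 - A + x * A) = 1 - x - A + 2 * (x * A) - x * x * A := by noncomm_ring
    rw [this, hx]; noncomm_ring
  have e1 : (1 + x) * Rd ^ 4 = 1 + x := by
    have h1 : (1 + x) * Rd = (1 + x) * Z := by
      have := mul_mul_absorb (mul_mul_absorb (plus P) (rfl : (1 + x) * Z = (1 + x) * Z)
        (Commute.one_right _)) (plus E) ((Commute.one_right (1 + x)).mul_right
          ((Commute.one_left Z).add_left xZ))
      rw [hRd, this, one_mul, mul_one]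
    rw [mul_pow_absorb h1 ((Commute.one_left Z).add_left xZ), show Z ^ 4 = Z * Z * (Z * Z) by
      noncomm_ring, hZ, mul_one, mul_one]
  have e2 : (1 - x) * Rd ^ 4 = (1 - x) * W := by
    have cP : Commute (1 - x) (1 - 2 * P) := c2 ((Commute.one_left P).sub_left xP)
    have cZ : Commute (1 - x) Z := (Commute.one_left Z).sub_left xZ
    refine mul_pow_absorb ?_ (cV ((Commute.one_left P).sub_left xP)
      ((Commute.one_left E).sub_left xE) cZ) 4
    rw [hRd, mul_assoc]
    exact mul_mul_absorb (minus P) (mul_mul_absorb rfl (minus E) cZ) cP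
  have nW : Commute n W := (cV nP nE nZ).pow_right 4
  have xW : Commute x W := (cV xP xE xZ).pow_right 4
  -- Doubling allows the decomposition `2 = (1 + x) + (1 - x)` without a division. The block of the
  -- circuit is thus half of `1 - W`.
  have e3 : n * (x * Rd ^ 4) * n + n * (x * Rd ^ 4) * n = n * (1 - W) := by
    have : n * (x * Rd ^ 4) * n + n * (x * Rd ^ 4) * n =
        n * x * ((1 + x) * Rd ^ 4 + (1 - x) * Rd ^ 4) * n := by noncomm_ring
    rw [this, e1, e2]
    have : n * x * (1 + x + (1 - x) * W) * n =
        n * x * n + n * (x * x) * n + n * x * (W * n) - n * (x * x) * (W * n) := by noncomm_ring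
    rw [this, hx, ← nW.eq, ← mul_assoc (n * x), hnx, mul_one, ← mul_assoc n n, hn]
    noncomm_ring
  constructor
  · intro h
    rw [h, add_zero] at e3
    -- Since `W` commutes with `x`, conjugation by `x` carries the vanishing from the range of `n`
    -- to that of `1 - n`.
    have h1 : x * (n * (1 - W)) * x = (1 - n) * (1 - W) := by
      rw [← hxn]
      have : Commute x (1 - W) := (Commute.one_right x).sub_right xW
      rw [← mul_assoc, mul_assoc _ _ x, ← this.eq, mul_assoc, mul_assoc, mul_assoc]
    rw [← e3, mul_zero, zero_mul] at h1
    have : 1 - W = n * (1 - W) + (1 - n) * (1 - W) := by noncomm_ring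
    rw [← e3, ← h1, add_zero, sub_eq_zero] at this
    exact this.symm
  · intro h
    rw [h, sub_self, mul_zero] at e3
    exact h2 _ e3

variable [Algebra ℂ R]

/-- With `Q = V P V`, the square of `(1 - 2P) V` is the product of the reflections in `P` and `Q`,
so its fourth power is `1` iff `P` and `Q` commute. If `c = 0` then `P Q = Q P = 0`. Otherwise
commuting would force `c² = 1`. -/
theorem reflections_pow_eq_one_iff {P V : R} {c : ℂ} (hP : P * P = P) (hP0 : P ≠ 0)
    (hV : V * V = 1) (hc : P * V * P = c • P) (hc1 : c ^ 2 ≠ 1) :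
    ((1 - 2 * P) * V) ^ 4 = 1 ↔ c = 0 := by
  set Q := V * P * V with hQ
  have QQ : Q * Q = Q := by
    calc V * P * V * (V * P * V) = V * P * (V * V) * P * V := by noncomm_ring
      _ = V * (P * P) * V := by rw [hV]; noncomm_ring
      _ = _ := by rw [hP]
  have PQ : P * Q = c • (P * V) := by
    rw [hQ, show P * (V * P * V) = P * V * P * V by noncomm_ring, hc, smul_mul_assoc]
  have QP : Q * P = c • (V * P) := by
    rw [hQ, show V * P * V * P = V * (P * V * P) by noncomm_ring, hc, mul_smul_comm]
  have e1 : ((1 - 2 * P) * V) ^ 4 = (1 - 2 * P) * (1 - 2 * Q) * ((1 - 2 * P) * (1 - 2 * Q)) := by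
    have : ((1 - 2 * P) * V) * ((1 - 2 * P) * V) = (1 - 2 * P) * (1 - 2 * Q) := by
      have : ((1 - 2 * P) * V) * ((1 - 2 * P) * V) =
          (1 - 2 * P) * (V * V - 2 * (V * P * V)) := by noncomm_ring
      rw [this, hV]
    rw [← this]; noncomm_ring
  have sP : (1 - 2 * P) * (1 - 2 * P) = 1 := by
    have : (1 - 2 * P) * (1 - 2 * P) = 1 - 4 * P + 4 * (P * P) := by noncomm_ring
    rw [this, hP]; noncomm_ring
  have sQ : (1 - 2 * Q) * (1 - 2 * Q) = 1 := by
    have : (1 - 2 * Q) * (1 - 2 * Q) = 1 - 4 * Q + 4 * (Q * Q) := by noncomm_ring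
    rw [this, QQ]; noncomm_ring
  rw [e1]
  constructor
  · intro h
    have h1 : (1 - 2 * P) * (1 - 2 * Q) = (1 - 2 * Q) * (1 - 2 * P) := by
      calc (1 - 2 * P) * (1 - 2 * Q)
          = (1 - 2 * P) * (1 - 2 * Q) *
              ((1 - 2 * P) * ((1 - 2 * Q) * (1 - 2 * Q)) * (1 - 2 * P)) := by
            rw [sQ, mul_one, sP, mul_one]
        _ = (1 - 2 * P) * (1 - 2 * Q) *
            ((1 - 2 * P) * (1 - 2 * Q)) * ((1 - 2 * Q) * (1 - 2 * P)) := by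
            noncomm_ring
        _ = _ := by rw [h, one_mul]
    have h2 : P * Q = Q * P := by
      have : (4 : ℂ) • (P * Q) = (4 : ℂ) • (Q * P) := by
        have e : ∀ a b : R, (4 : ℂ) • (a * b) =
            (1 - 2 * a) * (1 - 2 * b) - 1 + 2 * a + 2 * b := fun a b => by
          have : (4 : ℂ) • (a * b) = 4 * (a * b) := by
            rw [show (4 : ℂ) = ((4 : ℕ) : ℂ) by norm_num, Nat.cast_smul_eq_nsmul, nsmul_eq_mul]
            norm_num
          rw [this]; noncomm_ring
        rw [e, e, h1]; noncomm_ring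
      exact smul_right_injective R (by norm_num : (4 : ℂ) ≠ 0) this
    rw [PQ, QP] at h2
    -- Commuting means `c P V = c V P`. Multiplying by `P` on the left gives `c P V = c² P`; a
    -- further factor `V` on the right gives `c P = c² P V`. Together `c P = c³ P`.
    have h3 : c • (P * V) = (c ^ 2) • P := by
      have := congrArg (P * ·) h2
      simp only [mul_smul_comm] at this
      rw [← mul_assoc, hP, ← mul_assoc, hc, smul_smul] at this
      rw [this, pow_two]
    have h4 : c • P = (c ^ 2) • (P * V) := by
      have := congrArg (· * V) h3
      simp only [smul_mul_assoc, mul_assoc, hV, mul_one] at this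
      exact this
    have h5 : (c * (1 - c ^ 2)) • P = 0 := by
      rw [mul_sub, sub_smul, mul_one, sub_eq_zero]
      calc c • P = c • c • (P * V) := by rw [h4, smul_smul, pow_two]
        _ = _ := by rw [h3, smul_smul]
    rcases smul_eq_zero.1 h5 with h6 | h6
    · rcases mul_eq_zero.1 h6 with h7 | h7
      · exact h7
      · exact absurd (sub_eq_zero.1 h7).symm hc1
    · exact absurd h6 hP0
  · rintro rfl
    rw [zero_smul] at PQ QP
    have h1 : (1 - 2 * P) * (1 - 2 * Q) = (1 - 2 * Q) * (1 - 2 * P) := by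
      have e : ∀ a b : R, (1 - 2 * a) * (1 - 2 * b) = 1 - 2 * a - 2 * b + 4 * (a * b) :=
        fun a b => by noncomm_ring
      rw [e, e, PQ, QP]; noncomm_ring
    nth_rewrite 2 [h1]
    rw [mul_assoc, ← mul_assoc (1 - 2 * Q), sQ, one_mul, sP]

end algebra

/-! ## The acceptance probability -/

/-- Cyclicity of the trace and `Π² = Π` turn the probability into `2^{-m} Tr(B B†)` with `B = Π U
Π`, and `Tr(B B†)` is the squared Frobenius norm of `B`. -/
theorem dqc1AcceptProb_eq_zero_iff {m : ℕ} (U : QOp (m + 1)) :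
    dqc1AcceptProb U = 0 ↔ proj0 m * U * proj0 m = 0 := by
  have hn : proj0 m * proj0 m = proj0 m := by
    rw [proj0, Matrix.diagonal_mul_diagonal]
    congr 1; funext y; split_ifs <;> simp
  have hs : (proj0 m).conjTranspose = proj0 m := by
    rw [proj0, Matrix.diagonal_conjTranspose]
    congr 1; funext y
    simp only [Pi.star_apply]
    split_ifs <;> simp
  set B := proj0 m * U * proj0 m with hB
  have h1 : Matrix.trace (proj0 m * (U * (((2 : ℂ) ^ m)⁻¹ • proj0 m) * U.conjTranspose)) =
      ((2 : ℂ) ^ m)⁻¹ * (B * B.conjTranspose).trace := by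
    have h3 : B * B.conjTranspose = proj0 m * U * proj0 m * U.conjTranspose * proj0 m := by
      rw [hB, Matrix.conjTranspose_mul, Matrix.conjTranspose_mul, hs]
      calc _ = proj0 m * U * (proj0 m * proj0 m) * U.conjTranspose * proj0 m := by noncomm_ring
        _ = _ := by rw [hn]
    have h4 : (B * B.conjTranspose).trace =
        (proj0 m * (U * proj0 m * U.conjTranspose)).trace := by
      rw [h3, Matrix.trace_mul_comm, ← mul_assoc, ← mul_assoc, ← mul_assoc, hn]
      simp only [mul_assoc]
    rw [h4, mul_smul_comm, smul_mul_assoc, mul_smul_comm, Matrix.trace_smul, smul_eq_mul]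
  have h5 : (2 : ℂ) ^ m = ((2 ^ m : ℝ) : ℂ) := by push_cast; rfl
  rw [dqc1AcceptProb, h1, h5, ← Complex.ofReal_inv, Complex.re_ofReal_mul, mul_eq_zero]
  have h6 : (B * B.conjTranspose).trace = 0 ↔ B = 0 := by
    open scoped ComplexOrder in
    exact Matrix.trace_mul_conjTranspose_self_eq_zero_iff
  have h7 : (B * B.conjTranspose).trace.im = 0 := by
    open scoped ComplexOrder in
    exact (Complex.nonneg_iff.1 (Matrix.posSemidef_self_mul_conjTranspose B).trace_nonneg).2.symm
  rw [← h6, Complex.ext_iff]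
  simp [h7]

/-! ### The unitary of the whole circuit. -/

namespace RGate

theorem h_notMem_desc {n s : ℕ} (C : BoolCircuit n s) (i : ℕ) : h i ∉ C.desc := by
  induction C with
  | nil => simp [BoolCircuit.desc]
  | not C _ ih => simp [BoolCircuit.desc, notBlock, ih]
  | and C _ _ ih => simp [BoolCircuit.desc, andBlock, ih]
  | or C _ _ ih => simp [BoolCircuit.desc, andBlock, orBlock, ih]

theorem h_notMem_checkHalf {n s : ℕ} (C : BoolCircuit n s) (i : ℕ) : h i ∉ C.checkHalf := by
  have h1 := h_notMem_desc C i
  have h2 := mt (C.mem_desc_of_mem_asc (h i)) h1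
  simp [BoolCircuit.checkHalf, h1, h2]

theorem h_notMem_onesHalf (m i : ℕ) : h i ∉ onesHalf m := by
  have h1 : h i ∉ onesDesc m := by
    induction m with
    | zero => simp [onesDesc]
    | succ m ih => simp [onesDesc, ih]
  have h2 := mt (mem_onesDesc_of_mem_onesAsc m (h i)) h1
  simp [onesHalf, h1, h2]

end RGate

namespace BoolCircuit

variable {n s N : ℕ}

theorem unitaryOf_checkHalf (C : BoolCircuit n s) (hs : 0 < s) (hN : 2 * (n + s) + 4 ≤ N) :
    unitaryOf N C.checkHalf * unitaryOf N C.checkHalf =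
      1 - dg (fun b => ind (C.consistent b && xor (b (2 * (n + s) + 2)) (b 2))) +
        pm (flipBit 0) *
          dg (fun b => ind (C.consistent b && xor (b (2 * (n + s) + 2)) (b 2))) := by
  rw [← unitaryOf_append, unitaryOf_eq_pm, funext (C.acts_checkHalf), pm_ctrl_flip]
  · intro g hg
    exact C.valid_checkHalf hs hN g (by simpa using hg)
  · intro i hi
    exact RGate.h_notMem_checkHalf C i (by simpa using hi)

end BoolCircuit

theorem unitaryOf_onesHalf {N m : ℕ} (hN : 2 * m + 4 ≤ N) :
    unitaryOf N (onesHalf m) * unitaryOf N (onesHalf m) =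
      1 - onesProj N m + pm (flipBit 0) * onesProj N m := by
  rw [← unitaryOf_append, unitaryOf_eq_pm, funext (acts_onesHalf m), pm_ctrl_flip, onesProj]
  · intro g hg
    exact valid_onesHalf hN g (by simpa using hg)
  · intro i hi
    exact RGate.h_notMem_onesHalf m i (by simpa using hi)

theorem unitaryOf_auxPhase {N : ℕ} (hN : 4 ≤ N) :
    unitaryOf N auxPhase = dg fun b => sgn (b 2) := by
  rw [← had_mul_flip_mul_had (show 2 < N by omega), auxPhase,
    show [RGate.h 2, .x 2, .h 2] = [.h 2] ++ ([.x 2] ++ [.h 2]) from rfl, unitaryOf_append,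
    unitaryOf_append, unitaryOf_h (by omega),
    unitaryOf_eq_pm_act (g := .x 2) (show 2 < N by omega) (by simp)]
  rfl

theorem allOnes_flipBit_zero (m : ℕ) (b : ℕ → Bool) : allOnes m (flipBit 0 b) = allOnes m b :=
  (toggles_ones m).dep _ _ fun _ _ hv => flipBit_of_ne hv _

namespace BoolCircuit

variable {n s : ℕ}

/-- The Hadamard layer commutes with the flip of the clean qubit, so conjugating the flip controlled
by the projector `D` only replaces `D` by `H D H`. -/
theorem unitaryOf_rgates {N : ℕ} (C : BoolCircuit n s) (hs : 0 < s) (hN : 2 * (n + s) + 4 ≤ N) :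
    unitaryOf N C.rgates = pm (flipBit 0) *
      ((1 - unitaryOf N (hadamards (n + s)) * onesProj N (n + s) *
          unitaryOf N (hadamards (n + s)) +
        pm (flipBit 0) * (unitaryOf N (hadamards (n + s)) * onesProj N (n + s) *
          unitaryOf N (hadamards (n + s)))) * dg (fun b => sgn (b 2)) *
      (1 - dg (fun b => ind (C.consistent b && xor (b (2 * (n + s) + 2)) (b 2))) +
        pm (flipBit 0) *
          dg (fun b => ind (C.consistent b && xor (b (2 * (n + s) + 2)) (b 2))))) ^ 4 := by
  have h1 := C.unitaryOf_checkHalf hs hN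
  have h2 := unitaryOf_onesHalf hN
  have h3 := hadamards_sq hN
  have h4 : Commute (unitaryOf N (hadamards (n + s))) (pm (flipBit 0)) :=
    commute_hadamards hN fun j _ _ => commute_had_pm (by omega) (by omega) (by omega)
  have hr : unitaryOf N C.round = (1 - unitaryOf N (hadamards (n + s)) * onesProj N (n + s) *
          unitaryOf N (hadamards (n + s)) +
        pm (flipBit 0) * (unitaryOf N (hadamards (n + s)) * onesProj N (n + s) *
          unitaryOf N (hadamards (n + s)))) * dg (fun b => sgn (b 2)) *
      (1 - dg (fun b => ind (C.consistent b && xor (b (2 * (n + s) + 2)) (b 2))) +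
        pm (flipBit 0) *
          dg (fun b => ind (C.consistent b && xor (b (2 * (n + s) + 2)) (b 2)))) := by
    simp only [round, unitaryOf_append]
    rw [← h1, unitaryOf_auxPhase (by omega)]
    set H := unitaryOf N (hadamards (n + s))
    set D := onesProj N (n + s)
    set x : QOp N := pm (flipBit 0)
    set Z : QOp N := dg fun b => sgn (b 2)
    have : 1 - H * D * H + x * (H * D * H) =
        H * (unitaryOf N (onesHalf (n + s)) * unitaryOf N (onesHalf (n + s))) * H := by
      rw [h2]
      calc 1 - H * D * H + x * (H * D * H) = 1 - H * D * H + (x * H) * D * H := by noncomm_ring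
        _ = H * H - H * D * H + (H * x) * D * H := by rw [h3, h4.eq]
        _ = _ := by noncomm_ring
    rw [this]
    noncomm_ring
  rw [← hr]
  simp only [rgates, unitaryOf_append]
  rw [unitaryOf_eq_pm_act (g := .x 0) (show 0 < N by omega) (by simp)]
  have : (RGate.x 0).act = flipBit 0 := rfl
  rw [this]
  noncomm_ring

theorem acceptProb_toDQC1_eq_zero_iff (C : BoolCircuit n (s + 1)) (k : ℕ) :
    (C.toDQC1 k).acceptProb = 0 ↔ C.gap = 0 := by
  have hN : 2 * (n + (s + 1)) + 4 ≤ 2 * (n + (s + 1)) + 3 + k + 1 := by omega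
  rw [DQC1.acceptProb, dqc1AcceptProb_eq_zero_iff]
  change proj0 (2 * (n + (s + 1)) + 3 + k) * unitaryOf (2 * (n + (s + 1)) + 3 + k + 1) C.rgates *
    proj0 (2 * (n + (s + 1)) + 3 + k) = 0 ↔ _
  rw [C.unitaryOf_rgates (by omega) hN]
  have hp : proj0 (2 * (n + (s + 1)) + 3 + k) = dg fun b => ind (!b 0) := by
    rw [proj0, dg]
    congr 1; funext y
    have : extBits y 0 = y 0 := extBits_val y 0
    rw [this]
    cases y 0 <;> simp [ind]
  rw [hp]
  -- Idle qubits only enlarge `N`; the rest of the argument needs nothing but the lower bound on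
  -- `N`.
  generalize 2 * (n + (s + 1)) + 3 + k + 1 = N at hN ⊢
  have h3 := hadamards_sq hN
  have hx := pm_flipBit_sq (N := N) (i := 0) (by omega)
  have hH : ∀ v : (ℕ → Bool) → ℂ, (∀ j b, 2 ≤ j → v (flipBit j b) = v b) →
      Commute (unitaryOf N (hadamards (n + (s + 1)))) (dg v) := fun v hv =>
    commute_hadamards hN fun j hj _ => commute_had_dg fun b => hv j b hj
  have hHx : Commute (unitaryOf N (hadamards (n + (s + 1)))) (pm (flipBit 0)) :=
    commute_hadamards hN fun j _ _ => commute_had_pm (by omega) (by omega) (by omega)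
  have hHn := hH (fun b => ind (!b 0)) fun j b hj => by rw [flipBit_of_ne (by omega)]
  have hDx : Commute (pm (flipBit 0)) (onesProj N (n + (s + 1))) := commute_pm_dg fun b => by
    rw [allOnes_flipBit_zero, flipBit_of_ne (by omega)]
  have hDD : onesProj N (n + (s + 1)) * onesProj N (n + (s + 1)) = onesProj N (n + (s + 1)) := by
    rw [onesProj, dg_mul]; congr 1; funext b; exact ind_mul_self _
  have hsand := onesProj_sandwich hN C.phase
  have hnx : (dg fun b => ind (!b 0)) * pm (flipBit 0) =
      pm (flipBit 0) * (1 - dg fun b => ind (!b 0) : QOp N) := by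
    rw [dg_mul_pm, ← dg_one, dg_sub]
    congr 2; funext b
    rw [flipBit_self]
    cases b 0 <;> simp [ind]
  have hnn : (dg fun b => ind (!b 0)) * (dg fun b => ind (!b 0)) =
      (dg fun b => ind (!b 0) : QOp N) := by
    rw [dg_mul]; congr 1; funext b; exact ind_mul_self _
  have hV : (dg (fun b => sgn (b 2)) *
      (1 - 2 * dg (fun b => ind (C.consistent b && xor (b (2 * (n + (s + 1)) + 2)) (b 2)))) :
        QOp N) = dg C.phase := by
    rw [← dg_one, show ∀ a : QOp N, 2 * a = (2 : ℂ) • a from fun a => by rw [two_smul, two_mul],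
      dg_smul, dg_sub, dg_mul]
    rfl
  have hEx : ∀ b, ind (C.consistent (flipBit 0 b) &&
      xor (flipBit 0 b (2 * (n + (s + 1)) + 2)) (flipBit 0 b 2)) =
        ind (C.consistent b && xor (b (2 * (n + (s + 1)) + 2)) (b 2)) := fun b => by
    rw [flipBit_of_ne (by omega), flipBit_of_ne (by omega),
      C.toggles_chain.dep _ _ fun _ _ hv => flipBit_of_ne hv _]
  have hm : (dg (bitMean 2 (wireMean (n + (s + 1)) C.phase)) : QOp N) =
      ((1 / 2) ^ (n + (s + 1)) * (C.gap : ℂ)) • 1 := by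
    rw [funext C.mean_phase, ← dg_one, dg_smul]
    simp
  rw [hm, smul_one_mul] at hsand
  have hD0 : onesProj N (n + (s + 1)) ≠ 0 := fun h => by
    have := congrFun (congrFun h fun _ => true) fun _ => true
    rw [onesProj, dg, Matrix.diagonal_apply_eq, Matrix.zero_apply] at this
    have h1 : allOnes (n + (s + 1)) (extBits fun _ : Fin N => true) = true := by
      rw [allOnes_eq_true_iff]
      intro w hw
      simp only [extBits]
      rw [dif_pos (by omega)]
    have h2 : extBits (fun _ : Fin N => true) 2 = true := by
      simp only [extBits]
      rw [dif_pos (by omega)]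
    simp [h1, h2, ind] at this
  have hVV : (dg C.phase * dg C.phase : QOp N) = 1 := by
    rw [dg_mul, ← dg_one]
    congr 1; funext b
    rw [phase]
    generalize (C.consistent b && xor (b (2 * (n + (s + 1)) + 2)) (b 2)) = p
    cases b 2 <;> cases p <;> norm_num [sgn, ind]
  -- This is where at least one gate is needed: `|gap| ≤ 2^n` lies strictly below the number
  -- `2^{n+s+1}` of assignments to the wires.
  have hg : ((1 / 2) ^ (n + (s + 1)) * (C.gap : ℂ)) ^ 2 ≠ 1 := by
    intro h
    have h1 : C.gap ^ 2 = (2 ^ (n + (s + 1))) ^ 2 := by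
      have : ((C.gap ^ 2 : ℤ) : ℂ) = ((2 ^ (n + (s + 1))) ^ 2 : ℤ) := by
        push_cast
        rw [mul_pow, one_div, inv_pow, inv_pow, inv_mul_eq_one₀ (by simp)] at h
        exact h.symm
      exact_mod_cast this
    have h2 := pow_le_pow_left₀ (abs_nonneg _) C.abs_gap_le 2
    rw [sq_abs, h1] at h2
    have h3 : (2 : ℤ) ^ n < 2 ^ (n + (s + 1)) := pow_lt_pow_right₀ (by norm_num) (by omega)
    exact absurd h2 (not_le.2 (pow_lt_pow_left₀ h3 (by positivity) (by norm_num)))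
  set H := unitaryOf N (hadamards (n + (s + 1)))
  set D := onesProj N (n + (s + 1))
  set x : QOp N := pm (flipBit 0)
  set ν : QOp N := dg fun b => ind (!b 0)
  have hDn : Commute ν D := dg_commute _ _
  rw [compress_eq_zero_iff (x := x) (n := ν) (P := H * D * H) ?_ hx hnn ?_ ?_
    ((hHx.symm.mul_right hDx).mul_right hHx.symm) (commute_pm_dg hEx)
    (commute_pm_dg fun b => by rw [flipBit_of_ne (by omega)])
    ((hHn.symm.mul_right hDn).mul_right hHn.symm) (dg_commute _ _) (dg_commute _ _)
    (dg_sgn_sq 2), hV, reflections_pow_eq_one_iff (c := (1 / 2) ^ (n + (s + 1)) * (C.gap : ℂ))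
    ?_ ?_ hVV ?_ hg]
  · simp
  · calc H * D * H * (H * D * H) = H * D * (H * H) * D * H := by noncomm_ring
      _ = H * (D * D) * H := by rw [h3]; noncomm_ring
      _ = _ := by rw [hDD]
  · intro h
    apply hD0
    calc D = H * H * D * (H * H) := by rw [h3]; noncomm_ring
      _ = H * (H * D * H) * H := by noncomm_ring
      _ = 0 := by rw [h]; noncomm_ring
  · calc H * D * H * dg C.phase * (H * D * H) = H * (D * H * dg C.phase * H * D) * H := by
          noncomm_ring
      _ = _ := by rw [hsand, mul_smul_comm, smul_mul_assoc]
  · intro A hA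
    rw [← two_smul ℂ A] at hA
    exact (smul_eq_zero.1 hA).resolve_left (by norm_num)
  · rw [hnx, mul_assoc, sub_mul, one_mul, hnn, sub_self, mul_zero]
  · rw [mul_assoc, hnx, ← mul_assoc, hx, one_mul]

end BoolCircuit

/-! ## Countably many machines suffice -/

instance : Finite Turing.Dir :=
  Finite.of_surjective (fun b : Bool => if b then Turing.Dir.left else Turing.Dir.right)
    fun d => by cases d; exacts [⟨true, rfl⟩, ⟨false, rfl⟩]

namespace Machine

/-- Machines with standard sets of states and of work symbols. -/
abbrev Code : Type :=
  Σ a b k : ℕ, Fin a × (Fin a → Option Bool) ×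
    (Bool → Fin a → (Fin (k + 1) → Option (Letter ⊕ Fin b)) →
      Fin a × (Fin (k + 1) → Option (Letter ⊕ Fin b) × Option Turing.Dir))

instance : Countable Code := by
  have h1 : ∀ b k : ℕ, Countable (Fin (k + 1) → Option (Letter ⊕ Fin b) × Option Turing.Dir) :=
    fun _ _ => inferInstance
  have h2 : ∀ b k : ℕ, Finite (Fin (k + 1) → Option (Letter ⊕ Fin b)) := fun _ _ => inferInstance
  have h3 : ∀ a b k : ℕ, Countable ((Fin (k + 1) → Option (Letter ⊕ Fin b)) →
      Fin a × (Fin (k + 1) → Option (Letter ⊕ Fin b) × Option Turing.Dir)) :=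
    fun a b k => @instCountableForallOfFinite _ _ (h2 b k) fun _ => inferInstance
  infer_instance

/-- The machine with a given code. -/
def ofCode (c : Code) : Machine where
  State := Fin c.1
  Work := Fin c.2.1
  k := c.2.2.1
  start := c.2.2.2.1
  verdict := c.2.2.2.2.1
  trans := c.2.2.2.2.2

theorem map_act {Γ Γ' : Type} [Inhabited Γ] [Inhabited Γ'] (f : Turing.PointedMap Γ Γ')
    (T : Turing.Tape Γ) (u : Γ × Option Turing.Dir) :
    (act T u).map f = act (T.map f) (f u.1, u.2) := by
  obtain ⟨a, _ | d⟩ := u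
  · exact Turing.Tape.map_write f a T
  · exact (Turing.Tape.map_move f _ d).trans (congrArg _ (Turing.Tape.map_write f a T))

/-- Renaming the states and the work symbols does not change the outcome. -/
theorem exists_ofCode_outcome_eq (M : Machine) :
    ∃ c : Code, ∀ w bs, (ofCode c).outcome w bs = M.outcome w bs := by
  obtain ⟨a, ⟨e⟩⟩ := Finite.exists_equiv_fin M.State
  obtain ⟨b, ⟨g⟩⟩ := Finite.exists_equiv_fin M.Work
  let G : Option (Letter ⊕ M.Work) ≃ Option (Letter ⊕ Fin b) :=
    Equiv.optionCongr ((Equiv.refl Letter).sumCongr g)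
  -- The renaming fixes the blank and the input letters, so it carries initial tapes to initial
  -- tapes.
  let f : Turing.PointedMap (Option (Letter ⊕ M.Work)) (Option (Letter ⊕ Fin b)) := ⟨G, rfl⟩
  let c : Code := ⟨a, b, M.k, e M.start, fun q => M.verdict (e.symm q), fun d q h =>
    (e (M.trans d (e.symm q) fun j => G.symm (h j)).1, fun j =>
      (G ((M.trans d (e.symm q) fun j => G.symm (h j)).2 j).1,
        ((M.trans d (e.symm q) fun j => G.symm (h j)).2 j).2))⟩
  let R : M.Cfg → (ofCode c).Cfg := fun x => ⟨e x.state, fun j => (x.tapes j).map f⟩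
  have hstep : ∀ x d, (ofCode c).step (R x) d = R (M.step x d) := by
    intro x d
    have hv : (ofCode c).verdict (R x).state = M.verdict x.state := by
      change M.verdict (e.symm (e x.state)) = _
      rw [Equiv.symm_apply_apply]
    unfold step
    rw [hv]
    cases h : M.verdict x.state with
    | some y => rfl
    | none =>
      have ht : (M.trans d (e.symm (R x).state)
          fun j : Fin (M.k + 1) => G.symm ((R x).tapes j).head) =
          M.trans d x.state fun j => (x.tapes j).head := by
        change M.trans d (e.symm (e x.state))
          (fun j : Fin (M.k + 1) => G.symm ((x.tapes j).map f).head) = _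
        rw [Equiv.symm_apply_apply]
        congr 1
        funext j
        rw [Turing.Tape.map_fst]
        exact Equiv.symm_apply_apply _ _
      have ht' : (ofCode c).trans d (R x).state (fun j => ((R x).tapes j).head) =
          (e (M.trans d x.state fun j => (x.tapes j).head).1, fun j =>
            (G ((M.trans d x.state fun j => (x.tapes j).head).2 j).1,
              ((M.trans d x.state fun j => (x.tapes j).head).2 j).2)) := by
        rw [← ht]; rfl
      simp only [ht']
      change Cfg.mk _ _ = Cfg.mk _ _
      congr 1
      funext j
      exact (map_act f (x.tapes j) _).symm
  have hinit : ∀ w, (ofCode c).init w = R (M.init w) := by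
    intro w
    change Cfg.mk _ _ = Cfg.mk _ _
    congr 1
    funext j
    have h0 : (Turing.Tape.mk₁ (w.map fun s => some (Sum.inl s))).map f =
        Turing.Tape.mk₁ (w.map fun s => some (Sum.inl s)) := by
      rw [Turing.Tape.map_mk₁, List.map_map]; rfl
    have h1 : (Turing.Tape.mk₁ []).map f = Turing.Tape.mk₁ [] := Turing.Tape.map_mk₁ _ _
    by_cases hj : j = (0 : Fin (M.k + 1))
    · exact (if_pos hj).trans (h0.symm.trans (congrArg (Turing.Tape.map f) (if_pos hj).symm))
    · exact (if_neg hj).trans (h1.symm.trans (congrArg (Turing.Tape.map f) (if_neg hj).symm))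
  have hrun : ∀ (bs : List Bool) x, bs.foldl (ofCode c).step (R x) = R (bs.foldl M.step x) := by
    intro bs
    induction bs with
    | nil => intro x; rfl
    | cons d bs ih => intro x; rw [List.foldl_cons, List.foldl_cons, hstep, ih]
  refine ⟨c, fun w bs => ?_⟩
  unfold outcome run
  rw [hinit, hrun]
  change M.verdict (e.symm (e _)) = _
  rw [Equiv.symm_apply_apply]

/-- One family of circuits has to defeat every machine, and the diagonal argument handles only a
sequence of them. Agreement of outcomes suffices, since sampling is defined through outcomes alone.
-/
theorem exists_enumeration :
    ∃ F : ℕ → Machine, ∀ M : Machine, ∃ i, ∀ w bs, (F i).outcome w bs = M.outcome w bs := by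
  have : Nonempty Code := ⟨⟨1, 0, 0, 0, fun _ => none, fun _ q h => (q, fun j => (h j, none))⟩⟩
  obtain ⟨e, he⟩ := exists_surjective_nat Code
  refine ⟨fun i => ofCode (e i), fun M => ?_⟩
  obtain ⟨c, hc⟩ := M.exists_ofCode_outcome_eq
  obtain ⟨i, rfl⟩ := he c
  exact ⟨i, hc⟩

theorem Samples.congr {M M' : Machine} (h : ∀ w bs, M'.outcome w bs = M.outcome w bs) {D : DQC1}
    {τ ε : ℝ} (hM : M.Samples D τ ε) : M'.Samples D τ ε := by
  simpa only [Samples, HaltsWithin, acceptProb, h] using hM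

end Machine

/-! ## Growth of the running times -/

theorem monotone_eval_nat (p : Polynomial ℕ) : Monotone fun n : ℕ => p.eval n := by
  intro m n h
  dsimp only
  rw [Polynomial.eval_eq_sum_range, Polynomial.eval_eq_sum_range]
  gcongr

theorem isLittleO_eval_pow (p : Polynomial ℕ) {r : ℝ} (hr : 1 < r) :
    (fun n : ℕ => ((p.eval n : ℕ) : ℝ)) =o[atTop] fun n : ℕ => r ^ n := by
  simp only [Polynomial.eval_eq_sum_range, Nat.cast_sum, Nat.cast_mul, Nat.cast_pow]
  refine Asymptotics.IsLittleO.fun_sum fun i _ =>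
    (isLittleO_pow_const_const_pow_of_one_lt (R := ℝ) i hr).const_mul_left _

/-- A polynomial overhead and a shift of the size do not matter for `2^{(1-a)n}`, up to a change
of `a`. -/
theorem eventually_poly_add_le (P : Polynomial ℕ) (c : ℕ) {a : ℝ} (ha : 0 < a) :
    ∀ᶠ n : ℕ in atTop, ((P.eval n + ⌊(2 : ℝ) ^ ((1 - a) * ((n + c : ℕ) : ℝ))⌋₊ : ℕ) : ℝ) ≤
      2 ^ ((1 - min a 1 / 2) * (n : ℝ)) := by
  -- Halving leaves room for the overhead: `1 - a ≤ 1 - 2δ < 1 - δ`. Capping at `1` keeps `1 - δ`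
  -- positive, so that the polynomial is dominated also when `a > 1`.
  set δ := min a 1 / 2 with hδ
  have hδ0 : 0 < δ := by positivity
  have h1 : 2 * δ ≤ a := by rw [hδ]; linarith [min_le_left a 1]
  have h2 : 2 * δ ≤ 1 := by rw [hδ]; linarith [min_le_right a 1]
  have hr : (1 : ℝ) < 2 ^ (1 - δ) := Real.one_lt_rpow (by norm_num) (by linarith)
  have hlt : (2 : ℝ) ^ (1 - 2 * δ) < 2 ^ (1 - δ) :=
    Real.rpow_lt_rpow_of_exponent_lt (by norm_num) (by linarith)
  have ho := (isLittleO_eval_pow P hr).add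
    ((isLittleO_pow_pow_of_lt_left (by positivity) hlt).const_mul_left
      ((2 : ℝ) ^ ((1 - 2 * δ) * c)))
  filter_upwards [ho.bound one_pos] with n hn
  rw [one_mul, Real.norm_of_nonneg (by positivity), Real.norm_of_nonneg (by positivity)] at hn
  rw [Real.rpow_mul (by norm_num) (1 - δ) n, Real.rpow_natCast]
  refine le_trans ?_ hn
  rw [Nat.cast_add]
  gcongr
  refine (Nat.floor_le (by positivity)).trans ?_
  rw [← Real.rpow_natCast (_ ^ _) n, ← Real.rpow_mul (by norm_num), ← Real.rpow_add (by norm_num)]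
  refine Real.rpow_le_rpow_of_exponent_le (by norm_num) ?_
  push_cast
  nlinarith [(Nat.cast_nonneg n : (0 : ℝ) ≤ n), (Nat.cast_nonneg c : (0 : ℝ) ≤ c)]

/-! ## Machines fail on infinitely many circuits -/

/-- Under the conjecture, a machine that samples within a multiplicative error below `1` fails
for infinitely many sizes. -/
theorem frequently_not_samples {a : ℝ} (ha : 0 < a) {p : Polynomial ℕ}
    (hp : ∀ (M : Machine) (T : ℕ → ℕ),
      (∀ (n s : ℕ) (f : BoolCircuit n (s + 1)), s + 1 ≤ p.eval n →
        M.HaltsWithin f.encode (T n) ∧ (M.NAccepts f.encode ↔ f.gap ≠ 0)) →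
      ∃ᶠ n : ℕ in atTop, (2 : ℝ) ^ ((1 - min a 1 / 2) * (n : ℝ)) < (T n : ℝ)) (M : Machine) :
    ∃ᶠ N : ℕ in atTop, ∃ (n s : ℕ) (f : BoolCircuit n (s + 1)) (k : ℕ), N = n + k ∧
      s + 1 ≤ p.eval n ∧ ¬ ∃ ε : ℝ, 0 ≤ ε ∧ ε < 1 ∧
        M.Samples (f.toDQC1 k) ((2 : ℝ) ^ ((1 - a) * (N : ℝ))) ε := by
  intro hev
  -- Suppose `M` fails at no size from `c` on. The conjecture speaks of algorithms that are correct
  -- for every `n`, so small `n` may not be left out. Adding `c` idle qubits places a circuit with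
  -- `n` inputs at size `n + c ≥ c`, and the factor in the running time due to this shift is a
  -- constant.
  obtain ⟨c, hc⟩ := eventually_atTop.1 hev
  set P : Polynomial ℕ := Polynomial.C (1000000 + 100 * c) * (Polynomial.X + p + 1) ^ 2 with hP
  refine hp (Machine.after M (translation M.k c M.Work)) (fun n =>
    P.eval n + ⌊(2 : ℝ) ^ ((1 - a) * ((n + c : ℕ) : ℝ))⌋₊) (fun n s f hs => ?_)
    ((eventually_poly_add_le P c ha).mono fun n hn => not_lt.2 hn)
  have h := hc (n + c) (by omega)
  have h' : ∃ ε : ℝ, 0 ≤ ε ∧ ε < 1 ∧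
      M.Samples (f.toDQC1 c) ((2 : ℝ) ^ ((1 - a) * ((n + c : ℕ) : ℝ))) ε := by
    by_contra hns
    exact h ⟨n, s, f, c, rfl, hs, hns⟩
  obtain ⟨ε, hε, hε1, T, hT, hhalt, hsamp⟩ := h'
  obtain ⟨σ, hrun, hσ⟩ := runs_translation (k := M.k) (W := M.Work) c f (Nat.succ_pos s)
  have hpos : 0 < 12 := by norm_num
  constructor
  -- The overhead is polynomial in `n` alone because `s + 1 ≤ p(n)`. The running time of the sampler
  -- is an integer, hence at most the floor of its real bound.
  · refine (Machine.haltsWithin_after M _ hpos hrun hσ hhalt).mono (add_le_add ?_ (Nat.le_floor hT))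
    rw [hP]
    simp only [Polynomial.eval_mul, Polynomial.eval_C, Polynomial.eval_pow, Polynomial.eval_add,
      Polynomial.eval_X, Polynomial.eval_one]
    gcongr
  · rw [Machine.nAccepts_after M _ hpos hrun hσ, ← M.acceptProb_ne_zero_iff hhalt,
      ne_eq, ne_eq, ← f.acceptProb_toDQC1_eq_zero_iff c, not_iff_not]
    -- If `q_acc = 0` then `|p_acc| ≤ ε p_acc` with `ε < 1` forces `p_acc = 0`; if `p_acc = 0` the
    -- allowed error is zero.
    constructor
    · intro h0
      rw [h0, sub_zero] at hsamp
      nlinarith [abs_nonneg (f.toDQC1 c).acceptProb, le_abs_self (f.toDQC1 c).acceptProb,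
        neg_abs_le (f.toDQC1 c).acceptProb]
    · intro h0
      rw [h0, mul_zero, zero_sub, abs_neg] at hsamp
      exact abs_nonpos_iff.1 hsamp

theorem theorem1 (conj : GapConjecture) (a : ℝ) (ha : 0 < a) :
    ∃ (q r : Polynomial ℕ) (D : ℕ → DQC1),
      (∀ n : ℕ, (D n).numQubits ≤ q.eval n ∧
        (D n).gates.length ≤ r.eval (D n).numQubits) ∧
      ∀ M : Machine, ∃ᶠ n : ℕ in atTop,
        ¬ ∃ ε : ℝ, 0 ≤ ε ∧ ε < 1 ∧
          M.Samples (D n) ((2 : ℝ) ^ ((1 - a) * (n : ℝ))) ε := by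
  obtain ⟨p, hp⟩ := conj (min a 1 / 2) (by positivity)
  obtain ⟨F, hF⟩ := Machine.exists_enumeration
  -- Task `j` is to defeat the machine with number `(Nat.unpair j).1`, so every machine has
  -- infinitely many tasks. The sizes `φ j` increase strictly and the tasks do not interfere.
  obtain ⟨φ, hφ, hbad⟩ := extraction_forall_of_frequently fun j =>
    frequently_not_samples ha hp (F (Nat.unpair j).1)
  choose n s f k hn hs hns using hbad
  -- At size `N = n + k` the number of qubits is `2 (n + s + 1) + 4 + k`, where `s + 1 ≤ p(n) ≤
  -- p(N)`. Sizes without a task get the empty circuit on one qubit.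
  refine ⟨3 * Polynomial.X + 2 * p + 4, 201 * Polynomial.X,
    Function.extend φ (fun j => (f j).toDQC1 (k j)) fun _ => ⟨0, []⟩, fun N => ?_, fun M => ?_⟩
  · simp only [Polynomial.eval_add, Polynomial.eval_mul, Polynomial.eval_X,
      Polynomial.eval_ofNat]
    by_cases hN : ∃ j, φ j = N
    · obtain ⟨j, rfl⟩ := hN
      rw [hφ.injective.extend_apply]
      refine ⟨?_, BoolCircuit.length_gates_toDQC1_le _ _⟩
      rw [BoolCircuit.numQubits_toDQC1]
      have h1 := hn j
      have h2 := hs j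
      have h3 := monotone_eval_nat p (show n j ≤ φ j by omega)
      dsimp only at h3
      omega
    · rw [Function.extend_apply' _ _ _ hN]
      simp [DQC1.numQubits]
  · obtain ⟨i, hi⟩ := hF M
    -- Beyond any `N` there is a task for machine `i`, namely `Nat.pair i N`, which is at least `N`;
    -- and `φ j ≥ j`.
    refine frequently_atTop.2 fun N => ⟨φ (Nat.pair i N),
      (Nat.right_le_pair i N).trans (hφ.le_apply), ?_⟩
    rw [hφ.injective.extend_apply]
    have h := hns (Nat.pair i N)
    rw [Nat.unpair_pair] at h
    exact fun ⟨ε, h0, h1, hM⟩ => h ⟨ε, h0, h1, hM.congr hi⟩
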